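/- **Definitions.** For readability the monoidal structures below are written as if strict; no strictness is assumed, and in general the structure isomorphisms are inserted. Composition is written right to left. A *right trace* on a monoidal category is a family of operations $\mathrm{Tr}_R^X:\hom(A\otimes X,B\otimes X)\to\hom(A,B)$ satisfying - tightening: $\mathrm{Tr}_R^X((g\otimes \mathrm{id}_X)\circ f\circ(h\otimes \mathrm{id}_X))=g\circ \mathrm{Tr}_R^X f\circ h$; - sliding: $\mathrm{Tr}_R^Y(f\circ(\mathrm{id}_A\otimes g))=\mathrm{Tr}_R^X((\mathrm{id}_B\otimes g)\circ f)$ for $f:A\otimes X\to B\otimes Y$ and $g:Y\to X$; - vanishing: $\mathrm{Tr}_R^I f=f$ and $\mathrm{Tr}_R^{X\otimes Y}f=\mathrm{Tr}_R^X(\mathrm{Tr}_R^Y f)$; - strength: $\mathrm{Tr}_R^X(g\otimes f)=g\otimes \mathrm{Tr}_R^X f$. A *left trace* is a family $\mathrm{Tr}_L^X:\hom(X\otimes A,X\otimes B)\to\hom(A,B)$ satisfying the mirror-image axioms. A *planar traced category* is a monoidal category with a right trace and a left trace satisfying - interchange: $\mathrm{Tr}_R^X(\mathrm{Tr}_L^Y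 f)=\mathrm{Tr}_L^Y(\mathrm{Tr}_R^X f)$ for $f:Y\otimes A\otimes X\to Y\otimes B\otimes X$; - pivoting: $\mathrm{Tr}_R^B(\mathrm{id}_B\otimes f)=\mathrm{Tr}_L^A(f\otimes \mathrm{id}_A)$ for all $f:I\to A\otimes B$, and likewise for all $f:A\otimes B\to I$. A *braided traced category* is a planar traced category with a braiding $\sigma$ such that $(\mathrm{Tr}_L^A\,\sigma_{A,A})\circ(\mathrm{Tr}_R^A\,\sigma_{A,A}^{-1})=\mathrm{id}_A$ for all $A$. A *pivotal category* is a monoidal category in which every object $A$ has a dual $A^*$ with unit $\eta_A:I\to A^*\otimes A$ and counit $\varepsilon_A:A\otimes A^*\to I$ satisfying the two triangle identities, together with a monoidal natural isomorphism $i_A:A\to A^{**}$; it is *braided pivotal* if its monoidal structure is also equipped with a braiding (with no further compatibility required). Every pivotal category carries the canonical trace operations $$\mathrm{Tr}_R^X f=(\mathrm{id}_B\otimes\varepsilon_X)\circ((f\circ(\mathrm{id}_A\otimes i_X^{-1}))\otimes \mathrm{id}_{X^*})\circ(\mathrm{id}_A\otimes\eta_{X^*}),$$ $$\mathrm{Tr}_L^X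 f=(\varepsilon_{X^*}\otimes \mathrm{id}_B)\circ(\mathrm{id}_{X^*}\otimes((i_X\otimes \mathrm{id}_B)\circ f))\circ(\eta_X\otimes \mathrm{id}_A).$$ A *braided traced functor* is a strong monoidal functor $F$, with structure isomorphisms $\phi:FA\otimes FB\to F(A\otimes B)$, that is compatible with the braidings and preserves both traces, that is, $F(\mathrm{Tr}_R^X f)=\mathrm{Tr}_R^{FX}(\phi^{-1}\circ Ff\circ\phi)$ and $F(\mathrm{Tr}_L^X f)=\mathrm{Tr}_L^{FX}(\phi^{-1}\circ Ff\circ\phi)$. **Theorem (Representation of braided traced categories).** For every braided traced category $\mathcal C$ there are a braided pivotal category $\mathrm{Int}(\mathcal C)$ and a full and faithful braided traced functor $F:\mathcal C\to\mathrm{Int}(\mathcal C)$, where $\mathrm{Int}(\mathcal C)$ is equipped with its canonical left and right trace. Moreover, every object of $\mathrm{Int}(\mathcal C)$ is isomorphic to one of the form $FA\otimes (FU)^*$ with $A,U$ objects of $\mathcal C$. -/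

import Mathlib

open CategoryTheory MonoidalCategory

universe v u

/-- The type of families of operations `Tr^X : hom (A ⊗ X, B ⊗ X) → hom (A, B)`. -/
abbrev RightTraceOp (C : Type u) [Category.{v} C] [MonoidalCategory C] : Type (max u v) :=
  ∀ (X : C) {A B : C}, (A ⊗ X ⟶ B ⊗ X) → (A ⟶ B)

/-- The type of families of operations `Tr^X : hom (X ⊗ A, X ⊗ B) → hom (A, B)`. -/
abbrev LeftTraceOp (C : Type u) [Category.{v} C] [MonoidalCategory C] : Type (max u v) :=
  ∀ (X : C) {A B : C}, (X ⊗ A ⟶ X ⊗ B) → (A ⟶ B)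

/-- A right traced category: a monoidal category with a right trace.
No strictness is assumed, so the structure isomorphisms are written out. -/
class RightTracedCategory (C : Type u) [Category.{v} C] [MonoidalCategory C] where
  /-- the right trace -/
  trR : RightTraceOp C
  trR_tightening : ∀ (X : C) {A A' B B' : C} (h : A' ⟶ A) (f : A ⊗ X ⟶ B ⊗ X) (g : B ⟶ B'),
    trR X (h ▷ X ≫ f ≫ g ▷ X) = h ≫ trR X f ≫ g
  trR_sliding : ∀ {X Y A B : C} (f : A ⊗ X ⟶ B ⊗ Y) (g : Y ⟶ X),
    trR Y (A ◁ g ≫ f) = trR X (f ≫ B ◁ g)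
  trR_vanishing_unit : ∀ {A B : C} (f : A ⊗ 𝟙_ C ⟶ B ⊗ 𝟙_ C),
    trR (𝟙_ C) f = (ρ_ A).inv ≫ f ≫ (ρ_ B).hom
  trR_vanishing_tensor : ∀ {X Y A B : C} (f : A ⊗ (X ⊗ Y) ⟶ B ⊗ (X ⊗ Y)),
    trR (X ⊗ Y) f = trR X (trR Y ((α_ A X Y).hom ≫ f ≫ (α_ B X Y).inv))
  trR_strength : ∀ (X : C) {A B D E : C} (g : D ⟶ E) (f : A ⊗ X ⟶ B ⊗ X),
    trR X ((α_ D A X).hom ≫ (g ⊗ₘ f) ≫ (α_ E B X).inv) = g ⊗ₘ trR X f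

/-- A left traced category: the mirror image of a right traced category. -/
class LeftTracedCategory (C : Type u) [Category.{v} C] [MonoidalCategory C] where
  /-- the left trace -/
  trL : LeftTraceOp C
  trL_tightening : ∀ (X : C) {A A' B B' : C} (h : A' ⟶ A) (f : X ⊗ A ⟶ X ⊗ B) (g : B ⟶ B'),
    trL X (X ◁ h ≫ f ≫ X ◁ g) = h ≫ trL X f ≫ g
  trL_sliding : ∀ {X Y A B : C} (f : X ⊗ A ⟶ Y ⊗ B) (g : Y ⟶ X),
    trL Y (g ▷ A ≫ f) = trL X (f ≫ g ▷ B)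
  trL_vanishing_unit : ∀ {A B : C} (f : 𝟙_ C ⊗ A ⟶ 𝟙_ C ⊗ B),
    trL (𝟙_ C) f = (λ_ A).inv ≫ f ≫ (λ_ B).hom
  trL_vanishing_tensor : ∀ {X Y A B : C} (f : (X ⊗ Y) ⊗ A ⟶ (X ⊗ Y) ⊗ B),
    trL (X ⊗ Y) f = trL Y (trL X ((α_ X Y A).inv ≫ f ≫ (α_ X Y B).hom))
  trL_strength : ∀ (X : C) {A B D E : C} (f : X ⊗ A ⟶ X ⊗ B) (g : D ⟶ E),
    trL X ((α_ X A D).inv ≫ (f ⊗ₘ g) ≫ (α_ X B E).hom) = trL X f ⊗ₘ g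

/-- A planar traced category: a right and a left trace related by interchange and pivoting. -/
class PlanarTracedCategory (C : Type u) [Category.{v} C] [MonoidalCategory C]
    extends RightTracedCategory C, LeftTracedCategory C where
  interchange : ∀ {X Y A B : C} (f : (Y ⊗ A) ⊗ X ⟶ (Y ⊗ B) ⊗ X),
    trR X (trL Y ((α_ Y A X).inv ≫ f ≫ (α_ Y B X).hom)) = trL Y (trR X f)
  left_pivoting : ∀ {A B : C} (f : 𝟙_ C ⟶ A ⊗ B),
    trR B ((λ_ B).hom ≫ (ρ_ B).inv ≫ B ◁ f ≫ (α_ B A B).inv) =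
      trL A ((ρ_ A).hom ≫ (λ_ A).inv ≫ f ▷ A ≫ (α_ A B A).hom)
  right_pivoting : ∀ {A B : C} (f : A ⊗ B ⟶ 𝟙_ C),
    trR B ((α_ B A B).hom ≫ B ◁ f ≫ (ρ_ B).hom ≫ (λ_ B).inv) =
      trL A ((α_ A B A).inv ≫ f ▷ A ≫ (λ_ A).hom ≫ (ρ_ A).inv)

/-- A braided traced category: a planar traced category with a braiding `σ` such that
`(Tr_L σ_{A,A}) ∘ (Tr_R σ_{A,A}⁻¹) = id_A`. -/
class BraidedTracedCategory (C : Type u) [Category.{v} C] [MonoidalCategory C]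
    [BraidedCategory C] extends PlanarTracedCategory C where
  trR_comp_trL : ∀ A : C, trR A (β_ A A).inv ≫ trL A (β_ A A).hom = 𝟙 A

section Pivotal

variable {D : Type u} [Category.{v} D] [MonoidalCategory D]

/-- The chosen dual `A*` of `A`, with unit `I ⟶ A* ⊗ A` and counit `A ⊗ A* ⟶ I`.
(In Mathlib's terminology this is a left dual; many authors call it a right dual.) -/
def dualObj [LeftRigidCategory D] (A : D) : D :=
  (LeftRigidCategory.leftDual A).leftDual

/-- The exact pairing between `A*` and `A`. -/
abbrev dualPairing [LeftRigidCategory D] (A : D) : ExactPairing (dualObj A) A :=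
  (LeftRigidCategory.leftDual A).exact

/-- The unit `η_A : I ⟶ A* ⊗ A`. -/
def dualUnit [LeftRigidCategory D] (A : D) : 𝟙_ D ⟶ dualObj A ⊗ A :=
  @ExactPairing.coevaluation D _ _ (dualObj A) A (dualPairing A)

/-- The counit `ε_A : A ⊗ A* ⟶ I`. -/
def dualCounit [LeftRigidCategory D] (A : D) : A ⊗ dualObj A ⟶ 𝟙_ D :=
  @ExactPairing.evaluation D _ _ (dualObj A) A (dualPairing A)

/-- The adjoint mate `f* : B* ⟶ A*` of `f : A ⟶ B`. -/
def dualMap [LeftRigidCategory D] {A B : D} (f : A ⟶ B) : dualObj B ⟶ dualObj A :=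
  @leftAdjointMate D _ _ A B (LeftRigidCategory.leftDual A) (LeftRigidCategory.leftDual B) f

/-- The canonical isomorphism `I* ≅ I`, by uniqueness of duals. -/
def dualUnitIso (D : Type u) [Category.{v} D] [MonoidalCategory D] [LeftRigidCategory D] :
    dualObj (𝟙_ D) ≅ 𝟙_ D :=
  leftDualIso (dualPairing (𝟙_ D)) exactPairingUnit

/-- The canonical isomorphism `(A ⊗ B)* ≅ B* ⊗ A*`, by uniqueness of duals. -/
def dualTensorIso [LeftRigidCategory D] (A B : D) :
    dualObj (A ⊗ B) ≅ dualObj B ⊗ dualObj A :=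
  leftDualIso (dualPairing (A ⊗ B))
    (@ExactPairing.tensor D _ _ (dualObj B) (dualObj A) B A (dualPairing B) (dualPairing A))

/-- The canonical map `I ⟶ I**`. -/
def doubleDualUnit (D : Type u) [Category.{v} D] [MonoidalCategory D] [LeftRigidCategory D] :
    𝟙_ D ⟶ dualObj (dualObj (𝟙_ D)) :=
  (dualUnitIso D).inv ≫ dualMap (dualUnitIso D).hom

/-- The canonical map `A** ⊗ B** ⟶ (A ⊗ B)**`. -/
def doubleDualTensor [LeftRigidCategory D] (A B : D) :
    dualObj (dualObj A) ⊗ dualObj (dualObj B) ⟶ dualObj (dualObj (A ⊗ B)) :=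
  (dualTensorIso (dualObj B) (dualObj A)).inv ≫ dualMap (dualTensorIso A B).hom

end Pivotal

/-- A pivotal category: a monoidal category in which every object `A` has a dual `A*`, with a
monoidal natural isomorphism `A ≅ A**`. -/
class PivotalCategory (D : Type u) [Category.{v} D] [MonoidalCategory D]
    extends LeftRigidCategory D where
  /-- the pivotal isomorphism -/
  piv : ∀ A : D, A ≅ dualObj (dualObj A)
  piv_naturality : ∀ {A B : D} (f : A ⟶ B),
    f ≫ (piv B).hom = (piv A).hom ≫ dualMap (dualMap f)
  piv_unit : (piv (𝟙_ D)).hom = doubleDualUnit D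
  piv_tensor : ∀ A B : D,
    (piv (A ⊗ B)).hom = ((piv A).hom ⊗ₘ (piv B).hom) ≫ doubleDualTensor A B

/-- The canonical right trace of a pivotal category:
`A ⟶ A ⊗ X** ⊗ X* ⟶ A ⊗ X ⊗ X* ⟶ B ⊗ X ⊗ X* ⟶ B`. -/
def pivotalTrR (D : Type u) [Category.{v} D] [MonoidalCategory D] [PivotalCategory D] :
    RightTraceOp D := fun X {A B} f =>
  (ρ_ A).inv ≫ A ◁ dualUnit (dualObj X) ≫ (α_ A (dualObj (dualObj X)) (dualObj X)).inv ≫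
    (A ◁ (PivotalCategory.piv X).inv ≫ f) ▷ dualObj X ≫
      (α_ B X (dualObj X)).hom ≫ B ◁ dualCounit X ≫ (ρ_ B).hom

/-- The canonical left trace of a pivotal category:
`A ⟶ X* ⊗ X ⊗ A ⟶ X* ⊗ X ⊗ B ⟶ X* ⊗ X** ⊗ B ⟶ B`. -/
def pivotalTrL (D : Type u) [Category.{v} D] [MonoidalCategory D] [PivotalCategory D] :
    LeftTraceOp D := fun X {A B} f =>
  (λ_ A).inv ≫ dualUnit X ▷ A ≫ (α_ (dualObj X) X A).hom ≫
    dualObj X ◁ (f ≫ (PivotalCategory.piv X).hom ▷ B) ≫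
      (α_ (dualObj X) (dualObj (dualObj X)) B).inv ≫ dualCounit (dualObj X) ▷ B ≫ (λ_ B).hom

section Functors

variable {C : Type u} [Category.{v} C] [MonoidalCategory C]
  {D : Type u} [Category.{v} D] [MonoidalCategory D]

/-- `F (Tr^X f) = Tr^{FX} (φ⁻¹ ∘ F f ∘ φ)`, with `φ : F A ⊗ F X ≅ F (A ⊗ X)` the structure
isomorphism of the strong monoidal functor `F`. -/
def PreservesRightTrace (F : C ⥤ D) [F.Monoidal] (tC : RightTraceOp C) (tD : RightTraceOp D) :
    Prop :=
  ∀ (X : C) {A B : C} (f : A ⊗ X ⟶ B ⊗ X),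
    F.map (tC X f) =
      tD (F.obj X) (Functor.LaxMonoidal.μ F A X ≫ F.map f ≫ Functor.OplaxMonoidal.δ F B X)

/-- The analogue of `PreservesRightTrace` for left traces. -/
def PreservesLeftTrace (F : C ⥤ D) [F.Monoidal] (tC : LeftTraceOp C) (tD : LeftTraceOp D) :
    Prop :=
  ∀ (X : C) {A B : C} (f : X ⊗ A ⟶ X ⊗ B),
    F.map (tC X f) =
      tD (F.obj X) (Functor.LaxMonoidal.μ F X A ≫ F.map f ≫ Functor.OplaxMonoidal.δ F X B)

end Functors

/-! An object of Int(C) is a pair (A, U), standing for FA ⊗ (FU)*. A morphism (A, U) → (B, V) is a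
map V ⊗ A ⟶ B ⊗ U, and composition closes the shared contravariant strand into a loop. The left
trace itself does not serve for this: closing a crossing with it gives `curl V` instead of the
identity. The axiom on σ makes `curl` invertible, and `curl` is natural, so inserting `curlInv`
yields a corrected trace `loop` which satisfies yanking (`loop_braiding`) and keeps tightening,
sliding and strength. Since `curl` behaves like the twist of a balanced category (`curl_tensor`),
`loop` obeys vanishing only up to a double braiding (`loop_tensor`). That double braiding is what
the crossings in the tensor product of morphisms require, and Int(C) becomes a monoidal category
(`intComp_assoc`, `intTensor_comp`).

The right trace can be written through `loop` (`trR_eq_loop`); with `curlInv_eq` this makes (I, S) a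
dual of (S, I) on both sides. On one side the triangles are yanking; on the other the unit and
counit carry the curls `curlR S` and `curl S`.

The pivotal structure and the braiding are not defined by formulas on pairs. Each amounts to a
choice of structure on every object (a two-sided dual, a half-braiding) that all morphisms preserve.
By `exists_extension` it suffices to have such structures on the objects FA and (FU)*: transposition
turns a morphism FA ⊗ (FU)* → (FV)* ⊗ FB into FV ⊗ FA → FB ⊗ FU, which comes from C because F is
full. Naturality and monoidality then hold together, since every morphism, and in particular every
comparison map, preserves the structure.

The canonical traces depend on the two-sided dual only up to compatible isomorphism (`trR_congr`,
`trL_congr`), so they may be computed with the explicit duals of the objects FA (`inclDual_trR`,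
`inclDual_trL`). -/

/-! ### Crossings acting on the first two of several strands. -/

section TailCalculus

variable {C : Type u} [Category.{v} C] [MonoidalCategory C]

/-- The morphism `f` acting on the first two factors of a right-nested tensor product. -/
def tail {V A B U : C} (f : V ⊗ A ⟶ B ⊗ U) (P : C) : V ⊗ (A ⊗ P) ⟶ B ⊗ (U ⊗ P) :=
  (α_ V A P).inv ≫ f ▷ P ≫ (α_ B U P).hom

theorem tail_id (V A P : C) : tail (𝟙 (V ⊗ A)) P = 𝟙 _ := by simp [tail]

theorem tail_comp {V A B U D W : C} (f : V ⊗ A ⟶ B ⊗ U) (g : B ⊗ U ⟶ D ⊗ W) (P : C) :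
    tail f P ≫ tail g P = tail (f ≫ g) P := by simp [tail]

theorem tail_naturality {V A B U P Q : C} (f : V ⊗ A ⟶ B ⊗ U) (k : P ⟶ Q) :
    tail f P ≫ B ◁ U ◁ k = V ◁ A ◁ k ≫ tail f Q := by
  simp only [tail, Category.assoc]
  rw [associator_inv_naturality_right_assoc, whisker_exchange_assoc,
    associator_naturality_right]

theorem tail_naturality_assoc {V A B U P Q : C} (f : V ⊗ A ⟶ B ⊗ U) (k : P ⟶ Q) {Z : C}
    (h : B ⊗ (U ⊗ Q) ⟶ Z) :
    tail f P ≫ B ◁ U ◁ k ≫ h = V ◁ A ◁ k ≫ tail f Q ≫ h := by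
  rw [reassoc_of% (tail_naturality f k)]

theorem tail_comp_whiskerRight {V A B U V' B' : C} (a : V' ⟶ V) (f : V ⊗ A ⟶ B ⊗ U) (b : B ⟶ B')
    (P : C) : tail (a ▷ A ≫ f ≫ b ▷ U) P = a ▷ (A ⊗ P) ≫ tail f P ≫ b ▷ (U ⊗ P) := by
  simp [tail]

theorem tail_comp_whiskerLeft {V A B U A' U' : C} (a : A' ⟶ A) (f : V ⊗ A ⟶ B ⊗ U) (b : U ⟶ U')
    (P : C) : tail (V ◁ a ≫ f ≫ B ◁ b) P = V ◁ (a ▷ P) ≫ tail f P ≫ B ◁ (b ▷ P) := by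
  simp [tail]

variable [BraidedCategory C]

/-- The braiding acting on the first two factors of a right-nested tensor product. -/
def cr (X Y P : C) : X ⊗ (Y ⊗ P) ⟶ Y ⊗ (X ⊗ P) := tail (β_ X Y).hom P

/-- The inverse braiding acting on the first two factors of a right-nested tensor product. -/
def cri (X Y P : C) : Y ⊗ (X ⊗ P) ⟶ X ⊗ (Y ⊗ P) := tail (β_ X Y).inv P

theorem cr_cri (X Y P : C) : cr X Y P ≫ cri X Y P = 𝟙 _ := by
  rw [cr, cri, tail_comp, Iso.hom_inv_id, tail_id]

theorem cri_cr (X Y P : C) : cri X Y P ≫ cr X Y P = 𝟙 _ := by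
  rw [cr, cri, tail_comp, Iso.inv_hom_id, tail_id]

instance isIso_cr (X Y P : C) : IsIso (cr X Y P) := ⟨cri X Y P, cr_cri X Y P, cri_cr X Y P⟩

theorem cr_cri_assoc (X Y P : C) {Z : C} (h : X ⊗ (Y ⊗ P) ⟶ Z) :
    cr X Y P ≫ cri X Y P ≫ h = h := by rw [reassoc_of% (cr_cri X Y P)]

theorem cri_cr_assoc (X Y P : C) {Z : C} (h : Y ⊗ (X ⊗ P) ⟶ Z) :
    cri X Y P ≫ cr X Y P ≫ h = h := by rw [reassoc_of% (cri_cr X Y P)]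

theorem cr_naturality_left {X X' : C} (a : X ⟶ X') (Y P : C) :
    a ▷ (Y ⊗ P) ≫ cr X' Y P = cr X Y P ≫ Y ◁ (a ▷ P) := by
  have h := tail_comp_whiskerRight a (β_ X' Y).hom (𝟙 _) P
  have h' := tail_comp_whiskerLeft (𝟙 _) (β_ X Y).hom a P
  simp only [id_whiskerRight, Category.comp_id, Category.id_comp,
    BraidedCategory.braiding_naturality_left, whiskerLeft_id] at h h'
  rw [cr, ← h, h', cr]

theorem cr_naturality_right (X : C) {Y Y' : C} (a : Y ⟶ Y') (P : C) :
    X ◁ (a ▷ P) ≫ cr X Y' P = cr X Y P ≫ a ▷ (X ⊗ P) := by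
  have h := tail_comp_whiskerRight (𝟙 _) (β_ X Y).hom a P
  have h' := tail_comp_whiskerLeft a (β_ X Y').hom (𝟙 _) P
  simp only [id_whiskerRight, Category.comp_id, Category.id_comp,
    BraidedCategory.braiding_naturality_right, whiskerLeft_id] at h h'
  rw [cr, ← h', h, cr]

theorem cri_naturality_left {X X' : C} (a : X ⟶ X') (Y P : C) :
    Y ◁ (a ▷ P) ≫ cri X' Y P = cri X Y P ≫ a ▷ (Y ⊗ P) := by
  rw [← cancel_epi (cr X Y P), ← reassoc_of% (cr_naturality_left a Y P), cr_cri, cr_cri_assoc,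
    Category.comp_id]

theorem cri_naturality_right (X : C) {Y Y' : C} (a : Y ⟶ Y') (P : C) :
    a ▷ (X ⊗ P) ≫ cri X Y' P = cri X Y P ≫ X ◁ (a ▷ P) := by
  rw [← cancel_epi (cr X Y P), ← reassoc_of% (cr_naturality_right X a P), cr_cri, cr_cri_assoc,
    Category.comp_id]

theorem cr_tail_naturality {X Y P Q : C} (k : P ⟶ Q) :
    cr X Y P ≫ Y ◁ X ◁ k = X ◁ Y ◁ k ≫ cr X Y Q := tail_naturality _ _

theorem cr_tail_naturality_assoc {X Y P Q : C} (k : P ⟶ Q) {Z : C} (h : Y ⊗ (X ⊗ Q) ⟶ Z) :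
    cr X Y P ≫ Y ◁ X ◁ k ≫ h = X ◁ Y ◁ k ≫ cr X Y Q ≫ h := tail_naturality_assoc _ _ _

theorem cri_tail_naturality_assoc {X Y P Q : C} (k : P ⟶ Q) {Z : C} (h : X ⊗ (Y ⊗ Q) ⟶ Z) :
    cri X Y P ≫ X ◁ Y ◁ k ≫ h = Y ◁ X ◁ k ≫ cri X Y Q ≫ h := tail_naturality_assoc _ _ _

theorem cri_tail_naturality {X Y P Q : C} (k : P ⟶ Q) :
    cri X Y P ≫ X ◁ Y ◁ k = Y ◁ X ◁ k ≫ cri X Y Q := tail_naturality _ _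

theorem cr_tensor_right (X Y Z P : C) :
    cr X (Y ⊗ Z) P = X ◁ (α_ Y Z P).hom ≫ cr X Y (Z ⊗ P) ≫ Y ◁ cr X Z P ≫ (α_ Y Z (X ⊗ P)).inv := by
  simp only [cr, tail, BraidedCategory.braiding_tensor_right_hom]; monoidal

theorem cr_tensor_left (X Y Z P : C) :
    cr (X ⊗ Y) Z P = (α_ X Y (Z ⊗ P)).hom ≫ X ◁ cr Y Z P ≫ cr X Z (Y ⊗ P) ≫
      Z ◁ (α_ X Y P).inv := by
  simp only [cr, tail, BraidedCategory.braiding_tensor_left_hom]; monoidal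

theorem cri_tensor_right (X Y Z P : C) :
    cri X (Y ⊗ Z) P = (α_ Y Z (X ⊗ P)).hom ≫ Y ◁ cri X Z P ≫ cri X Y (Z ⊗ P) ≫
      X ◁ (α_ Y Z P).inv := by
  simp only [cri, tail, BraidedCategory.braiding_tensor_right_inv]; monoidal

theorem cri_tensor_left (X Y Z P : C) :
    cri (X ⊗ Y) Z P = Z ◁ (α_ X Y P).hom ≫ cri X Z (Y ⊗ P) ≫ X ◁ cri Y Z P ≫
      (α_ X Y (Z ⊗ P)).inv := by
  simp only [cri, tail, BraidedCategory.braiding_tensor_left_inv]; monoidal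

/-- A strand `X` passes over a morphism. -/
theorem tail_over (X : C) {V A B U : C} (f : V ⊗ A ⟶ B ⊗ U) (P : C) :
    X ◁ tail f P ≫ cr X B (U ⊗ P) ≫ B ◁ cr X U P =
      cr X V (A ⊗ P) ≫ V ◁ cr X A P ≫ tail f (X ⊗ P) := by
  have h := cr_naturality_right X f P
  rw [cr_tensor_right, cr_tensor_right] at h
  simp only [Category.assoc] at h
  rw [← cancel_epi (X ◁ (α_ V A P).hom), ← cancel_mono (α_ B U (X ⊗ P)).inv]
  simp only [tail, Category.assoc, Iso.hom_inv_id, Category.comp_id]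
  rw [← h]
  simp only [whiskerLeft_comp, Category.assoc, whiskerLeft_hom_inv_assoc]

/-- A strand `X` passes back over a morphism. -/
theorem tail_over_inv (X : C) {V A B U : C} (f : V ⊗ A ⟶ B ⊗ U) (P : C) :
    tail f (X ⊗ P) ≫ B ◁ cri X U P ≫ cri X B (U ⊗ P) =
      V ◁ cri X A P ≫ cri X V (A ⊗ P) ≫ X ◁ tail f P := by
  rw [← cancel_epi (V ◁ cr X A P), ← cancel_epi (cr X V (A ⊗ P))]
  rw [← reassoc_of% (tail_over X f P)]
  simp only [← whiskerLeft_comp_assoc, cr_cri, whiskerLeft_id, Category.id_comp, cr_cri_assoc,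
    Category.comp_id]

/-- The Yang-Baxter equation. -/
theorem cr_yangBaxter (X Y Z P : C) :
    X ◁ cr Y Z P ≫ cr X Z (Y ⊗ P) ≫ Z ◁ cr X Y P =
      cr X Y (Z ⊗ P) ≫ Y ◁ cr X Z P ≫ cr Y Z (X ⊗ P) :=
  tail_over X (β_ Y Z).hom P

theorem cri_yangBaxter (X Y Z P : C) :
    Z ◁ cri X Y P ≫ cri X Z (Y ⊗ P) ≫ X ◁ cri Y Z P =
      cri Y Z (X ⊗ P) ≫ Y ◁ cri X Z P ≫ cri X Y (Z ⊗ P) :=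
  (tail_over_inv X (β_ Y Z).inv P).symm

end TailCalculus

/-! ### The double braiding, curls, and the framing-corrected trace. -/

section DoubleBraiding

variable {C : Type u} [Category.{v} C] [MonoidalCategory C] [BraidedCategory C]

/-- The double braiding. -/
def dbl (X Y : C) : X ⊗ Y ⟶ X ⊗ Y := (β_ X Y).hom ≫ (β_ Y X).hom

/-- The inverse of the double braiding. -/
def dblInv (X Y : C) : X ⊗ Y ⟶ X ⊗ Y := (β_ Y X).inv ≫ (β_ X Y).inv

theorem dbl_dblInv (X Y : C) : dbl X Y ≫ dblInv X Y = 𝟙 _ := by simp [dbl, dblInv]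

theorem dblInv_dbl (X Y : C) : dblInv X Y ≫ dbl X Y = 𝟙 _ := by simp [dbl, dblInv]

end DoubleBraiding

section Loop

open LeftTracedCategory RightTracedCategory

variable {C : Type u} [Category.{v} C] [MonoidalCategory C] [BraidedCategory C]
  [BraidedTracedCategory C]

/-- The positive left curl. -/
def curl (X : C) : X ⟶ X := trL X (β_ X X).hom

/-- The inverse of the positive left curl. -/
def curlInv (X : C) : X ⟶ X := trR X (β_ X X).inv

/-- The positive right curl. -/
def curlR (X : C) : X ⟶ X := trR X (β_ X X).hom

/-- The morphism passes through the crossing onto the closed strand, slides once round it, and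
leaves through the crossing again. -/
theorem curl_naturality {X Y : C} (f : X ⟶ Y) : f ≫ curl Y = curl X ≫ f := by
  have h1 := trL_tightening Y f (β_ Y Y).hom (𝟙 Y)
  have h2 := trL_sliding (β_ Y X).hom f
  have h3 := trL_tightening X (𝟙 X) (β_ X X).hom f
  simp only [whiskerLeft_id, Category.comp_id, Category.id_comp,
    BraidedCategory.braiding_naturality_right, BraidedCategory.braiding_naturality_left] at h1 h2 h3
  rw [curl, ← h1, ← h2, h3, curl]

theorem curlR_naturality {X Y : C} (f : X ⟶ Y) : f ≫ curlR Y = curlR X ≫ f := by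
  have h1 := trR_tightening Y f (β_ Y Y).hom (𝟙 Y)
  have h2 := trR_sliding (β_ X Y).hom f
  have h3 := trR_tightening X (𝟙 X) (β_ X X).hom f
  simp only [id_whiskerRight, Category.comp_id, Category.id_comp,
    BraidedCategory.braiding_naturality_left] at h1 h2 h3
  rw [← BraidedCategory.braiding_naturality_right] at h3
  rw [curlR, ← h1, ← h2, h3, curlR]

/-- This is the only point where the axiom on σ specific to braided traced categories enters. -/
theorem curlInv_curl (X : C) : curlInv X ≫ curl X = 𝟙 X := BraidedTracedCategory.trR_comp_trL X

theorem curl_curlInv (X : C) : curl X ≫ curlInv X = 𝟙 X := by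
  rw [← curl_naturality, curlInv_curl]

instance isIso_curl (X : C) : IsIso (curl X) := ⟨curlInv X, curl_curlInv X, curlInv_curl X⟩

theorem curlInv_naturality {X Y : C} (f : X ⟶ Y) : f ≫ curlInv Y = curlInv X ≫ f := by
  rw [← cancel_mono (curl Y), Category.assoc, Category.assoc, curlInv_curl, curl_naturality,
    ← Category.assoc, curlInv_curl, Category.comp_id, Category.id_comp]

/-- The framing-corrected left trace, which satisfies the yanking equation. -/
def loop (V : C) {P Q : C} (k : V ⊗ P ⟶ V ⊗ Q) : P ⟶ Q := trL V (k ≫ curlInv V ▷ Q)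

theorem trL_eq_loop (V : C) {P Q : C} (k : V ⊗ P ⟶ V ⊗ Q) : trL V k = loop V (k ≫ curl V ▷ Q) := by
  simp [loop, ← comp_whiskerRight, curl_curlInv]

theorem loop_comp (V : C) {P Q R : C} (k : V ⊗ P ⟶ V ⊗ Q) (b : Q ⟶ R) :
    loop V (k ≫ V ◁ b) = loop V k ≫ b := by
  have h := trL_tightening V (𝟙 P) (k ≫ curlInv V ▷ Q) b
  simp only [whiskerLeft_id, Category.id_comp, Category.assoc] at h
  rw [loop, loop, ← h, Category.assoc, whisker_exchange]

theorem comp_loop (V : C) {O P Q : C} (a : O ⟶ P) (k : V ⊗ P ⟶ V ⊗ Q) :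
    loop V (V ◁ a ≫ k) = a ≫ loop V k := by
  have h := trL_tightening V a (k ≫ curlInv V ▷ Q) (𝟙 _)
  simp only [whiskerLeft_id, Category.comp_id] at h
  rw [loop, loop, ← h, Category.assoc]

theorem comp_loop_comp (V : C) {O P Q R : C} (a : O ⟶ P) (k : V ⊗ P ⟶ V ⊗ Q) (b : Q ⟶ R) :
    a ≫ loop V k ≫ b = loop V (V ◁ a ≫ k ≫ V ◁ b) := by
  rw [comp_loop, loop_comp]

/-- Sliding survives the correction because `curlInv` is natural. -/
theorem loop_slide {V Y P Q : C} (k : V ⊗ P ⟶ Y ⊗ Q) (g : Y ⟶ V) :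
    loop Y (g ▷ P ≫ k) = loop V (k ≫ g ▷ Q) := by
  rw [loop, loop, Category.assoc, trL_sliding, Category.assoc, Category.assoc,
    ← comp_whiskerRight, ← comp_whiskerRight, curlInv_naturality]

theorem loop_tail (V : C) {P Q : C} (k : V ⊗ P ⟶ V ⊗ Q) (R : C) :
    loop V (tail k R) = loop V k ▷ R := by
  have h := trL_strength V (k ≫ curlInv V ▷ Q) (𝟙 R)
  rw [tensorHom_id, tensorHom_id] at h
  rw [loop, loop, ← h, tail]
  simp

/-- Conjugating by the braiding moves the strand X to the right of the loop, where strength applies;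
the closed strand V therefore passes over X. -/
theorem whiskerLeft_loop_under (X V : C) {P Q : C} (k : V ⊗ P ⟶ V ⊗ Q) :
    X ◁ loop V k = loop V (cr V X P ≫ X ◁ k ≫ cri V X Q) := by
  have h : X ◁ loop V k = (β_ P X).inv ≫ loop V k ▷ X ≫ (β_ Q X).hom := by
    rw [BraidedCategory.braiding_naturality_left, Iso.inv_hom_id_assoc]
  rw [h, ← loop_tail, ← loop_comp, ← comp_loop]
  congr 1
  rw [← cancel_mono (cr V X Q), Category.assoc, Category.assoc, Category.assoc, Category.assoc,
    cri_cr, Category.comp_id, ← cancel_epi (V ◁ (β_ P X).hom)]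
  have h2 := BraidedCategory.braiding_naturality_left k X
  rw [← cancel_epi (α_ V P X).inv] at h2
  simp only [cr, tail, Category.assoc, ← whiskerLeft_comp_assoc, Iso.hom_inv_id, whiskerLeft_id,
    Category.id_comp, BraidedCategory.braiding_tensor_left_hom] at h2 ⊢
  rw [h2]
  simp

/-- Yanking: the correction slides through the crossing onto the open strand, where it cancels the
curl. -/
theorem loop_braiding (V : C) : loop V (β_ V V).hom = 𝟙 V := by
  rw [loop, ← BraidedCategory.braiding_naturality_right, ← curlInv_curl V]
  have h := trL_tightening V (curlInv V) (β_ V V).hom (𝟙 _)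
  simpa [curl] using h

theorem loop_cr (V P : C) : loop V (cr V V P) = 𝟙 (V ⊗ P) := by
  rw [cr, loop_tail, loop_braiding, id_whiskerRight]

theorem trL_tail (V : C) {P Q : C} (k : V ⊗ P ⟶ V ⊗ Q) (R : C) :
    trL V (tail k R) = trL V k ▷ R := by
  have h := trL_strength V k (𝟙 R)
  rwa [tensorHom_id, tensorHom_id] at h

/-- Vanishing closes the strands X and Y one after the other. Each self-crossing contributes a curl,
and the two mixed crossings left over form the double braiding. -/
theorem curl_tensor (X Y : C) : curl (X ⊗ Y) = dbl X Y ≫ (curl X ⊗ₘ curl Y) := by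
  have h1 : trL X ((α_ X Y (X ⊗ Y)).inv ≫ (β_ (X ⊗ Y) (X ⊗ Y)).hom ≫ (α_ X Y (X ⊗ Y)).hom) =
      (β_ Y (X ⊗ Y)).hom ≫ (α_ X Y Y).hom ≫ curl X ▷ (Y ⊗ Y) ≫ cr X Y Y := by
    rw [curl, ← trL_tail]
    have := trL_tightening X ((β_ Y (X ⊗ Y)).hom ≫ (α_ X Y Y).hom) (tail (β_ X X).hom (Y ⊗ Y))
      (cr X Y Y)
    rw [Category.assoc] at this
    rw [← this]
    congr 1
    rw [BraidedCategory.braiding_tensor_left_hom, BraidedCategory.braiding_tensor_right_hom X X Y]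
    simp only [cr, tail]; monoidal
  have h2 : dblInv X Y ≫ curl (X ⊗ Y) = curl X ⊗ₘ curl Y := by
    rw [curl, trL_vanishing_tensor, h1]
    have t1 := trL_tightening Y (dblInv X Y)
      ((β_ Y (X ⊗ Y)).hom ≫ (α_ X Y Y).hom ≫ curl X ▷ (Y ⊗ Y) ≫ cr X Y Y) (𝟙 _)
    rw [whiskerLeft_id, Category.comp_id, Category.comp_id] at t1
    have t2 := trL_tightening Y (β_ Y X).inv (cr Y Y X) ((β_ Y X).hom ≫ curl X ▷ Y)
    rw [← t1]
    have e : trL Y (cr Y Y X) = curl Y ▷ X := by rw [cr, trL_tail]; rfl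
    rw [e] at t2
    trans (β_ Y X).inv ≫ curl Y ▷ X ≫ (β_ Y X).hom ≫ curl X ▷ Y
    · rw [← t2]
      congr 1
      rw [BraidedCategory.braiding_naturality_right_assoc, dblInv, cr_naturality_left]
      have : ((β_ Y X).inv ≫ (β_ X Y).inv) ▷ Y ≫ (α_ X Y Y).hom ≫ cr X Y Y ≫ Y ◁ curl X ▷ Y =
        (β_ Y X).inv ▷ Y ≫ (α_ Y X Y).hom ≫ Y ◁ curl X ▷ Y := by
        simp [cr, tail]
      rw [this, ← BraidedCategory.braiding_naturality_right_assoc, whiskerLeft_comp]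
      simp [cr, tail, BraidedCategory.braiding_tensor_right_hom]
    · rw [reassoc_of% (BraidedCategory.braiding_naturality_left (curl Y) X), Iso.inv_hom_id_assoc,
        MonoidalCategory.tensorHom_def']
  rw [← h2, ← Category.assoc, dbl_dblInv, Category.id_comp]

theorem curlInv_tensor (X Y : C) : curlInv (X ⊗ Y) = dblInv X Y ≫ (curlInv X ⊗ₘ curlInv Y) := by
  have h : dblInv X Y = curlInv (X ⊗ Y) ≫ (curl X ⊗ₘ curl Y) := by
    rw [← curlInv_naturality, ← cancel_mono (curl (X ⊗ Y)), Category.assoc, curlInv_curl,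
      curl_tensor, ← Category.assoc, dblInv_dbl, Category.id_comp, Category.comp_id]
  rw [h, Category.assoc, tensorHom_comp_tensorHom, curl_curlInv, curl_curlInv, id_tensorHom_id,
    Category.comp_id]

/-- Vanishing for the trace, combined with the failure of `curlInv` to be monoidal: by
`curlInv_tensor` that failure is the inverse double braiding. -/
theorem loop_tensor (X Y : C) {P Q : C} (m : (X ⊗ Y) ⊗ P ⟶ (X ⊗ Y) ⊗ Q) :
    loop (X ⊗ Y) m =
      loop Y (loop X ((α_ X Y P).inv ≫ m ≫ dblInv X Y ▷ Q ≫ (α_ X Y Q).hom)) := by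
  rw [loop, trL_vanishing_tensor, loop, loop]
  have h := trL_tightening X (𝟙 _)
    (((α_ X Y P).inv ≫ m ≫ dblInv X Y ▷ Q ≫ (α_ X Y Q).hom) ≫ curlInv X ▷ (Y ⊗ Q)) (curlInv Y ▷ Q)
  rw [whiskerLeft_id, Category.id_comp, Category.id_comp] at h
  rw [Category.assoc] at h
  rw [← h, curlInv_tensor, MonoidalCategory.tensorHom_def]
  simp

/-- Nested loops may be interchanged. -/
theorem loop_swap (V W : C) {P Q : C} (k : W ⊗ (V ⊗ P) ⟶ W ⊗ (V ⊗ Q)) :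
    loop V (loop W k) = loop W (loop V (cri W V P ≫ k ≫ cr W V Q)) := by
  -- Each nested loop is turned into a single loop on a tensor product, the factor `dbl` cancelling
  -- the correction of `loop_tensor`. Sliding the braiding round that single loop exchanges the two
  -- strands.
  have h1 := loop_tensor W V ((α_ W V P).hom ≫ k ≫ (α_ W V Q).inv ≫ dbl W V ▷ Q)
  have h2 := loop_tensor V W ((β_ W V).inv ▷ P ≫ (α_ W V P).hom ≫ k ≫ (α_ W V Q).inv ≫
    dbl W V ▷ Q ≫ (β_ W V).hom ▷ Q)
  have h3 := loop_slide ((β_ W V).inv ▷ P ≫ (α_ W V P).hom ≫ k ≫ (α_ W V Q).inv ≫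
    dbl W V ▷ Q) (β_ W V).hom
  simp only [Category.assoc] at h3
  rw [h2] at h3
  simp only [← comp_whiskerRight_assoc, Iso.hom_inv_id, id_whiskerRight, Category.id_comp] at h3
  rw [h1] at h3
  simp only [Category.assoc, Iso.inv_hom_id_assoc, ← comp_whiskerRight_assoc, dbl_dblInv,
    id_whiskerRight, Category.id_comp, Iso.inv_hom_id, Category.comp_id] at h3
  rw [h3]
  simp [cr, cri, tail, dbl, dblInv]

theorem loop_swap' (V W : C) {P Q : C} (k : W ⊗ (V ⊗ P) ⟶ W ⊗ (V ⊗ Q)) :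
    loop V (loop W k) = loop W (loop V (cr V W P ≫ k ≫ cri V W Q)) := by
  rw [loop_swap W V]
  simp only [Category.assoc, cri_cr, cri_cr_assoc, Category.comp_id]

theorem trR_loop (X Y : C) {A B : C} (k : Y ⊗ (A ⊗ X) ⟶ Y ⊗ (B ⊗ X)) :
    trR X (loop Y k) = loop Y (trR X ((α_ Y A X).hom ≫ k ≫ (α_ Y B X).inv)) := by
  have h := PlanarTracedCategory.interchange
    ((α_ Y A X).hom ≫ (k ≫ curlInv Y ▷ (B ⊗ X)) ≫ (α_ Y B X).inv)
  have h' := trR_tightening X (𝟙 _) ((α_ Y A X).hom ≫ k ≫ (α_ Y B X).inv) (curlInv Y ▷ B)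
  simp only [Category.assoc, Iso.inv_hom_id, Category.comp_id, Iso.inv_hom_id_assoc,
    id_whiskerRight, Category.id_comp] at h h'
  rw [loop, loop, h, ← h']
  simp

/-- The right trace as a framed loop. -/
theorem trR_eq_loop (X : C) {A B : C} (f : A ⊗ X ⟶ B ⊗ X) :
    trR X f = loop X ((β_ X A).hom ≫ A ◁ curlR X ≫ f ≫ (β_ X B).inv) := by
  -- Yanking introduces a new closed strand X under B, and f is moved onto it by naturality. What
  -- remains for the right trace to close is a bare crossing, which gives `curlR`.
  have h1 : f = loop X (cr X A X ≫ A ◁ (β_ X X).hom ≫ tail f X ≫ cri X B X) := by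
    have h := whiskerLeft_loop_under B X (β_ X X).hom
    rw [loop_braiding, whiskerLeft_id] at h
    conv_lhs => rw [← Category.comp_id f, h, ← comp_loop]
    congr 1
    have h2 := BraidedCategory.braiding_naturality_right X f
    simp only [BraidedCategory.braiding_tensor_right_hom, Category.assoc] at h2
    simp only [cr, tail, Category.assoc]
    rw [← cancel_mono (α_ B X X).hom] at h2
    simp only [Category.assoc, Iso.inv_hom_id, Category.comp_id] at h2
    rw [reassoc_of% h2]
  have h3 := trR_strength X (𝟙 A) (β_ X X).hom
  have h4 := trR_tightening X (β_ X A).hom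
    ((α_ A X X).hom ≫ (𝟙 A ⊗ₘ (β_ X X).hom) ≫ (α_ A X X).inv ≫ f ▷ X) (β_ X B).inv
  have h5 := trR_tightening X (𝟙 _) ((α_ A X X).hom ≫ (𝟙 A ⊗ₘ (β_ X X).hom) ≫ (α_ A X X).inv) f
  simp only [id_whiskerRight, Category.id_comp, id_tensorHom, Category.assoc] at h3 h4 h5
  conv_lhs => rw [h1]
  rw [trR_loop, curlR, ← Category.assoc (A ◁ _ ) f, ← h3, ← h5, ← h4]
  simp [cr, cri, tail]

/-- This relates left and right curls. It yields the cancellation `loop S (β_ S S).inv ≫ curlR S ≫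
curl S = 𝟙 S` on which the right duals depend. -/
theorem curlInv_eq (X : C) : curlInv X = loop X (β_ X X).inv ≫ curlR X := by
  rw [curlInv, trR_eq_loop, ← loop_comp]
  have h : (β_ X X).hom ≫ X ◁ curlR X ≫ (β_ X X).inv ≫ (β_ X X).inv =
      curlR X ▷ X ≫ (β_ X X).inv := by
    rw [← BraidedCategory.braiding_naturality_left_assoc, Iso.hom_inv_id_assoc]
  rw [h, BraidedCategory.braiding_inv_naturality_left]

end Loop

/-! ### Composition of Int morphisms. -/

section IntComposition

variable {C : Type u} [Category.{v} C] [MonoidalCategory C] [BraidedCategory C]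

theorem whiskerLeft_over (X : C) {V A B U : C} (f : V ⊗ A ⟶ B ⊗ U) :
    X ◁ f ≫ cr X B U ≫ B ◁ (β_ X U).hom = cr X V A ≫ V ◁ (β_ X A).hom ≫ tail f X := by
  have h := BraidedCategory.braiding_naturality_right X f
  simp only [BraidedCategory.braiding_tensor_right_hom, Category.assoc] at h
  rw [← cancel_mono (α_ B U X).hom] at h
  simp only [Category.assoc, Iso.inv_hom_id, Category.comp_id] at h
  simp only [cr, tail, Category.assoc, h]

variable [BraidedTracedCategory C]

theorem tail_loop (W : C) {Y B E V : C} (k : W ⊗ (Y ⊗ B) ⟶ W ⊗ (E ⊗ V)) (U : C) :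
    tail (loop W k) U = loop W (W ◁ (α_ Y B U).inv ≫ tail k U ≫ W ◁ (α_ E V U).hom) := by
  rw [tail, ← loop_tail, ← loop_comp, ← comp_loop]

/-- Composition in the `Int` construction: two morphisms joined along two strands, one of which
runs backwards. -/
def intComp {A U B V D W : C} (f : V ⊗ A ⟶ B ⊗ U) (g : W ⊗ B ⟶ D ⊗ V) : W ⊗ A ⟶ D ⊗ U :=
  loop V (cr V W A ≫ W ◁ f ≫ tail g U ≫ cri V D U)

theorem intComp_tail {A U B V D W : C} (f : V ⊗ A ⟶ B ⊗ U) (g : W ⊗ B ⟶ D ⊗ V) (P : C) :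
    tail (intComp f g) P =
      loop V (cr V W (A ⊗ P) ≫ W ◁ tail f P ≫ tail g (U ⊗ P) ≫ cri V D (U ⊗ P)) := by
  rw [intComp, tail_loop]
  congr 1
  simp only [tail, cr, cri]
  monoidal

/-- The crossings cancel except for one of V with itself, which is yanked straight. -/
theorem intComp_id {A U B V : C} (f : V ⊗ A ⟶ B ⊗ U) : intComp f (β_ V B).hom = f := by
  have h : tail (β_ V B).hom U ≫ cri V B U = 𝟙 _ := cr_cri V B U
  rw [intComp, h, Category.comp_id, loop_comp, loop_cr, Category.id_comp]

theorem id_intComp {A U D W : C} (g : W ⊗ A ⟶ D ⊗ U) : intComp (β_ U A).hom g = g := by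
  rw [intComp, ← reassoc_of% (whiskerLeft_over U g), comp_loop, ← whiskerLeft_loop_under,
    loop_braiding, whiskerLeft_id, Category.comp_id]

/-- Both sides are double loops over V and W. After the loops are interchanged, Yang–Baxter and
moving the inverse crossing through h identify the integrands. -/
theorem intComp_assoc {A U B V D W E Y : C} (f : V ⊗ A ⟶ B ⊗ U) (g : W ⊗ B ⟶ D ⊗ V)
    (h : Y ⊗ D ⟶ E ⊗ W) : intComp (intComp f g) h = intComp f (intComp g h) := by
  have e : tail h U ≫ cri W E U = tail (h ≫ (β_ W E).inv) U := tail_comp _ _ _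
  rw [intComp, intComp.eq_1 f (intComp g h), intComp_tail g h U, e]
  rw [intComp, whiskerLeft_loop_under, comp_loop_comp, ← Category.assoc, ← e, comp_loop_comp,
    ← comp_loop, loop_swap' V W]
  congr 2
  have h1 := cr_yangBaxter V W Y A
  have h2 := cri_yangBaxter V W E U
  have h3 := tail_over_inv V h U
  simp only [Category.assoc, whiskerLeft_comp]
  rw [← reassoc_of% h3, h2, ← cr_tail_naturality_assoc, reassoc_of% h1]

theorem intComp_slide {A U B V V' D W : C} (b : V' ⟶ V) (f : V ⊗ A ⟶ B ⊗ U) (g : W ⊗ B ⟶ D ⊗ V') :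
    intComp (b ▷ A ≫ f) g = intComp f (g ≫ D ◁ b) := by
  have h := tail_comp_whiskerLeft (𝟙 _) g b U
  simp only [id_whiskerRight, whiskerLeft_id, Category.id_comp] at h
  rw [intComp, intComp, whiskerLeft_comp_assoc, ← reassoc_of% (cr_naturality_left b W A),
    loop_slide, h]
  simp only [Category.assoc, cri_naturality_left]

/-- With `intComp_slide`, this makes composition balanced over morphisms of both the covariant and
the contravariant part of the middle object. -/
theorem intComp_push {A U B B' V D W : C} (f : V ⊗ A ⟶ B ⊗ U) (a : B ⟶ B') (g : W ⊗ B' ⟶ D ⊗ V) :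
    intComp (f ≫ a ▷ U) g = intComp f (W ◁ a ≫ g) := by
  have h := tail_comp_whiskerLeft a g (𝟙 _) U
  simp only [id_whiskerRight, whiskerLeft_id, Category.comp_id] at h
  rw [intComp, intComp, h]
  simp only [Category.assoc, whiskerLeft_comp]

theorem intComp_comp_whiskerRight {A U B V D D' W W' : C} (f : V ⊗ A ⟶ B ⊗ U) (b : W' ⟶ W)
    (g : W ⊗ B ⟶ D ⊗ V) (a : D ⟶ D') :
    intComp f (b ▷ B ≫ g ≫ a ▷ V) = b ▷ A ≫ intComp f g ≫ a ▷ U := by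
  rw [intComp, intComp, tail_comp_whiskerRight, ← loop_comp, ← comp_loop]
  congr 1
  simp only [Category.assoc]
  rw [reassoc_of% (cr_naturality_right V b A), cri_naturality_right,
    reassoc_of% (whisker_exchange b f)]

end IntComposition

/-! ### Tensor product of Int morphisms. -/

section IntTensor

variable {C : Type u} [Category.{v} C] [MonoidalCategory C] [BraidedCategory C]

/-- The tensor product of morphisms in the `Int` construction. -/
def intTensor {A U B V A' U' B' V' : C} (f : V ⊗ A ⟶ B ⊗ U) (g : V' ⊗ A' ⟶ B' ⊗ U') :
    (V' ⊗ V) ⊗ (A ⊗ A') ⟶ (B ⊗ B') ⊗ (U' ⊗ U) :=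
  (α_ V' V (A ⊗ A')).hom ≫ V' ◁ tail f A' ≫ V' ◁ B ◁ (β_ U A').hom ≫ cr V' B (A' ⊗ U) ≫
    B ◁ tail g U ≫ (α_ B B' (U' ⊗ U)).inv

/-- The morphisms of the `Int` construction coming from a pair of morphisms. -/
def intPair {A B U V : C} (a : A ⟶ B) (b : V ⟶ U) : V ⊗ A ⟶ B ⊗ U :=
  b ▷ A ≫ (β_ U A).hom ≫ a ▷ U

theorem intTensor_intPair {A B U V A' B' U' V' : C} (a : A ⟶ B) (b : V ⟶ U) (a' : A' ⟶ B')
    (b' : V' ⟶ U') :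
    intTensor (intPair a b) (intPair a' b') = intPair (a ⊗ₘ a') (b' ⊗ₘ b) := by
  have h1 : tail (b ▷ A ≫ (β_ U A).hom ≫ a ▷ U) A' =
      b ▷ (A ⊗ A') ≫ cr U A A' ≫ a ▷ (U ⊗ A') := tail_comp_whiskerRight _ _ _ _
  have h2 : tail (b' ▷ A' ≫ (β_ U' A').hom ≫ a' ▷ U') U =
      b' ▷ (A' ⊗ U) ≫ cr U' A' U ≫ a' ▷ (U' ⊗ U) := tail_comp_whiskerRight _ _ _ _
  have h3 : U' ◁ cr U A A' ≫ U' ◁ A ◁ (β_ U A').hom ≫ cr U' A (A' ⊗ U) ≫ A ◁ cr U' A' U =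
      (α_ U' U (A ⊗ A')).inv ≫ (β_ (U' ⊗ U) (A ⊗ A')).hom ≫ (α_ A A' (U' ⊗ U)).hom := by
    rw [BraidedCategory.braiding_tensor_left_hom, BraidedCategory.braiding_tensor_right_hom,
      BraidedCategory.braiding_tensor_right_hom]
    simp only [cr, tail]
    monoidal
  rw [intTensor, intPair, intPair, h1, h2, intPair]
  simp only [whiskerLeft_comp, Category.assoc]
  have h4 : U' ◁ a ▷ (U ⊗ A') ≫ U' ◁ B ◁ (β_ U A').hom =
      U' ◁ A ◁ (β_ U A').hom ≫ U' ◁ a ▷ (A' ⊗ U) := by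
    rw [← whiskerLeft_comp, ← whisker_exchange, whiskerLeft_comp]
  rw [← reassoc_of% (cr_naturality_left b' B (A' ⊗ U)), whisker_exchange_assoc,
    whisker_exchange_assoc, whisker_exchange_assoc, whisker_exchange_assoc, reassoc_of% h4,
    reassoc_of% (cr_naturality_right U' a (A' ⊗ U)), ← whisker_exchange_assoc a, reassoc_of% h3]
  simp [MonoidalCategory.tensorHom_def]

/-- The identities from here to `over_tensor` involve no trace: they pull the strand V, closed in
the first tensor factor, past the whole second factor by Yang–Baxter and by moving strands over
morphisms. They are the geometric content of `intTensor_comp`. -/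
theorem over_inner {V V' W' B' D' P Q : C} (G : V' ⊗ P ⟶ B' ⊗ Q) (g : W' ⊗ B' ⟶ D' ⊗ V') :
    V' ◁ cri V W' P ≫ cr V' V (W' ⊗ P) ≫
        V ◁ (cr V' W' P ≫ W' ◁ G ≫ tail g Q ≫ cri V' D' Q) =
      cr V' W' (V ⊗ P) ≫ W' ◁ cr V' V P ≫ W' ◁ V ◁ G ≫ W' ◁ cr V B' Q ≫ tail g (V ⊗ Q) ≫
        cri V' D' (V ⊗ Q) ≫ V' ◁ cri V D' Q ≫ cri V V' (D' ⊗ Q) := by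
  have h1 : V' ◁ cri V W' P ≫ cr V' V (W' ⊗ P) ≫ V ◁ cr V' W' P =
      cr V' W' (V ⊗ P) ≫ W' ◁ cr V' V P ≫ cri V W' (V' ⊗ P) := tail_over V' (β_ V W').inv P
  have h2 := tail_over_inv V g Q
  have h3 := cri_yangBaxter V V' D' Q
  have h4 : W' ◁ cr V B' Q ≫ W' ◁ cri V B' Q = 𝟙 _ := by
    rw [← whiskerLeft_comp, cr_cri, whiskerLeft_id]
  rw [← h3, reassoc_of% h2, reassoc_of% h4]
  simp only [whiskerLeft_comp]
  rw [← cri_tail_naturality_assoc, reassoc_of% h1]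

theorem over_outer {V V' W' D D' P Q : C} (K : V' ⊗ (W' ⊗ P) ⟶ V' ⊗ (D' ⊗ Q))
    (L : V' ⊗ (W' ⊗ (V ⊗ P)) ⟶ V' ⊗ (V ⊗ (D' ⊗ Q)))
    (hKL : V' ◁ cri V W' P ≫ cr V' V (W' ⊗ P) ≫ V ◁ K = L ≫ cri V V' (D' ⊗ Q)) :
    V' ◁ W' ◁ cri V D P ≫ V' ◁ cri V W' (D ⊗ P) ≫ V' ◁ V ◁ cr W' D P ≫ cr V' V (D ⊗ (W' ⊗ P)) ≫
        V ◁ cr V' D (W' ⊗ P) ≫ V ◁ D ◁ K ≫ V ◁ cri V' D (D' ⊗ Q) =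
      V' ◁ cr W' D (V ⊗ P) ≫ cr V' D (W' ⊗ (V ⊗ P)) ≫ D ◁ L ≫ cri V' D (V ⊗ (D' ⊗ Q)) ≫
        V' ◁ cri V D (D' ⊗ Q) ≫ cri V V' (D ⊗ (D' ⊗ Q)) := by
  have h1 := congrArg (V' ◁ ·) (tail_over_inv V (β_ W' D).hom P)
  have h2 := tail_over V' (β_ V D).inv (W' ⊗ P)
  have h3 := cri_yangBaxter V V' D (D' ⊗ Q)
  have h4 := congrArg (D ◁ ·) hKL
  simp only [whiskerLeft_comp] at h1 h4
  rw [← h3, ← reassoc_of% h4]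
  have h1' : V' ◁ W' ◁ cri V D P ≫ V' ◁ cri V W' (D ⊗ P) ≫ V' ◁ V ◁ cr W' D P =
    V' ◁ cr W' D (V ⊗ P) ≫ V' ◁ D ◁ cri V W' P ≫ V' ◁ cri V D (W' ⊗ P) := h1.symm
  have h2' : V' ◁ cri V D (W' ⊗ P) ≫ cr V' V (D ⊗ (W' ⊗ P)) ≫ V ◁ cr V' D (W' ⊗ P) =
    cr V' D (V ⊗ (W' ⊗ P)) ≫ D ◁ cr V' V (W' ⊗ P) ≫ cri V D (V' ⊗ (W' ⊗ P)) := h2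
  rw [reassoc_of% h1', reassoc_of% h2', cri_tail_naturality_assoc, cr_tail_naturality_assoc]

theorem over_tensor {V V' W W' B D B' D' P S Q : C} (F : V ⊗ P ⟶ B ⊗ S) (f : W ⊗ B ⟶ D ⊗ V)
    (G : V' ⊗ S ⟶ B' ⊗ Q) (g : W' ⊗ B' ⟶ D' ⊗ V') :
    V' ◁ cr V W' (W ⊗ P) ≫ V' ◁ W' ◁ cr V W P ≫ V' ◁ W' ◁ W ◁ F ≫ V' ◁ W' ◁ tail f S ≫
        V' ◁ W' ◁ cri V D S ≫ V' ◁ cri V W' (D ⊗ S) ≫ V' ◁ V ◁ cr W' D S ≫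
        cr V' V (D ⊗ (W' ⊗ S)) ≫ V ◁ cr V' D (W' ⊗ S) ≫
        V ◁ D ◁ (cr V' W' S ≫ W' ◁ G ≫ tail g Q ≫ cri V' D' Q) ≫
        V ◁ cri V' D (D' ⊗ Q) =
      V' ◁ cr V W' (W ⊗ P) ≫ V' ◁ W' ◁ cr V W P ≫ cr V' W' (W ⊗ (V ⊗ P)) ≫
        W' ◁ cr V' W (V ⊗ P) ≫ W' ◁ W ◁ V' ◁ F ≫ W' ◁ W ◁ cr V' B S ≫ W' ◁ W ◁ B ◁ G ≫
        W' ◁ tail f (B' ⊗ Q) ≫ W' ◁ D ◁ cr V B' Q ≫ cr W' D (B' ⊗ (V ⊗ Q)) ≫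
        D ◁ tail g (V ⊗ Q) ≫ D ◁ cri V' D' (V ⊗ Q) ≫ cri V' D (D' ⊗ (V ⊗ Q)) ≫
        V' ◁ D ◁ cri V D' Q ≫ V' ◁ cri V D (D' ⊗ Q) ≫ cri V V' (D ⊗ (D' ⊗ Q)) := by
  have hi := over_inner (V := V) G g
  have ho := over_outer (V := V) (V' := V') (W' := W') (D := D) (D' := D') (P := S) (Q := Q)
    (cr V' W' S ≫ W' ◁ G ≫ tail g Q ≫ cri V' D' Q)
    (cr V' W' (V ⊗ S) ≫ W' ◁ cr V' V S ≫ W' ◁ V ◁ G ≫ W' ◁ cr V B' Q ≫ tail g (V ⊗ Q) ≫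
        cri V' D' (V ⊗ Q) ≫ V' ◁ cri V D' Q) (by simpa only [Category.assoc] using hi)
  rw [ho]
  have h1 : W' ◁ cr V' W (V ⊗ P) ≫ W' ◁ W ◁ V' ◁ F =
      W' ◁ V' ◁ W ◁ F ≫ W' ◁ cr V' W (B ⊗ S) := by
    rw [← whiskerLeft_comp, cr_tail_naturality, whiskerLeft_comp]
  have h2 : W' ◁ W ◁ B ◁ G ≫ W' ◁ tail f (B' ⊗ Q) = W' ◁ tail f (V' ⊗ S) ≫ W' ◁ D ◁ V ◁ G := by
    rw [← whiskerLeft_comp, ← whiskerLeft_comp, tail_naturality]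
  have h3 := congrArg (W' ◁ ·) (tail_over V' f S)
  simp only [whiskerLeft_comp] at h3 ⊢
  have h4 := cr_yangBaxter V' W' D (V ⊗ S)
  have h5 := cri_tail_naturality_assoc (X := V') (Y := D) (cri V D' Q)
    (V' ◁ cri V D (D' ⊗ Q) ≫ cri V V' (D ⊗ (D' ⊗ Q)))
  rw [reassoc_of% h1, reassoc_of% h2, ← reassoc_of% h3, cr_tail_naturality_assoc,
    cr_tail_naturality_assoc, h5]
  simp only [Category.assoc, reassoc_of% h4, cr_tail_naturality_assoc]

theorem tail_intTensor {A U B V A' U' B' V' : C} (f : V ⊗ A ⟶ B ⊗ U) (g : V' ⊗ A' ⟶ B' ⊗ U')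
    (P : C) :
    tail (intTensor f g) P = (V' ⊗ V) ◁ (α_ A A' P).hom ≫ (α_ V' V (A ⊗ (A' ⊗ P))).hom ≫
      V' ◁ tail f (A' ⊗ P) ≫ V' ◁ B ◁ cr U A' P ≫ cr V' B (A' ⊗ (U ⊗ P)) ≫
        B ◁ tail g (U ⊗ P) ≫ (α_ B B' (U' ⊗ (U ⊗ P))).inv ≫ (B ⊗ B') ◁ (α_ U' U P).inv := by
  simp only [intTensor, tail, cr]
  monoidal

theorem cr_tensor_tensor (V' V W' W P : C) :
    (α_ V' V ((W' ⊗ W) ⊗ P)).inv ≫ cr (V' ⊗ V) (W' ⊗ W) P =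
      V' ◁ V ◁ (α_ W' W P).hom ≫ V' ◁ cr V W' (W ⊗ P) ≫ V' ◁ W' ◁ cr V W P ≫
        cr V' W' (W ⊗ (V ⊗ P)) ≫ W' ◁ cr V' W (V ⊗ P) ≫ (α_ W' W _).inv ≫
          (W' ⊗ W) ◁ (α_ V' V P).inv := by
  rw [cr_tensor_left, cr_tensor_right, cr_tensor_right, Iso.inv_hom_id_assoc]
  simp

/-- The double braiding coming from `loop_tensor` appears as two inverse crossings of V and V'. One
is consumed in `over_tensor`; the other matches the crossing created in `comp_loop_comp_loop_comp`
when one loop is put inside the other. -/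
theorem cri_tensor_tensor_dblInv (V' V D D' Q : C) :
    cri (V' ⊗ V) (D ⊗ D') Q ≫ dblInv V' V ▷ ((D ⊗ D') ⊗ Q) ≫ (α_ V' V ((D ⊗ D') ⊗ Q)).hom =
      (D ⊗ D') ◁ (α_ V' V Q).hom ≫ (α_ D D' _).hom ≫ D ◁ cri V' D' (V ⊗ Q) ≫
        cri V' D (D' ⊗ (V ⊗ Q)) ≫ V' ◁ D ◁ cri V D' Q ≫ V' ◁ cri V D (D' ⊗ Q) ≫
          cri V V' (D ⊗ (D' ⊗ Q)) ≫ cri V' V (D ⊗ (D' ⊗ Q)) ≫ V' ◁ V ◁ (α_ D D' Q).inv := by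
  have h : dblInv V' V ▷ ((D ⊗ D') ⊗ Q) ≫ (α_ V' V ((D ⊗ D') ⊗ Q)).hom =
      (α_ V' V ((D ⊗ D') ⊗ Q)).hom ≫ cri V V' _ ≫ cri V' V _ := by
    simp [dblInv, cri, tail]
  rw [h, cri_tensor_left, cri_tensor_right, cri_tensor_right,
    cri_tail_naturality (X := V') (Y := V) (α_ D D' Q).inv,
    cri_tail_naturality_assoc (X := V) (Y := V') (α_ D D' Q).inv]
  simp

variable [BraidedTracedCategory C]

theorem comp_loop_comp_loop_comp (V V' : C) {P₀ P Q R S T : C} (a : P₀ ⟶ P) (k : V ⊗ P ⟶ V ⊗ Q)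
    (m : Q ⟶ R) (k' : V' ⊗ R ⟶ V' ⊗ S) (b : S ⟶ T) :
    a ≫ loop V k ≫ m ≫ loop V' k' ≫ b =
      loop V (loop V' (V' ◁ V ◁ a ≫ V' ◁ k ≫ V' ◁ V ◁ m ≫ cr V' V R ≫ V ◁ k' ≫ cri V' V S ≫
        V' ◁ V ◁ b)) := by
  rw [comp_loop_comp V a k (m ≫ loop V' k' ≫ b), cri_tail_naturality, ← cr_tail_naturality_assoc]
  simp only [whiskerLeft_comp, whiskerLeft_loop_under, ← loop_comp, ← comp_loop, Category.assoc]

/-- Both sides become double loops over V and V', and their integrands agree by `over_tensor`. -/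
theorem intTensor_comp {A U A' U' B V B' V' D W D' W' : C} (f₁ : V ⊗ A ⟶ B ⊗ U)
    (f₂ : W ⊗ B ⟶ D ⊗ V) (g₁ : V' ⊗ A' ⟶ B' ⊗ U') (g₂ : W' ⊗ B' ⟶ D' ⊗ V') :
    intTensor (intComp f₁ f₂) (intComp g₁ g₂) =
      intComp (intTensor f₁ g₁) (intTensor f₂ g₂) := by
  have h := over_tensor (tail f₁ A' ≫ B ◁ (β_ U A').hom) f₂ (tail g₁ U) g₂
  rw [intComp.eq_1 (intTensor _ _), loop_tensor, intTensor, intComp_tail, intComp_tail,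
    whiskerLeft_loop_under, whiskerLeft_loop_under,
    ← Category.assoc (W' ◁ D ◁ (β_ U A').hom), comp_loop_comp_loop_comp]
  congr 2
  simp only [Category.assoc]
  rw [reassoc_of% (cr_tensor_tensor V' V W' W (A ⊗ A')), cri_tensor_tensor_dblInv]
  rw [tail_intTensor, intTensor]
  trans (V' ◁ V ◁ (α_ W' W (A ⊗ A')).hom ≫ (V' ◁ cr V W' (W ⊗ A ⊗ A') ≫
      V' ◁ W' ◁ cr V W (A ⊗ A') ≫ V' ◁ W' ◁ W ◁ (tail f₁ A' ≫ B ◁ (β_ U A').hom) ≫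
      V' ◁ W' ◁ tail f₂ (A' ⊗ U) ≫ V' ◁ W' ◁ cri V D (A' ⊗ U) ≫ V' ◁ cri V W' (D ⊗ A' ⊗ U) ≫
      V' ◁ V ◁ cr W' D (A' ⊗ U) ≫ cr V' V (D ⊗ W' ⊗ A' ⊗ U) ≫ V ◁ cr V' D (W' ⊗ A' ⊗ U) ≫
      V ◁ D ◁ (cr V' W' (A' ⊗ U) ≫ W' ◁ tail g₁ U ≫ tail g₂ (U' ⊗ U) ≫ cri V' D' (U' ⊗ U)) ≫
      V ◁ cri V' D (D' ⊗ U' ⊗ U)) ≫ cri V' V (D ⊗ D' ⊗ U' ⊗ U)) ≫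
      V' ◁ V ◁ (α_ D D' (U' ⊗ U)).inv
  · have e : tail f₂ (U ⊗ A') ≫ cri V D (U ⊗ A') ≫ V ◁ D ◁ (β_ U A').hom =
      W ◁ B ◁ (β_ U A').hom ≫ tail f₂ (A' ⊗ U) ≫ cri V D (A' ⊗ U) := by
        rw [cri_tail_naturality, tail_naturality_assoc]
    have e2 := congrArg (V' ◁ W' ◁ ·) e
    simp only [whiskerLeft_comp] at e2
    have e3 : V' ◁ cri V W' (D ⊗ (U ⊗ A')) ≫ V' ◁ V ◁ W' ◁ D ◁ (β_ U A').hom =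
      V' ◁ W' ◁ V ◁ D ◁ (β_ U A').hom ≫ V' ◁ cri V W' (D ⊗ (A' ⊗ U)) := by
      rw [← whiskerLeft_comp, cri_tail_naturality, whiskerLeft_comp]
    simp only [whiskerLeft_comp, Category.assoc]
    rw [reassoc_of% e3, reassoc_of% e2]
  · rw [h]
    simp only [whiskerLeft_comp, Category.assoc]
    monoidal

end IntTensor

/-! ### Naturality of the associativity and unit constraints. -/

section IntTensorCoherence

variable {C : Type u} [Category.{v} C] [MonoidalCategory C] [BraidedCategory C]

theorem intTensor_assoc {A₁ U₁ B₁ V₁ A₂ U₂ B₂ V₂ A₃ U₃ B₃ V₃ : C} (f₁ : V₁ ⊗ A₁ ⟶ B₁ ⊗ U₁)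
    (f₂ : V₂ ⊗ A₂ ⟶ B₂ ⊗ U₂) (f₃ : V₃ ⊗ A₃ ⟶ B₃ ⊗ U₃) :
    (α_ V₃ V₂ V₁).hom ▷ _ ≫ intTensor (intTensor f₁ f₂) f₃ ≫ (α_ B₁ B₂ B₃).hom ▷ _ =
      _ ◁ (α_ A₁ A₂ A₃).hom ≫ intTensor f₁ (intTensor f₂ f₃) ≫ _ ◁ (α_ U₃ U₂ U₁).hom := by
  have h1 : V₃ ◁ V₂ ◁ B₁ ◁ A₂ ◁ (β_ U₁ A₃).hom ≫ V₃ ◁ cr V₂ B₁ (A₂ ⊗ (A₃ ⊗ U₁)) ≫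
      V₃ ◁ B₁ ◁ tail f₂ (A₃ ⊗ U₁) = V₃ ◁ cr V₂ B₁ (A₂ ⊗ (U₁ ⊗ A₃)) ≫
        V₃ ◁ B₁ ◁ tail f₂ (U₁ ⊗ A₃) ≫ V₃ ◁ B₁ ◁ B₂ ◁ U₂ ◁ (β_ U₁ A₃).hom := by
    simp only [← whiskerLeft_comp]
    rw [← cr_tail_naturality_assoc, ← whiskerLeft_comp, ← tail_naturality]
  have h2 := cr_tail_naturality (X := V₃) (Y := B₁) (tail f₂ (A₃ ⊗ U₁) ≫ B₂ ◁ cr U₂ A₃ U₁)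
  have hb : (β_ (U₂ ⊗ U₁) A₃).hom = (α_ U₂ U₁ A₃).hom ≫ U₂ ◁ (β_ U₁ A₃).hom ≫ cr U₂ A₃ U₁ := by
    simp [cr, tail, BraidedCategory.braiding_tensor_left_hom]
  have hb' : (β_ U₁ (A₂ ⊗ A₃)).hom = cr U₁ A₂ A₃ ≫ A₂ ◁ (β_ U₁ A₃).hom ≫ (α_ A₂ A₃ U₁).inv := by
    simp [cr, tail, BraidedCategory.braiding_tensor_right_hom]
  rw [intTensor, tail_intTensor, intTensor.eq_1 f₁ (intTensor f₂ f₃), tail_intTensor, hb, hb',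
    cr_tensor_right, cr_tensor_left]
  trans (α_ V₃ V₂ V₁).hom ▷ _ ≫ (α_ V₃ (V₂ ⊗ V₁) _).hom ≫ V₃ ◁ (α_ V₂ V₁ _).hom ≫
    V₃ ◁ V₂ ◁ V₁ ◁ (α_ A₁ A₂ A₃).hom ≫ V₃ ◁ V₂ ◁ tail f₁ (A₂ ⊗ A₃) ≫
    V₃ ◁ V₂ ◁ B₁ ◁ cr U₁ A₂ A₃ ≫ (V₃ ◁ cr V₂ B₁ (A₂ ⊗ (U₁ ⊗ A₃)) ≫
    V₃ ◁ B₁ ◁ tail f₂ (U₁ ⊗ A₃) ≫ V₃ ◁ B₁ ◁ B₂ ◁ U₂ ◁ (β_ U₁ A₃).hom) ≫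
    V₃ ◁ B₁ ◁ B₂ ◁ cr U₂ A₃ U₁ ≫ cr V₃ B₁ (B₂ ⊗ (A₃ ⊗ (U₂ ⊗ U₁))) ≫
    B₁ ◁ cr V₃ B₂ (A₃ ⊗ (U₂ ⊗ U₁)) ≫ B₁ ◁ B₂ ◁ tail f₃ (U₂ ⊗ U₁) ≫
    B₁ ◁ (α_ B₂ B₃ _).inv ≫ (α_ B₁ (B₂ ⊗ B₃) _).inv
  · simp only [whiskerLeft_comp, Category.assoc]
    monoidal
  · simp only [whiskerLeft_comp, Category.assoc] at h2
    rw [← h1]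
    simp only [Category.assoc]
    have hc (X Y : C) {P Q : C} (e : P ≅ Q) :
        cr X Y P = X ◁ Y ◁ e.hom ≫ cr X Y Q ≫ Y ◁ X ◁ e.inv := by
      rw [← cr_tail_naturality_assoc, ← whiskerLeft_comp, ← whiskerLeft_comp, e.hom_inv_id]
      simp
    rw [← reassoc_of% h2, hc V₂ B₁ (α_ A₂ A₃ U₁), hc V₃ B₁ (V₂ ◁ᵢ α_ A₂ A₃ U₁)]
    simp only [whiskerLeftIso_hom, whiskerLeftIso_inv, whiskerLeft_comp, Category.assoc]
    monoidal

theorem id_intTensor_unit {A U B V : C} (f : V ⊗ A ⟶ B ⊗ U) :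
    (ρ_ V).inv ▷ (𝟙_ C ⊗ A) ≫ intTensor (β_ (𝟙_ C) (𝟙_ C)).hom f ≫ (λ_ B).hom ▷ (U ⊗ 𝟙_ C) =
      V ◁ (λ_ A).hom ≫ f ≫ B ◁ (ρ_ U).inv := by
  simp only [intTensor, cr, tail, braiding_tensorUnit_left, braiding_tensorUnit_right]
  monoidal

theorem intTensor_id_unit {A U B V : C} (f : V ⊗ A ⟶ B ⊗ U) :
    (λ_ V).inv ▷ (A ⊗ 𝟙_ C) ≫ intTensor f (β_ (𝟙_ C) (𝟙_ C)).hom ≫ (ρ_ B).hom ▷ (𝟙_ C ⊗ U) =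
      V ◁ (ρ_ A).hom ≫ f ≫ B ◁ (λ_ U).inv := by
  simp only [intTensor, cr, tail, braiding_tensorUnit_left, braiding_tensorUnit_right]
  monoidal

end IntTensorCoherence

/-! ### The monoidal category of pairs. -/

/-- Objects of the `Int` construction: pairs of objects, the second standing for a dual. -/
structure IntObj (C : Type u) where
  /-- the covariant part -/
  pos : C
  /-- the contravariant part -/
  neg : C

/-- Morphisms of the `Int` construction. -/
@[ext]
structure IntHom {C : Type u} [Category.{v} C] [MonoidalCategory C] (X Y : IntObj C) where
  /-- the underlying morphism -/
  hom : Y.neg ⊗ X.pos ⟶ Y.pos ⊗ X.neg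

namespace IntObj

variable {C : Type u} [Category.{v} C] [MonoidalCategory C] [BraidedCategory C]
  [BraidedTracedCategory C]

instance category : Category.{v} (IntObj C) where
  Hom X Y := IntHom X Y
  id X := ⟨(β_ X.neg X.pos).hom⟩
  comp f g := ⟨intComp f.hom g.hom⟩
  id_comp f := IntHom.ext (id_intComp f.hom)
  comp_id f := IntHom.ext (intComp_id f.hom)
  assoc f g h := IntHom.ext (intComp_assoc f.hom g.hom h.hom)

theorem hom_ext {X Y : IntObj C} {f g : X ⟶ Y} (h : f.hom = g.hom) : f = g := IntHom.ext h

theorem id_hom (X : IntObj C) : IntHom.hom (𝟙 X) = (β_ X.neg X.pos).hom := rfl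

theorem comp_hom {X Y Z : IntObj C} (f : X ⟶ Y) (g : Y ⟶ Z) :
    (f ≫ g).hom = intComp f.hom g.hom := rfl

/-- The morphism given by a morphism of the covariant parts and a morphism of the contravariant
parts. -/
def pair {X Y : IntObj C} (a : X.pos ⟶ Y.pos) (b : Y.neg ⟶ X.neg) : X ⟶ Y := ⟨intPair a b⟩

theorem pair_hom {X Y : IntObj C} (a : X.pos ⟶ Y.pos) (b : Y.neg ⟶ X.neg) :
    (pair a b).hom = intPair a b := rfl

theorem pair_id (X : IntObj C) : pair (𝟙 X.pos) (𝟙 X.neg) = 𝟙 X := by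
  apply hom_ext; rw [pair_hom, intPair, id_hom]; simp

/-- Composing with a `pair` needs no trace. As all structure isomorphisms are pairs, the coherence
laws reduce to those of C. -/
theorem pair_comp_hom {X Y Z : IntObj C} (a : X.pos ⟶ Y.pos) (b : Y.neg ⟶ X.neg) (g : Y ⟶ Z) :
    (pair a b ≫ g).hom = Z.neg ◁ a ≫ g.hom ≫ Z.pos ◁ b := by
  rw [comp_hom, pair_hom, intPair, intComp_slide, intComp_push, id_intComp]

theorem comp_pair_hom {X Y Z : IntObj C} (f : X ⟶ Y) (a : Y.pos ⟶ Z.pos) (b : Z.neg ⟶ Y.neg) :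
    (f ≫ pair a b).hom = b ▷ X.pos ≫ f.hom ≫ a ▷ X.neg := by
  rw [comp_hom, pair_hom, intPair, intComp_comp_whiskerRight, intComp_id]

theorem pair_comp_pair {X Y Z : IntObj C} (a : X.pos ⟶ Y.pos) (b : Y.neg ⟶ X.neg)
    (a' : Y.pos ⟶ Z.pos) (b' : Z.neg ⟶ Y.neg) :
    pair a b ≫ pair a' b' = pair (a ≫ a') (b' ≫ b) := by
  apply hom_ext
  rw [comp_pair_hom, pair_hom, pair_hom, intPair, intPair]
  simp

/-- The isomorphism given by isomorphisms of the covariant and the contravariant parts. -/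
@[simps]
def pairIso {X Y : IntObj C} (a : X.pos ≅ Y.pos) (b : Y.neg ≅ X.neg) : X ≅ Y where
  hom := pair a.hom b.hom
  inv := pair a.inv b.inv
  hom_inv_id := by rw [pair_comp_pair, Iso.hom_inv_id, Iso.inv_hom_id, pair_id]
  inv_hom_id := by rw [pair_comp_pair, Iso.inv_hom_id, Iso.hom_inv_id, pair_id]

instance monoidalCategoryStruct : MonoidalCategoryStruct (IntObj C) where
  tensorObj X Y := ⟨X.pos ⊗ Y.pos, Y.neg ⊗ X.neg⟩
  whiskerLeft X _ _ f := ⟨intTensor (IntHom.hom (𝟙 X)) f.hom⟩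
  whiskerRight f Y := ⟨intTensor f.hom (IntHom.hom (𝟙 Y))⟩
  tensorHom f g := ⟨intTensor f.hom g.hom⟩
  tensorUnit := ⟨𝟙_ C, 𝟙_ C⟩
  associator X Y Z := pairIso (α_ X.pos Y.pos Z.pos) (α_ Z.neg Y.neg X.neg)
  leftUnitor X := pairIso (λ_ X.pos) (ρ_ X.neg).symm
  rightUnitor X := pairIso (ρ_ X.pos) (λ_ X.neg).symm

theorem tensor_hom {X Y X' Y' : IntObj C} (f : X ⟶ Y) (g : X' ⟶ Y') :
    (f ⊗ₘ g).hom = intTensor f.hom g.hom := rfl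

theorem pair_tensor_pair {X Y X' Y' : IntObj C} (a : X.pos ⟶ Y.pos) (b : Y.neg ⟶ X.neg)
    (a' : X'.pos ⟶ Y'.pos) (b' : Y'.neg ⟶ X'.neg) :
    pair a b ⊗ₘ pair a' b' = (pair (a ⊗ₘ a') (b' ⊗ₘ b) : X ⊗ X' ⟶ Y ⊗ Y') := by
  apply hom_ext
  rw [tensor_hom, pair_hom, pair_hom, intTensor_intPair]
  rfl

theorem associator_eq (X Y Z : IntObj C) : (α_ X Y Z) =
    pairIso (X := (X ⊗ Y) ⊗ Z) (Y := X ⊗ (Y ⊗ Z)) (α_ X.pos Y.pos Z.pos) (α_ Z.neg Y.neg X.neg) :=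
  rfl

theorem leftUnitor_eq (X : IntObj C) : (λ_ X) =
    pairIso (X := 𝟙_ _ ⊗ X) (λ_ X.pos) (ρ_ X.neg).symm := rfl

theorem rightUnitor_eq (X : IntObj C) : (ρ_ X) =
    pairIso (X := X ⊗ 𝟙_ _) (ρ_ X.pos) (λ_ X.neg).symm := rfl

instance monoidalCategory : MonoidalCategory (IntObj C) := MonoidalCategory.ofTensorHom
  (id_tensorHom_id := fun X Y => by
    rw [← pair_id, ← pair_id, pair_tensor_pair, id_tensorHom_id, id_tensorHom_id]
    exact pair_id (X ⊗ Y))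
  (id_tensorHom := fun _ _ _ _ => rfl)
  (tensorHom_id := fun _ _ => rfl)
  (tensorHom_comp_tensorHom := fun f₁ f₂ g₁ g₂ =>
    hom_ext (intTensor_comp f₁.hom g₁.hom f₂.hom g₂.hom).symm)
  (associator_naturality := fun f₁ f₂ f₃ => by
    apply hom_ext
    simp only [associator_eq, pairIso_hom]
    rw [comp_pair_hom, pair_comp_hom]
    exact intTensor_assoc f₁.hom f₂.hom f₃.hom)
  (leftUnitor_naturality := fun f => by
    apply hom_ext
    simp only [leftUnitor_eq, pairIso_hom]
    rw [comp_pair_hom, pair_comp_hom]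
    exact id_intTensor_unit f.hom)
  (rightUnitor_naturality := fun f => by
    apply hom_ext
    simp only [rightUnitor_eq, pairIso_hom]
    rw [comp_pair_hom, pair_comp_hom]
    exact intTensor_id_unit f.hom)
  (pentagon := fun W X Y Z => by
    simp only [associator_eq, pairIso_hom, ← pair_id, pair_tensor_pair, pair_comp_pair]
    congr 1
    · simp only [id_tensorHom, tensorHom_id]
      exact pentagon W.pos X.pos Y.pos Z.pos
    · simp only [id_tensorHom, tensorHom_id]
      exact (Category.assoc _ _ _).trans (pentagon Z.neg Y.neg X.neg W.neg))
  (triangle := fun X Y => by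
    simp only [associator_eq, leftUnitor_eq, rightUnitor_eq, pairIso_hom, ← pair_id,
      pair_tensor_pair, pair_comp_pair]
    congr 1
    · simp only [id_tensorHom, tensorHom_id]
      exact triangle X.pos Y.pos
    · simp only [id_tensorHom, tensorHom_id]
      exact triangle_assoc_comp_right_inv Y.neg X.neg)

end IntObj

section

variable {C : Type u} [Category.{v} C] [MonoidalCategory C] [BraidedCategory C]

theorem intPair_unit {A B : C} (f : A ⟶ B) :
    intPair f (𝟙 (𝟙_ C)) = (λ_ A).hom ≫ f ≫ (ρ_ B).inv := by
  simp [intPair, braiding_tensorUnit_left]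

end

/-! ### Loop identities behind the triangle equations. -/

section Triangles

variable {C : Type u} [Category.{v} C] [MonoidalCategory C] [BraidedCategory C]
  [BraidedTracedCategory C]

/-- Replaces the objects in a composite by isomorphic ones. It serves to strip the tensor units from
composites with duals, so that only an essential loop remains. -/
theorem intComp_conj {A A' U U' B B' V V' D D' W W' : C} (e : V ≅ V') (a : A ⟶ A') (b : B' ≅ B)
    (u : U' ⟶ U) (w : W ⟶ W') (d : D' ⟶ D) (f : V' ⊗ A' ⟶ B' ⊗ U') (g : W' ⊗ B' ⟶ D' ⊗ V') :
    intComp (e.hom ▷ A ≫ V' ◁ a ≫ f ≫ B' ◁ u ≫ b.hom ▷ U)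
      (w ▷ B ≫ W' ◁ b.inv ≫ g ≫ d ▷ V' ≫ D ◁ e.inv) =
    w ▷ A ≫ W' ◁ a ≫ intComp f g ≫ D' ◁ u ≫ d ▷ U := by
  have h : intComp (V' ◁ a ≫ f ≫ B' ◁ u) g = W' ◁ a ≫ intComp f g ≫ D' ◁ u := by
    rw [intComp, intComp, comp_loop_comp]
    congr 1
    simp only [Category.assoc, whiskerLeft_comp]
    rw [cri_tail_naturality, tail_naturality_assoc, cr_tail_naturality_assoc]
  have h1 : V' ◁ a ≫ f ≫ B' ◁ u ≫ b.hom ▷ U = (V' ◁ a ≫ f ≫ B' ◁ u) ≫ b.hom ▷ U := by simp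
  have h2 : W ◁ b.hom ≫ (w ▷ B ≫ W' ◁ b.inv ≫ g ≫ d ▷ V' ≫ D ◁ e.inv) ≫ D ◁ e.hom =
      w ▷ B' ≫ g ≫ d ▷ V' := by
    simp [whisker_exchange_assoc]
  rw [intComp_slide, h1, intComp_push, h2, intComp_comp_whiskerRight, h]
  simp

theorem intComp_unit_left {A B V D : C} (f : V ⊗ A ⟶ B) (g : B ⟶ D ⊗ V) :
    intComp (f ≫ (ρ_ B).inv) ((λ_ B).hom ≫ g) =
      (λ_ A).hom ≫ loop V (f ≫ g ≫ (β_ V D).inv) ≫ (ρ_ D).inv := by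
  rw [intComp, comp_loop_comp]
  congr 1
  simp only [cr, cri, tail, braiding_tensorUnit_right]
  monoidal

theorem intComp_unit_right {U B V W : C} (f : V ⟶ B ⊗ U) (g : W ⊗ B ⟶ V) :
    intComp ((ρ_ V).hom ≫ f) (g ≫ (λ_ V).inv) =
      (ρ_ W).hom ≫ loop V ((β_ V W).hom ≫ W ◁ f ≫ (α_ W B U).inv ≫ g ▷ U) ≫ (λ_ U).inv := by
  rw [intComp, comp_loop_comp]
  congr 1
  simp only [cr, cri, tail, braiding_inv_tensorUnit_right]
  monoidal

/-- The double braiding of `loop_tensor` cancels the surplus crossings; two yankings remain. -/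
theorem loop_triangle_braiding (S : C) :
    loop (S ⊗ S) ((β_ (S ⊗ S) S).hom ≫ S ◁ (β_ S S).hom ≫ (α_ S S S).inv ≫ (β_ S S).hom ▷ S) =
      𝟙 S := by
  rw [loop_tensor]
  have h : (α_ S S S).inv ≫ ((β_ (S ⊗ S) S).hom ≫ S ◁ (β_ S S).hom ≫ (α_ S S S).inv ≫
      (β_ S S).hom ▷ S) ≫ dblInv S S ▷ S ≫ (α_ S S S).hom =
      tail (β_ S S).hom S ≫ S ◁ (β_ S S).hom := by
    have h' := whiskerLeft_over S (β_ S S).hom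
    rw [← cancel_mono (cr S S S)]
    simp only [Category.assoc]
    refine Eq.trans ?_ h'
    simp [dblInv, cr, tail, BraidedCategory.braiding_tensor_left_hom]
  rw [h, loop_comp, loop_tail, loop_braiding, id_whiskerRight, Category.id_comp, loop_braiding]

/-- Here the double braiding of `loop_tensor` turns a crossing into its inverse. The inner loop is
then a negative curl, which the factor `x ≫ y` has to compensate; the outer loop is yanked. -/
theorem loop_triangle_curl (S : C) (x y : S ⟶ S) (h : loop S (β_ S S).inv ≫ x ≫ y = 𝟙 S) :
    loop (S ⊗ S) ((β_ (S ⊗ S) S).hom ≫ S ◁ (x ▷ S) ≫ (α_ S S S).inv ≫ (S ◁ y) ▷ S) =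
      𝟙 S := by
  rw [loop_tensor]
  have h1 : (α_ S S S).inv ≫ ((β_ (S ⊗ S) S).hom ≫ S ◁ (x ▷ S) ≫ (α_ S S S).inv ≫
      (S ◁ y) ▷ S) ≫ dblInv S S ▷ S ≫ (α_ S S S).hom =
      S ◁ (β_ S S).hom ≫ tail (β_ S S).inv S ≫ S ◁ ((x ≫ y) ▷ S) := by
    have h2 : (β_ S S).hom ≫ S ◁ (x ≫ y) ≫ dblInv S S = (β_ S S).inv ≫ S ◁ (x ≫ y) := by
      simp [dblInv]
    trans S ◁ (β_ S S).hom ≫ tail ((β_ S S).hom ≫ S ◁ (x ≫ y) ≫ dblInv S S) S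
    · simp [tail, BraidedCategory.braiding_tensor_left_hom]
    · rw [h2]; simp [tail]
  rw [h1, comp_loop, loop_comp, loop_tail, ← comp_whiskerRight, h, id_whiskerRight,
    Category.comp_id, loop_braiding]

end Triangles

/-! ### The embedding and the dual objects. -/

namespace IntObj

variable {C : Type u} [Category.{v} C] [MonoidalCategory C] [BraidedCategory C]
  [BraidedTracedCategory C]

variable (C) in
/-- The embedding of a category in its `Int` construction. -/
abbrev incl : C ⥤ IntObj C where
  obj A := ⟨A, 𝟙_ C⟩
  map f := pair f (𝟙 (𝟙_ C))
  map_id A := pair_id (⟨A, 𝟙_ C⟩ : IntObj C)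
  map_comp f g := by rw [pair_comp_pair, Category.comp_id]

theorem incl_map {A B : C} (f : A ⟶ B) :
    (incl C).map f = pair (X := (incl C).obj A) (Y := (incl C).obj B) f (𝟙 (𝟙_ C)) := rfl

theorem incl_map_hom {A B : C} (f : A ⟶ B) :
    ((incl C).map f).hom = (λ_ A).hom ≫ f ≫ (ρ_ B).inv := intPair_unit f

instance incl_full : (incl C).Full where
  map_surjective {A B} g := by
    have h (x : 𝟙_ C ⊗ A ⟶ B ⊗ 𝟙_ C) :
        (λ_ A).hom ≫ ((λ_ A).inv ≫ x ≫ (ρ_ B).hom) ≫ (ρ_ B).inv = x := by simp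
    exact ⟨(λ_ A).inv ≫ g.hom ≫ (ρ_ B).hom, hom_ext ((incl_map_hom _).trans (h g.hom))⟩

instance incl_faithful : (incl C).Faithful where
  map_injective {A B f g} h := by
    have h' : (λ_ A).hom ≫ f ≫ (ρ_ B).inv = (λ_ A).hom ≫ g ≫ (ρ_ B).inv :=
      (incl_map_hom f).symm.trans ((congrArg IntHom.hom h).trans (incl_map_hom g))
    simpa using h'

theorem pair_whiskerRight {X Y : IntObj C} (a : X.pos ⟶ Y.pos) (b : Y.neg ⟶ X.neg)
    (Z : IntObj C) :
    pair a b ▷ Z = (pair (a ▷ Z.pos) (Z.neg ◁ b) : X ⊗ Z ⟶ Y ⊗ Z) := by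
  rw [← tensorHom_id, ← pair_id, pair_tensor_pair, tensorHom_id, id_tensorHom]

theorem whiskerLeft_pair {X Y : IntObj C} (Z : IntObj C) (a : X.pos ⟶ Y.pos)
    (b : Y.neg ⟶ X.neg) :
    Z ◁ pair a b = (pair (Z.pos ◁ a) (b ▷ Z.neg) : Z ⊗ X ⟶ Z ⊗ Y) := by
  rw [← id_tensorHom, ← pair_id, pair_tensor_pair, tensorHom_id, id_tensorHom]

/-- The comparison isomorphism of the embedding. -/
def inclμ (A B : C) : (incl C).obj A ⊗ (incl C).obj B ≅ (incl C).obj (A ⊗ B) :=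
  pairIso (X := (incl C).obj A ⊗ (incl C).obj B) (Y := (incl C).obj (A ⊗ B))
    (Iso.refl _) (λ_ (𝟙_ C)).symm

theorem inclμ_hom (A B : C) : (inclμ A B).hom =
    pair (X := (incl C).obj A ⊗ (incl C).obj B) (Y := (incl C).obj (A ⊗ B)) (𝟙 (A ⊗ B))
      (λ_ (𝟙_ C)).inv := rfl

variable (C) in
/-- The monoidal structure of the embedding. -/
def inclCoreMonoidal : (incl C).CoreMonoidal where
  εIso := Iso.refl _
  μIso := inclμ
  μIso_hom_natural_left f X := by
    rw [inclμ_hom, inclμ_hom, incl_map, incl_map, pair_whiskerRight, pair_comp_pair,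
      pair_comp_pair]
    congr 1
    · exact (Category.comp_id _).trans (Category.id_comp _).symm
    · change (λ_ (𝟙_ C)).inv ≫ 𝟙_ C ◁ 𝟙 (𝟙_ C) = 𝟙 (𝟙_ C) ≫ (λ_ (𝟙_ C)).inv
      simp
  μIso_hom_natural_right X f := by
    rw [inclμ_hom, inclμ_hom, incl_map, incl_map, whiskerLeft_pair, pair_comp_pair,
      pair_comp_pair]
    congr 1
    · exact (Category.comp_id _).trans (Category.id_comp _).symm
    · change (λ_ (𝟙_ C)).inv ≫ 𝟙 (𝟙_ C) ▷ 𝟙_ C = 𝟙 (𝟙_ C) ≫ (λ_ (𝟙_ C)).inv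
      simp
  associativity X Y Z := by
    rw [inclμ_hom, inclμ_hom, inclμ_hom, inclμ_hom, incl_map, pair_whiskerRight,
      whiskerLeft_pair, associator_eq, pairIso_hom, pair_comp_pair, pair_comp_pair,
      pair_comp_pair, pair_comp_pair]
    congr 1
    · change 𝟙 (X ⊗ Y) ▷ Z ≫ 𝟙 _ ≫ (α_ X Y Z).hom = (α_ X Y Z).hom ≫ X ◁ 𝟙 (Y ⊗ Z) ≫ 𝟙 _
      simp
    · change (𝟙 (𝟙_ C) ≫ (λ_ (𝟙_ C)).inv) ≫ 𝟙_ C ◁ (λ_ (𝟙_ C)).inv =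
        ((λ_ (𝟙_ C)).inv ≫ (λ_ (𝟙_ C)).inv ▷ 𝟙_ C) ≫ (α_ (𝟙_ C) (𝟙_ C) (𝟙_ C)).hom
      monoidal
  left_unitality X := by
    rw [Iso.refl_hom, id_whiskerRight, Category.id_comp, inclμ_hom, incl_map, leftUnitor_eq,
      pairIso_hom, pair_comp_pair]
    congr 1
    · change (λ_ X).hom = 𝟙 _ ≫ (λ_ X).hom
      simp
    · change (ρ_ (𝟙_ C)).inv = 𝟙 _ ≫ (λ_ (𝟙_ C)).inv
      monoidal
  right_unitality X := by
    rw [Iso.refl_hom, whiskerLeft_id, Category.id_comp, inclμ_hom, incl_map, rightUnitor_eq,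
      pairIso_hom, pair_comp_pair]
    congr 1
    · change (ρ_ X).hom = 𝟙 _ ≫ (ρ_ X).hom
      simp
    · change (λ_ (𝟙_ C)).inv = 𝟙 _ ≫ (λ_ (𝟙_ C)).inv
      monoidal

instance inclMonoidal : (incl C).Monoidal := (inclCoreMonoidal C).toMonoidal

theorem incl_μ (A B : C) : Functor.LaxMonoidal.μ (incl C) A B = (inclμ A B).hom := rfl

theorem incl_δ (A B : C) : Functor.OplaxMonoidal.δ (incl C) A B = (inclμ A B).inv := rfl

theorem incl_ε : Functor.LaxMonoidal.ε (incl C) = 𝟙 (𝟙_ (IntObj C)) := rfl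

/-- The object standing for the dual of `S`. -/
def star (S : C) : IntObj C := ⟨𝟙_ C, S⟩

/-- A morphism from the unit. -/
def cup {Z : IntObj C} (x : Z.neg ⟶ Z.pos) : 𝟙_ (IntObj C) ⟶ Z := ⟨x ▷ 𝟙_ C⟩

/-- A morphism to the unit. -/
def cap {Z : IntObj C} (y : Z.pos ⟶ Z.neg) : Z ⟶ 𝟙_ (IntObj C) := ⟨𝟙_ C ◁ y⟩

set_option linter.unusedSimpArgs false in
theorem star_incl_triangle_left (S : C) :
    cup (Z := star S ⊗ (incl C).obj S) (𝟙 (𝟙_ C ⊗ S)) ▷ star S ≫ (α_ _ _ _).hom ≫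
      star S ◁ cap (Z := (incl C).obj S ⊗ star S) (𝟙 (S ⊗ 𝟙_ C)) =
    (λ_ _).hom ≫ (ρ_ _).inv := by
  apply hom_ext
  rw [leftUnitor_eq, rightUnitor_eq, associator_eq, pairIso_hom, pairIso_hom, pairIso_inv,
    pair_comp_pair, comp_hom, pair_comp_hom, pair_hom]
  change intComp (intTensor (𝟙 (𝟙_ C ⊗ S) ▷ 𝟙_ C) (β_ S (𝟙_ C)).hom)
    (_ ◁ (α_ (𝟙_ C) S (𝟙_ C)).hom ≫ intTensor (β_ S (𝟙_ C)).hom (𝟙_ C ◁ 𝟙 (S ⊗ 𝟙_ C)) ≫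
      _ ◁ (α_ S (𝟙_ C) S).hom) =
    intPair ((λ_ (𝟙_ C)).hom ≫ (ρ_ (𝟙_ C)).inv) ((λ_ S).hom ≫ (ρ_ S).inv)
  have h := intComp_conj (S ◁ᵢ λ_ S) (λ_ (𝟙_ C)).hom ((λ_ S).symm ≪≫ (ρ_ (𝟙_ C ⊗ S)).symm)
    (ρ_ S).inv (λ_ S).hom (λ_ (𝟙_ C)).inv ((ρ_ (S ⊗ S)).hom ≫ (β_ S S).hom)
    ((β_ S S).hom ≫ (λ_ (S ⊗ S)).inv)
  rw [intComp_unit_right, loop_triangle_braiding] at h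
  refine Eq.trans ?_ (h.trans ?_)
  · congr 1 <;>
    · simp only [intTensor, cr, tail, braiding_tensorUnit_right, braiding_tensorUnit_left,
      BraidedCategory.braiding_tensor_right_hom, BraidedCategory.braiding_tensor_left_hom,
      whiskerLeftIso_hom, whiskerLeftIso_inv, whiskerRightIso_hom, whiskerRightIso_inv,
      Iso.trans_hom, Iso.trans_inv, Iso.symm_hom, Iso.symm_inv]
      monoidal
  · simp only [intPair, BraidedCategory.braiding_tensor_right_hom, braiding_tensorUnit_right,
      BraidedCategory.braiding_tensor_left_hom, braiding_tensorUnit_left]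
    monoidal

set_option linter.unusedSimpArgs false in
theorem star_incl_triangle_right (S : C) :
    (incl C).obj S ◁ cup (Z := star S ⊗ (incl C).obj S) (𝟙 (𝟙_ C ⊗ S)) ≫ (α_ _ _ _).inv ≫
      cap (Z := (incl C).obj S ⊗ star S) (𝟙 (S ⊗ 𝟙_ C)) ▷ (incl C).obj S =
    (ρ_ _).hom ≫ (λ_ _).inv := by
  apply hom_ext
  rw [leftUnitor_eq, rightUnitor_eq, associator_eq, pairIso_hom, pairIso_inv, pairIso_inv,
    pair_comp_pair, comp_hom, pair_comp_hom, pair_hom]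
  change intComp (intTensor (β_ (𝟙_ C) S).hom (𝟙 (𝟙_ C ⊗ S) ▷ 𝟙_ C))
    (_ ◁ (α_ S (𝟙_ C) S).inv ≫ intTensor (𝟙_ C ◁ 𝟙 (S ⊗ 𝟙_ C)) (β_ (𝟙_ C) S).hom ≫
      _ ◁ (α_ (𝟙_ C) S (𝟙_ C)).inv) =
    intPair ((ρ_ S).hom ≫ (λ_ S).inv) ((ρ_ (𝟙_ C)).hom ≫ (λ_ (𝟙_ C)).inv)
  have h := intComp_conj (ρ_ (𝟙_ C ⊗ S) ≪≫ λ_ S) (ρ_ S).hom (S ◁ᵢ (λ_ S).symm)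
    (λ_ (𝟙_ C)).inv (λ_ (𝟙_ C)).hom (λ_ S).inv ((β_ S S).hom ≫ (ρ_ (S ⊗ S)).inv)
    ((λ_ (S ⊗ S)).hom ≫ (β_ S S).hom)
  rw [intComp_unit_left, Iso.hom_inv_id, Category.comp_id, loop_braiding] at h
  refine Eq.trans ?_ (h.trans ?_)
  · congr 1 <;>
    · simp only [intTensor, cr, tail, braiding_tensorUnit_right, braiding_tensorUnit_left,
      BraidedCategory.braiding_tensor_right_hom, BraidedCategory.braiding_tensor_left_hom,
      whiskerLeftIso_hom, whiskerLeftIso_inv, whiskerRightIso_hom, whiskerRightIso_inv,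
      Iso.trans_hom, Iso.trans_inv, Iso.symm_hom, Iso.symm_inv]
      monoidal
  · simp only [intPair, BraidedCategory.braiding_tensor_right_hom, braiding_tensorUnit_right,
      BraidedCategory.braiding_tensor_left_hom, braiding_tensorUnit_left]
    monoidal

-- Once the units are removed, the hypothesis on x and y is what the triangle asserts. For
-- `inclStar` they are the two positive curls.
set_option linter.unusedSimpArgs false in
theorem incl_star_triangle_left (S : C) (x y : S ⟶ S)
    (hxy : loop S (x ▷ S ≫ S ◁ y ≫ (β_ S S).inv) = 𝟙 S) :
    cup (Z := (incl C).obj S ⊗ star S) (x ▷ 𝟙_ C) ▷ (incl C).obj S ≫ (α_ _ _ _).hom ≫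
      (incl C).obj S ◁ cap (Z := star S ⊗ (incl C).obj S) (𝟙_ C ◁ y) =
    (λ_ _).hom ≫ (ρ_ _).inv := by
  apply hom_ext
  rw [leftUnitor_eq, rightUnitor_eq, associator_eq, pairIso_hom, pairIso_hom, pairIso_inv,
    pair_comp_pair, comp_hom, pair_comp_hom, pair_hom]
  change intComp (intTensor ((x ▷ 𝟙_ C) ▷ 𝟙_ C) (β_ (𝟙_ C) S).hom)
    (_ ◁ (α_ S (𝟙_ C) S).hom ≫ intTensor (β_ (𝟙_ C) S).hom (𝟙_ C ◁ 𝟙_ C ◁ y) ≫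
      _ ◁ (α_ (𝟙_ C) S (𝟙_ C)).hom) =
    intPair ((λ_ S).hom ≫ (ρ_ S).inv) ((λ_ (𝟙_ C)).hom ≫ (ρ_ (𝟙_ C)).inv)
  have h := intComp_conj (λ_ (S ⊗ 𝟙_ C) ≪≫ ρ_ S) (λ_ S).hom ((ρ_ S).symm ▷ᵢ S)
    (λ_ (𝟙_ C)).inv (λ_ (𝟙_ C)).hom (ρ_ S).inv (x ▷ S ≫ (ρ_ (S ⊗ S)).inv)
    ((λ_ (S ⊗ S)).hom ≫ S ◁ y)
  rw [intComp_unit_left, hxy] at h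
  refine Eq.trans ?_ (h.trans ?_)
  · congr 1 <;>
    · simp only [intTensor, cr, tail, braiding_tensorUnit_right, braiding_tensorUnit_left,
      BraidedCategory.braiding_tensor_right_hom, BraidedCategory.braiding_tensor_left_hom,
      whiskerLeftIso_hom, whiskerLeftIso_inv, whiskerRightIso_hom, whiskerRightIso_inv,
      Iso.trans_hom, Iso.trans_inv, Iso.symm_hom, Iso.symm_inv]
      monoidal
  · simp only [intPair, BraidedCategory.braiding_tensor_right_hom, braiding_tensorUnit_right,
      BraidedCategory.braiding_tensor_left_hom, braiding_tensorUnit_left]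
    monoidal

set_option linter.unusedSimpArgs false in
theorem incl_star_triangle_right (S : C) (x y : S ⟶ S)
    (hxy : loop S (β_ S S).inv ≫ x ≫ y = 𝟙 S) :
    star S ◁ cup (Z := (incl C).obj S ⊗ star S) (x ▷ 𝟙_ C) ≫ (α_ _ _ _).inv ≫
      cap (Z := star S ⊗ (incl C).obj S) (𝟙_ C ◁ y) ▷ star S =
    (ρ_ _).hom ≫ (λ_ _).inv := by
  apply hom_ext
  rw [leftUnitor_eq, rightUnitor_eq, associator_eq, pairIso_hom, pairIso_inv, pairIso_inv,
    pair_comp_pair, comp_hom, pair_comp_hom, pair_hom]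
  change intComp (intTensor (β_ S (𝟙_ C)).hom ((x ▷ 𝟙_ C) ▷ 𝟙_ C))
    (_ ◁ (α_ (𝟙_ C) S (𝟙_ C)).inv ≫ intTensor (𝟙_ C ◁ 𝟙_ C ◁ y) (β_ S (𝟙_ C)).hom ≫
      _ ◁ (α_ S (𝟙_ C) S).inv) =
    intPair ((ρ_ (𝟙_ C)).hom ≫ (λ_ (𝟙_ C)).inv) ((ρ_ S).hom ≫ (λ_ S).inv)
  have h := intComp_conj (ρ_ S ▷ᵢ S) (λ_ (𝟙_ C)).hom ((ρ_ S).symm ≪≫ (λ_ (S ⊗ 𝟙_ C)).symm)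
    (λ_ S).inv (ρ_ S).hom (λ_ (𝟙_ C)).inv ((ρ_ (S ⊗ S)).hom ≫ x ▷ S)
    (S ◁ y ≫ (λ_ (S ⊗ S)).inv)
  rw [intComp_unit_right, loop_triangle_curl S x y hxy] at h
  refine Eq.trans ?_ (h.trans ?_)
  · congr 1 <;>
    · simp only [intTensor, cr, tail, braiding_tensorUnit_right, braiding_tensorUnit_left,
      BraidedCategory.braiding_tensor_right_hom, BraidedCategory.braiding_tensor_left_hom,
      whiskerLeftIso_hom, whiskerLeftIso_inv, whiskerRightIso_hom, whiskerRightIso_inv,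
      Iso.trans_hom, Iso.trans_inv, Iso.symm_hom, Iso.symm_inv]
      monoidal
  · simp only [intPair, BraidedCategory.braiding_tensor_right_hom, braiding_tensorUnit_right,
      BraidedCategory.braiding_tensor_left_hom, braiding_tensorUnit_left]
    monoidal

/-- `S*` is a left dual of `S`. -/
@[reducible]
def starIncl (S : C) : ExactPairing (star S) ((incl C).obj S) where
  coevaluation' := cup (Z := star S ⊗ (incl C).obj S) (𝟙 (𝟙_ C ⊗ S))
  evaluation' := cap (Z := (incl C).obj S ⊗ star S) (𝟙 (S ⊗ 𝟙_ C))
  coevaluation_evaluation' := star_incl_triangle_right S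
  evaluation_coevaluation' := star_incl_triangle_left S

/-- Naturality and sliding collect both curls outside the loop, and `curlInv_eq` makes them cancel
what the loop leaves. -/
theorem loop_curlR_curl (S : C) :
    loop S (curlR S ▷ S ≫ S ◁ curl S ≫ (β_ S S).inv) = 𝟙 S := by
  rw [BraidedCategory.braiding_inv_naturality_right, loop_slide, Category.assoc,
    ← comp_whiskerRight, ← BraidedCategory.braiding_inv_naturality_right, comp_loop,
    ← curl_naturality (curlR S), Category.assoc, ← curl_naturality (loop S (β_ S S).inv),
    ← Category.assoc, ← curlR_naturality, ← curlInv_eq, curlInv_curl]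

/-- `S*` is a right dual of `S`. -/
@[reducible]
def inclStar (S : C) : ExactPairing ((incl C).obj S) (star S) where
  coevaluation' := cup (Z := (incl C).obj S ⊗ star S) (curlR S ▷ 𝟙_ C)
  evaluation' := cap (Z := star S ⊗ (incl C).obj S) (𝟙_ C ◁ curl S)
  coevaluation_evaluation' := incl_star_triangle_right S _ _ (by
    rw [← Category.assoc, ← curlInv_eq, curlInv_curl])
  evaluation_coevaluation' := incl_star_triangle_left S _ _ (loop_curlR_curl S)

end IntObj

/-! ### Extending structures from generators to all objects. -/

section Lifting

universe w v' u'

/-- Extra structure on the objects of a monoidal category, with a monoidal notion of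
structure-preserving morphism. -/
structure MonoidalStr (D : Type u) [Category.{v} D] [MonoidalCategory D] where
  /-- structures on an object -/
  Str : D → Type w
  /-- structure-preserving morphisms -/
  IsHom : ∀ {X Y : D}, Str X → Str Y → (X ⟶ Y) → Prop
  id : ∀ {X : D} (s : Str X), IsHom s s (𝟙 X)
  comp : ∀ {X Y Z : D} {s : Str X} {t : Str Y} {r : Str Z} {f : X ⟶ Y} {g : Y ⟶ Z},
    IsHom s t f → IsHom t r g → IsHom s r (f ≫ g)
  inv : ∀ {X Y : D} {s : Str X} {t : Str Y} (e : X ≅ Y), IsHom s t e.hom → IsHom t s e.inv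
  /-- structures on a tensor product -/
  tensor : ∀ {X Y : D}, Str X → Str Y → Str (X ⊗ Y)
  /-- the structure on the unit -/
  unit : Str (𝟙_ D)
  whiskerLeft : ∀ {X Y Z : D} (r : Str Z) {s : Str X} {t : Str Y} {f : X ⟶ Y}, IsHom s t f →
    IsHom (tensor r s) (tensor r t) (Z ◁ f)
  whiskerRight : ∀ {X Y Z : D} {s : Str X} {t : Str Y} {f : X ⟶ Y}, IsHom s t f →
    ∀ r : Str Z, IsHom (tensor s r) (tensor t r) (f ▷ Z)
  associator : ∀ {X Y Z : D} (s : Str X) (t : Str Y) (r : Str Z),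
    IsHom (tensor (tensor s t) r) (tensor s (tensor t r)) (α_ X Y Z).hom
  leftUnitor : ∀ {X : D} (s : Str X), IsHom (tensor unit s) s (λ_ X).hom
  rightUnitor : ∀ {X : D} (s : Str X), IsHom (tensor s unit) s (ρ_ X).hom
  transport : ∀ {X Y : D} (s : Str X) (e : X ≅ Y), ∃ t : Str Y, IsHom s t e.hom

namespace MonoidalStr

variable {D : Type u} [Category.{v} D] [MonoidalCategory D] (M : MonoidalStr.{v, u, w} D)

/-- Two structures are related by a structure-preserving isomorphism. -/
def Equivalent {X Y : D} (s : M.Str X) (t : M.Str Y) : Prop :=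
  ∃ e : X ≅ Y, M.IsHom s t e.hom

/-- All morphisms preserve the structures. -/
def Full {X Y : D} (s : M.Str X) (t : M.Str Y) : Prop := ∀ f : X ⟶ Y, M.IsHom s t f

variable {M}

theorem Equivalent.refl {X : D} (s : M.Str X) : M.Equivalent s s := ⟨Iso.refl X, M.id s⟩

theorem Equivalent.symm {X Y : D} {s : M.Str X} {t : M.Str Y} (h : M.Equivalent s t) :
    M.Equivalent t s := by
  obtain ⟨e, he⟩ := h
  exact ⟨e.symm, M.inv e he⟩

theorem Equivalent.trans {X Y Z : D} {s : M.Str X} {t : M.Str Y} {r : M.Str Z}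
    (h : M.Equivalent s t) (h' : M.Equivalent t r) : M.Equivalent s r := by
  obtain ⟨e, he⟩ := h
  obtain ⟨e', he'⟩ := h'
  exact ⟨e ≪≫ e', M.comp he he'⟩

theorem Equivalent.tensor {X Y X' Y' : D} {s : M.Str X} {t : M.Str Y} {s' : M.Str X'}
    {t' : M.Str Y'} (h : M.Equivalent s t) (h' : M.Equivalent s' t') :
    M.Equivalent (M.tensor s s') (M.tensor t t') := by
  obtain ⟨e, he⟩ := h
  obtain ⟨e', he'⟩ := h'
  exact ⟨(e ▷ᵢ X') ≪≫ (Y ◁ᵢ e'), M.comp (M.whiskerRight he s') (M.whiskerLeft t he')⟩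

theorem equivalent_associator {X Y Z : D} (s : M.Str X) (t : M.Str Y) (r : M.Str Z) :
    M.Equivalent (M.tensor (M.tensor s t) r) (M.tensor s (M.tensor t r)) :=
  ⟨α_ X Y Z, M.associator s t r⟩

theorem equivalent_tensor_unit {X : D} (s : M.Str X) : M.Equivalent (M.tensor s M.unit) s :=
  ⟨ρ_ X, M.rightUnitor s⟩

theorem Full.congr {X Y X' Y' : D} {s : M.Str X} {t : M.Str Y} {s' : M.Str X'} {t' : M.Str Y'}
    (hs : M.Equivalent s s') (ht : M.Equivalent t t') (h : M.Full s t) : M.Full s' t' := by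
  obtain ⟨e, he⟩ := hs
  obtain ⟨e', he'⟩ := ht
  intro f
  have := M.comp (M.inv e he) (M.comp (h (e.hom ≫ f ≫ e'.inv)) he')
  simpa using this

/-- A morphism is recovered from its transpose, the coevaluation and coherence maps, and each of
these preserves the structures. -/
theorem Full.transpose_left {X Z S T : D} [ExactPairing T S] {σ : M.Str T} {φ : M.Str S}
    {s : M.Str X} {t : M.Str Z} (hη : M.IsHom M.unit (M.tensor σ φ) (η_ T S))
    (h : M.Full (M.tensor φ s) t) : M.Full s (M.tensor σ t) := by
  intro f
  rw [← (tensorLeftHomEquiv X T S Z).apply_symm_apply f]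
  exact M.comp (M.inv (λ_ X) (M.leftUnitor s)) (M.comp (M.whiskerRight hη s)
    (M.comp (M.associator σ φ s) (M.whiskerLeft σ (h _))))

theorem Full.transpose_right {X Z S T : D} [ExactPairing T S] {σ : M.Str T} {φ : M.Str S}
    {s : M.Str X} {t : M.Str Z} (hε : M.IsHom (M.tensor φ σ) M.unit (ε_ T S))
    (h : M.Full s (M.tensor t φ)) : M.Full (M.tensor s σ) t := by
  intro f
  rw [← (tensorRightHomEquiv X T S Z).symm_apply_apply f]
  exact M.comp (M.whiskerRight (h _) σ) (M.comp (M.associator t φ σ)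
    (M.comp (M.whiskerLeft t hε) (M.rightUnitor t)))

end MonoidalStr

/-- A monoidal category generated by the image of a full monoidal functor and duals of it. -/
structure DualGenerated {C : Type u'} [Category.{v'} C] [MonoidalCategory C]
    {D : Type u} [Category.{v} D] [MonoidalCategory D] (F : C ⥤ D) [F.Monoidal] where
  full : F.Full
  /-- the dual objects -/
  star : C → D
  /-- the duality -/
  pairing : ∀ S, ExactPairing (star S) (F.obj S)
  exists_iso : ∀ Z : D, ∃ A U, Nonempty (F.obj A ⊗ star U ≅ Z)
  exists_swap : ∀ B V, Nonempty (F.obj B ⊗ star V ≅ star V ⊗ F.obj B)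
  exists_tensor : ∀ U V, ∃ W, Nonempty (star U ⊗ star V ≅ star W)
  exists_unit : ∃ W, Nonempty (𝟙_ D ≅ star W)

/-- Structures on the generators of a category which is generated by duals. -/
structure DualGenerated.Lift {C : Type u'} [Category.{v'} C] [MonoidalCategory C]
    {D : Type u} [Category.{v} D] [MonoidalCategory D] {F : C ⥤ D} [F.Monoidal]
    (G : DualGenerated F) (M : MonoidalStr.{v, u, w} D) where
  /-- structures on the image of the functor -/
  φ : ∀ A, M.Str (F.obj A)
  /-- structures on the duals -/
  σ : ∀ S, M.Str (G.star S)
  map : ∀ {A B : C} (f : A ⟶ B), M.IsHom (φ A) (φ B) (F.map f)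
  μ : ∀ A B, M.IsHom (M.tensor (φ A) (φ B)) (φ (A ⊗ B)) (Functor.LaxMonoidal.μ F A B)
  ε : M.IsHom M.unit (φ (𝟙_ C)) (Functor.LaxMonoidal.ε F)
  coevaluation : ∀ S, M.IsHom M.unit (M.tensor (σ S) (φ S))
    (@ExactPairing.coevaluation D _ _ (G.star S) (F.obj S) (G.pairing S))
  evaluation : ∀ S, M.IsHom (M.tensor (φ S) (σ S)) M.unit
    (@ExactPairing.evaluation D _ _ (G.star S) (F.obj S) (G.pairing S))

namespace DualGenerated.Lift

open MonoidalStr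

variable {C : Type u'} [Category.{v'} C] [MonoidalCategory C]
  {D : Type u} [Category.{v} D] [MonoidalCategory D] {F : C ⥤ D} [F.Monoidal]
  {G : DualGenerated F} {M : MonoidalStr.{v, u, w} D} (L : G.Lift M)

/-- Structures equivalent to one in the image of the functor. -/
def IsPos {X : D} (s : M.Str X) : Prop := ∃ A, M.Equivalent s (L.φ A)

/-- Structures equivalent to a product of a generator and a dual generator. -/
def IsNormal {X : D} (s : M.Str X) : Prop :=
  ∃ A U, M.Equivalent s (M.tensor (L.φ A) (L.σ U))

variable {L}

theorem isPos_φ (A : C) : L.IsPos (L.φ A) := ⟨A, Equivalent.refl _⟩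

theorem isPos_unit : L.IsPos M.unit := ⟨𝟙_ C, Functor.Monoidal.εIso F, L.ε⟩

theorem IsPos.tensor {X Y : D} {s : M.Str X} {t : M.Str Y} (hs : L.IsPos s) (ht : L.IsPos t) :
    L.IsPos (M.tensor s t) := by
  obtain ⟨A, hA⟩ := hs
  obtain ⟨B, hB⟩ := ht
  exact ⟨A ⊗ B, (hA.tensor hB).trans ⟨Functor.Monoidal.μIso F A B, L.μ A B⟩⟩

theorem IsPos.full {X Y : D} {s : M.Str X} {t : M.Str Y} (hs : L.IsPos s) (ht : L.IsPos t) :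
    M.Full s t := by
  obtain ⟨A, hA⟩ := hs
  obtain ⟨B, hB⟩ := ht
  refine Full.congr hA.symm hB.symm fun f => ?_
  obtain ⟨g, rfl⟩ := G.full.map_surjective f
  exact L.map g

theorem full_tensor_σ {X Z : D} {s : M.Str X} {t : M.Str Z} (S : C)
    (h : M.Full s (M.tensor t (L.φ S))) : M.Full (M.tensor s (L.σ S)) t :=
  letI := G.pairing S
  Full.transpose_right (L.evaluation S) h

theorem full_σ_tensor {X Z : D} {s : M.Str X} {t : M.Str Z} (S : C)
    (h : M.Full (M.tensor (L.φ S) s) t) : M.Full s (M.tensor (L.σ S) t) :=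
  letI := G.pairing S
  Full.transpose_left (L.coevaluation S) h

theorem full_σ {X : D} {s : M.Str X} (S : C)
    (h : M.Full (M.tensor (L.φ S) s) M.unit) : M.Full s (L.σ S) :=
  (full_σ_tensor S h).congr (Equivalent.refl _) (equivalent_tensor_unit _)

/-- Moving both duals across leaves a morphism between products of objects in the image of F, which
lifts to C by fullness. Everything about normal forms follows from this. -/
theorem full_tensor_σ_σ_tensor (A U B V : C) :
    M.Full (M.tensor (L.φ A) (L.σ U)) (M.tensor (L.σ V) (L.φ B)) :=
  full_σ_tensor V (Full.congr (equivalent_associator _ _ _) (Equivalent.refl _)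
    (full_tensor_σ U (((isPos_φ V).tensor (isPos_φ A)).full ((isPos_φ B).tensor (isPos_φ U)))))

/-- Any isomorphism between the underlying objects will do, as fullness makes it
structure-preserving. The generators therefore need only bare isomorphisms, with no coherence. -/
theorem equivalent_swap (B V : C) :
    M.Equivalent (M.tensor (L.φ B) (L.σ V)) (M.tensor (L.σ V) (L.φ B)) := by
  obtain ⟨e⟩ := G.exists_swap B V
  exact ⟨e, full_tensor_σ_σ_tensor B V B V e.hom⟩

theorem exists_equivalent_σ (U V : C) : ∃ W, M.Equivalent (M.tensor (L.σ U) (L.σ V)) (L.σ W) := by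
  obtain ⟨W, ⟨e⟩⟩ := G.exists_tensor U V
  exact ⟨W, e, full_σ W (Full.congr (equivalent_associator _ _ _) (Equivalent.refl _)
    (full_tensor_σ V (full_tensor_σ U ((isPos_φ W).full
      ((isPos_unit.tensor (isPos_φ V)).tensor (isPos_φ U)))))) _⟩

theorem exists_unit_equivalent_σ : ∃ W, M.Equivalent M.unit (L.σ W) := by
  obtain ⟨W, ⟨e⟩⟩ := G.exists_unit
  exact ⟨W, e, full_σ W (((isPos_φ W).tensor isPos_unit).full isPos_unit) _⟩

theorem IsNormal.full {X Y : D} {s : M.Str X} {t : M.Str Y} (hs : L.IsNormal s)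
    (ht : L.IsNormal t) : M.Full s t := by
  obtain ⟨A, U, hA⟩ := hs
  obtain ⟨B, V, hB⟩ := ht
  exact (full_tensor_σ_σ_tensor A U B V).congr hA.symm ((hB.trans (equivalent_swap B V)).symm)

theorem IsPos.isNormal {X : D} {s : M.Str X} (hs : L.IsPos s) : L.IsNormal s := by
  obtain ⟨A, hA⟩ := hs
  obtain ⟨W, hW⟩ := exists_unit_equivalent_σ (L := L)
  exact ⟨A, W, hA.trans ((equivalent_tensor_unit _).symm.trans ((Equivalent.refl _).tensor hW))⟩

theorem IsNormal.tensor {X Y : D} {s : M.Str X} {t : M.Str Y} (hs : L.IsNormal s)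
    (ht : L.IsNormal t) : L.IsNormal (M.tensor s t) := by
  obtain ⟨A, U, hA⟩ := hs
  obtain ⟨B, V, hB⟩ := ht
  obtain ⟨W, hW⟩ := exists_equivalent_σ (L := L) U V
  obtain ⟨E, hE⟩ := (isPos_φ A).tensor (isPos_φ (L := L) B)
  refine ⟨E, W, (hA.tensor hB).trans ((equivalent_associator _ _ _).trans ?_)⟩
  refine Equivalent.trans ((Equivalent.refl _).tensor ((equivalent_associator _ _ _).symm.trans
    (((equivalent_swap B U).symm.tensor (Equivalent.refl _)).trans
      (equivalent_associator _ _ _)))) ?_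
  exact (equivalent_associator _ _ _).symm.trans (hE.tensor hW)

/-- Structures on the generators extend to all objects in such a way that all morphisms preserve
the structure. -/
theorem exists_extension (L : G.Lift M) : ∃ h : ∀ Z, M.Str Z,
    (∀ {Z W : D} (f : Z ⟶ W), M.IsHom (h Z) (h W) f) ∧
    (∀ Z W, M.IsHom (h (Z ⊗ W)) (M.tensor (h Z) (h W)) (𝟙 (Z ⊗ W))) ∧
    M.IsHom (h (𝟙_ D)) M.unit (𝟙 (𝟙_ D)) ∧
    ∀ A, M.IsHom (h (F.obj A)) (L.φ A) (𝟙 (F.obj A)) := by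
  -- The structure on Z is transported along an arbitrary isomorphism from a normal form; the
  -- choices are coherent afterwards because all morphisms between normal structures preserve them.
  have H : ∀ Z, ∃ s : M.Str Z, L.IsNormal s := fun Z => by
    obtain ⟨A, U, ⟨e⟩⟩ := G.exists_iso Z
    obtain ⟨t, ht⟩ := M.transport (M.tensor (L.φ A) (L.σ U)) e
    exact ⟨t, A, U, Equivalent.symm ⟨e, ht⟩⟩
  choose h hh using H
  exact ⟨h, fun f => (hh _).full (hh _) f, fun Z W => (hh _).full ((hh Z).tensor (hh W)) _,
    (hh _).full isPos_unit.isNormal _, fun A => (hh _).full (isPos_φ A).isNormal _⟩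

end DualGenerated.Lift

end Lifting

/-! ### Mates, two-sided duals and pivotal structures. -/

section Mates

variable {D : Type u} [Category.{v} D] [MonoidalCategory D]

/-- The morphisms `f` and `g` correspond to each other under duality. -/
def IsMate {X Y X' Y' : D} (E : ExactPairing X Y) (E' : ExactPairing X' Y') (f : X ⟶ X')
    (g : Y' ⟶ Y) : Prop :=
  E.coevaluation' ≫ f ▷ Y = E'.coevaluation' ≫ X' ◁ g

theorem tensor_coevaluation {X Y X' Y' : D} (E : ExactPairing X Y) (E' : ExactPairing X' Y') :
    (@ExactPairing.tensor D _ _ X X' Y Y' E E').coevaluation' =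
      E.coevaluation' ⊗≫ (X ◁ E'.coevaluation') ▷ Y ⊗≫ 𝟙 _ := rfl

theorem unit_coevaluation :
    (exactPairingUnit : ExactPairing (𝟙_ D) (𝟙_ D)).coevaluation' = (ρ_ (𝟙_ D)).inv := rfl

theorem tensor_evaluation {X Y X' Y' : D} (E : ExactPairing X Y) (E' : ExactPairing X' Y') :
    (@ExactPairing.tensor D _ _ X X' Y Y' E E').evaluation' =
      (α_ Y' Y (X ⊗ X')).hom ≫ Y' ◁ ((α_ Y X X').inv ≫ E.evaluation' ▷ X' ≫ (λ_ X').hom) ≫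
        E'.evaluation' := by
  change 𝟙 _ ⊗≫ Y' ◁ (E.evaluation' ▷ X') ⊗≫ E'.evaluation' = _
  monoidal

namespace IsMate

variable {X Y X' Y' X'' Y'' : D} {E : ExactPairing X Y} {E' : ExactPairing X' Y'}
  {E'' : ExactPairing X'' Y''}

theorem rightAdjointMate (E : ExactPairing X Y) (E' : ExactPairing X' Y') (f : X ⟶ X') :
    IsMate E E' f (@rightAdjointMate D _ _ X X' ⟨Y⟩ ⟨Y'⟩ f) :=
  (@coevaluation_comp_rightAdjointMate D _ _ X X' ⟨Y⟩ ⟨Y'⟩ f).symm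

theorem leftAdjointMate (E : ExactPairing X Y) (E' : ExactPairing X' Y') (g : Y' ⟶ Y) :
    IsMate E E' (@leftAdjointMate D _ _ Y' Y ⟨X'⟩ ⟨X⟩ g) g :=
  @coevaluation_comp_leftAdjointMate D _ _ Y' Y ⟨X'⟩ ⟨X⟩ g

theorem unique_right {f : X ⟶ X'} {g g' : Y' ⟶ Y} (h : IsMate E E' f g)
    (h' : IsMate E E' f g') : g = g' := by
  have := congrArg (@tensorLeftHomEquiv D _ _ (𝟙_ D) X' Y' Y E').symm (h.symm.trans h')
  change (@tensorLeftHomEquiv D _ _ (𝟙_ D) X' Y' Y E').symm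
      (@ExactPairing.coevaluation D _ _ X' Y' E' ≫ X' ◁ g) =
    (@tensorLeftHomEquiv D _ _ (𝟙_ D) X' Y' Y E').symm
      (@ExactPairing.coevaluation D _ _ X' Y' E' ≫ X' ◁ g') at this
  rw [tensorLeftHomEquiv_symm_coevaluation_comp_whiskerLeft,
    tensorLeftHomEquiv_symm_coevaluation_comp_whiskerLeft] at this
  exact (cancel_epi _).1 this

theorem unique_left {f f' : X ⟶ X'} {g : Y' ⟶ Y} (h : IsMate E E' f g)
    (h' : IsMate E E' f' g) : f = f' := by
  have := congrArg (@tensorRightHomEquiv D _ _ (𝟙_ D) X Y X' E).symm (h.trans h'.symm)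
  change (@tensorRightHomEquiv D _ _ (𝟙_ D) X Y X' E).symm
      (@ExactPairing.coevaluation D _ _ X Y E ≫ f ▷ Y) =
    (@tensorRightHomEquiv D _ _ (𝟙_ D) X Y X' E).symm
      (@ExactPairing.coevaluation D _ _ X Y E ≫ f' ▷ Y) at this
  rw [tensorRightHomEquiv_symm_coevaluation_comp_whiskerRight,
    tensorRightHomEquiv_symm_coevaluation_comp_whiskerRight] at this
  exact (cancel_epi _).1 this

theorem comp_evaluation {f : X ⟶ X'} {g : Y' ⟶ Y} (h : IsMate E E' f g) :
    g ▷ X ≫ E.evaluation' = Y' ◁ f ≫ E'.evaluation' := by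
  rw [h.unique_right (IsMate.rightAdjointMate E E' f)]
  exact @rightAdjointMate_comp_evaluation D _ _ X X' ⟨Y⟩ ⟨Y'⟩ f

/-- Mates may be tested on evaluations instead of coevaluations, which is the form in which duals of
tensor products in Int are computed. -/
theorem of_comp_evaluation {f : X ⟶ X'} {g : Y' ⟶ Y}
    (h : g ▷ X ≫ E.evaluation' = Y' ◁ f ≫ E'.evaluation') : IsMate E E' f g := by
  have h₀ := IsMate.rightAdjointMate E E' f
  have := congrArg (@tensorRightHomEquiv D _ _ Y' X Y (𝟙_ D) E) (h.trans h₀.comp_evaluation.symm)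
  change (@tensorRightHomEquiv D _ _ Y' X Y (𝟙_ D) E)
      (g ▷ X ≫ @ExactPairing.evaluation D _ _ X Y E) =
    (@tensorRightHomEquiv D _ _ Y' X Y (𝟙_ D) E)
      (_ ▷ X ≫ @ExactPairing.evaluation D _ _ X Y E) at this
  have e (k : Y' ⟶ Y) : (@tensorRightHomEquiv D _ _ Y' X Y (𝟙_ D) E)
      (k ▷ X ≫ @ExactPairing.evaluation D _ _ X Y E) = k ≫ (λ_ Y).inv :=
    @tensorRightHomEquiv_whiskerRight_comp_evaluation D _ _ X Y' (@HasRightDual.mk D _ _ X Y E) k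
  rw [e, e] at this
  rwa [(cancel_mono _).1 this]

theorem id (E : ExactPairing X Y) : IsMate E E (𝟙 X) (𝟙 Y) := by
  simp [IsMate]

theorem comp {f : X ⟶ X'} {g : Y' ⟶ Y} {f' : X' ⟶ X''} {g' : Y'' ⟶ Y'} (h : IsMate E E' f g)
    (h' : IsMate E' E'' f' g') : IsMate E E'' (f ≫ f') (g' ≫ g) := by
  unfold IsMate at *
  rw [comp_whiskerRight, reassoc_of% h, whiskerLeft_comp, ← reassoc_of% h', whisker_exchange]

theorem comp_id {E'' : ExactPairing X'' Y'} {f : X ⟶ X'} {g : Y' ⟶ Y} {f' : X' ⟶ X''}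
    (h : IsMate E E' f g) (h' : IsMate E' E'' f' (𝟙 Y')) : IsMate E E'' (f ≫ f') g := by
  have := h.comp h'
  rwa [Category.id_comp] at this

theorem id_comp {E' : ExactPairing X' Y} {f : X ⟶ X'} {g : Y'' ⟶ Y} {f' : X' ⟶ X''}
    (h : IsMate E E' f (𝟙 Y)) (h' : IsMate E' E'' f' g) : IsMate E E'' (f ≫ f') g := by
  have := h.comp h'
  rwa [Category.comp_id] at this

theorem inv {f : X ≅ X'} {g : Y' ≅ Y} (h : IsMate E E' f.hom g.hom) :
    IsMate E' E f.inv g.inv := by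
  unfold IsMate at *
  rw [← cancel_mono (f.hom ▷ Y'), ← cancel_mono (X' ◁ g.hom), Category.assoc, Category.assoc,
    Category.assoc, Category.assoc, ← comp_whiskerRight_assoc, f.inv_hom_id, id_whiskerRight,
    Category.id_comp, ← h, whisker_exchange_assoc, ← whiskerLeft_comp, g.inv_hom_id,
    whiskerLeft_id, Category.comp_id]

/-- The mate of an isomorphism is an isomorphism. -/
def rightIso (f : X ≅ X') {g : Y' ⟶ Y} (h : IsMate E E' f.hom g) : Y' ≅ Y where
  hom := g
  inv := @CategoryTheory.rightAdjointMate D _ _ X' X ⟨Y'⟩ ⟨Y⟩ f.inv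
  hom_inv_id := by
    have h' := (IsMate.rightAdjointMate E' E f.inv).comp h
    rw [f.inv_hom_id] at h'
    exact h'.unique_right (IsMate.id E')
  inv_hom_id := by
    have h' := h.comp (IsMate.rightAdjointMate E' E f.inv)
    rw [f.hom_inv_id] at h'
    exact h'.unique_right (IsMate.id E)

theorem tensor {X₁ Y₁ X₁' Y₁' : D} {E₁ : ExactPairing X₁ Y₁} {E₁' : ExactPairing X₁' Y₁'}
    {f : X ⟶ X'} {g : Y' ⟶ Y} {f₁ : X₁ ⟶ X₁'} {g₁ : Y₁' ⟶ Y₁} (h : IsMate E E' f g)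
    (h₁ : IsMate E₁ E₁' f₁ g₁) :
    IsMate (@ExactPairing.tensor D _ _ X X₁ Y Y₁ E E₁)
      (@ExactPairing.tensor D _ _ X' X₁' Y' Y₁' E' E₁') (f ⊗ₘ f₁) (g₁ ⊗ₘ g) := by
  unfold IsMate at *
  rw [tensor_coevaluation, tensor_coevaluation]
  calc
    _ = E.coevaluation' ⊗≫ ((X ◁ E₁.coevaluation' ≫ f ▷ (X₁ ⊗ Y₁)) ⊗≫ X' ◁ f₁ ▷ Y₁) ▷ Y ⊗≫
        𝟙 _ := by
      rw [MonoidalCategory.tensorHom_def]; monoidal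
    _ = (E.coevaluation' ≫ f ▷ Y) ⊗≫ X' ◁ (E₁.coevaluation' ≫ f₁ ▷ Y₁) ▷ Y ⊗≫ 𝟙 _ := by
      rw [whisker_exchange]; monoidal
    _ = E'.coevaluation' ⊗≫ X' ◁ (𝟙_ D ◁ g ≫ E₁'.coevaluation' ▷ Y) ⊗≫
        (X' ⊗ X₁') ◁ (g₁ ▷ Y) := by
      rw [h, h₁]; monoidal
    _ = _ := by
      rw [whisker_exchange, MonoidalCategory.tensorHom_def']; monoidal

theorem whiskerLeft {X₁ Y₁ : D} (E₁ : ExactPairing X₁ Y₁) {f : X ⟶ X'} {g : Y' ⟶ Y}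
    (h : IsMate E E' f g) :
    IsMate (@ExactPairing.tensor D _ _ X₁ X Y₁ Y E₁ E)
      (@ExactPairing.tensor D _ _ X₁ X' Y₁ Y' E₁ E') (X₁ ◁ f) (g ▷ Y₁) := by
  have := (IsMate.id E₁).tensor h
  rwa [id_tensorHom, tensorHom_id] at this

theorem whiskerRight {X₁ Y₁ : D} {f : X ⟶ X'} {g : Y' ⟶ Y} (h : IsMate E E' f g)
    (E₁ : ExactPairing X₁ Y₁) :
    IsMate (@ExactPairing.tensor D _ _ X X₁ Y Y₁ E E₁)
      (@ExactPairing.tensor D _ _ X' X₁ Y' Y₁ E' E₁) (f ▷ X₁) (Y₁ ◁ g) := by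
  have := h.tensor (IsMate.id E₁)
  rwa [id_tensorHom, tensorHom_id] at this

theorem associator (E : ExactPairing X Y) (E' : ExactPairing X' Y') (E'' : ExactPairing X'' Y'') :
    IsMate (@ExactPairing.tensor D _ _ (X ⊗ X') X'' (Y' ⊗ Y) Y''
        (@ExactPairing.tensor D _ _ X X' Y Y' E E') E'')
      (@ExactPairing.tensor D _ _ X (X' ⊗ X'') Y (Y'' ⊗ Y') E
        (@ExactPairing.tensor D _ _ X' X'' Y' Y'' E' E'')) (α_ X X' X'').hom (α_ Y'' Y' Y).hom := by
  unfold IsMate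
  rw [tensor_coevaluation, tensor_coevaluation, tensor_coevaluation, tensor_coevaluation]
  monoidal

theorem leftUnitor (E : ExactPairing X Y) :
    IsMate (@ExactPairing.tensor D _ _ (𝟙_ D) X (𝟙_ D) Y exactPairingUnit E) E
      (λ_ X).hom (ρ_ Y).inv := by
  unfold IsMate
  rw [tensor_coevaluation, unit_coevaluation]
  monoidal

theorem rightUnitor (E : ExactPairing X Y) :
    IsMate (@ExactPairing.tensor D _ _ X (𝟙_ D) Y (𝟙_ D) E exactPairingUnit) E
      (ρ_ X).hom (λ_ Y).inv := by
  unfold IsMate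
  rw [tensor_coevaluation, unit_coevaluation]
  monoidal

/-- For a two-sided dual, the evaluation of one pairing is mate to the coevaluation of the other.
Cups and caps are therefore compatible with two-sided duals, as the extension theorem requires. -/
theorem evaluation_coevaluation (E : ExactPairing X Y) (E' : ExactPairing Y X) :
    IsMate (@ExactPairing.tensor D _ _ X Y Y X E E') exactPairingUnit
      E'.evaluation' E.coevaluation' := by
  unfold IsMate
  rw [tensor_coevaluation, unit_coevaluation]
  calc
    _ = E.coevaluation' ⊗≫ (X ◁ E'.coevaluation' ⊗≫ E'.evaluation' ▷ X) ▷ Y ⊗≫ 𝟙 _ := by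
      monoidal
    _ = _ := by
      have := @ExactPairing.coevaluation_evaluation'' D _ _ Y X E'
      change X ◁ E'.coevaluation' ⊗≫ E'.evaluation' ▷ X = _ at this
      rw [this]; monoidal

theorem coevaluation_evaluation (E : ExactPairing X Y) (E' : ExactPairing Y X) :
    IsMate exactPairingUnit (@ExactPairing.tensor D _ _ X Y Y X E E')
      E.coevaluation' E'.evaluation' := by
  unfold IsMate
  rw [tensor_coevaluation, unit_coevaluation]
  symm
  calc
    _ = E.coevaluation' ⊗≫ X ◁ (E'.coevaluation' ▷ Y ⊗≫ Y ◁ E'.evaluation') ⊗≫ 𝟙 _ := by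
      monoidal
    _ = _ := by
      have := @ExactPairing.evaluation_coevaluation'' D _ _ Y X E'
      change E'.coevaluation' ▷ Y ⊗≫ Y ◁ E'.evaluation' = _ at this
      rw [this]; monoidal

theorem leftDualIso {X₁ X₂ : D} (E : ExactPairing X₁ Y) (E' : ExactPairing X₂ Y) :
    IsMate E E' (leftDualIso E E').hom (𝟙 Y) :=
  IsMate.leftAdjointMate E E' (𝟙 Y)

end IsMate

/-- A two-sided dual. -/
structure TwoSidedDual (X : D) where
  /-- the dual object -/
  dual : D
  /-- the dual object is a right dual -/
  right : ExactPairing X dual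
  /-- the dual object is a left dual -/
  left : ExactPairing dual X

/-- A morphism is compatible with two-sided duals if its two transposes agree. -/
def TwoSidedDual.IsHom {X Y : D} (s : TwoSidedDual X) (t : TwoSidedDual Y) (f : X ⟶ Y) : Prop :=
  ∃ g : t.dual ⟶ s.dual, IsMate s.right t.right f g ∧ IsMate t.left s.left g f

variable (D) in
/-- Two-sided duals as a monoidal structure. -/
@[reducible]
def twoSidedDualStr : MonoidalStr D where
  Str := TwoSidedDual
  IsHom := TwoSidedDual.IsHom
  id s := ⟨𝟙 _, IsMate.id _, IsMate.id _⟩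
  comp := by
    rintro X Y Z s t r f f' ⟨g, h, k⟩ ⟨g', h', k'⟩
    exact ⟨g' ≫ g, h.comp h', k'.comp k⟩
  inv := by
    rintro X Y s t e ⟨g, h, k⟩
    exact ⟨(IsMate.rightIso e h).inv, IsMate.inv (g := IsMate.rightIso e h) h,
      IsMate.inv (f := IsMate.rightIso e h) k⟩
  tensor {X Y} s t := ⟨t.dual ⊗ s.dual,
    @ExactPairing.tensor D _ _ X Y s.dual t.dual s.right t.right,
    @ExactPairing.tensor D _ _ t.dual s.dual Y X t.left s.left⟩
  unit := ⟨𝟙_ D, exactPairingUnit, exactPairingUnit⟩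
  whiskerLeft := by
    rintro X Y Z r s t f ⟨g, h, k⟩
    exact ⟨g ▷ r.dual, h.whiskerLeft r.right, k.whiskerRight r.left⟩
  whiskerRight := by
    rintro X Y Z s t f ⟨g, h, k⟩ r
    exact ⟨r.dual ◁ g, h.whiskerRight r.right, k.whiskerLeft r.left⟩
  associator s t r := ⟨(α_ r.dual t.dual s.dual).hom, IsMate.associator _ _ _,
    IsMate.associator _ _ _⟩
  leftUnitor s := ⟨(ρ_ s.dual).inv, IsMate.leftUnitor _,
    IsMate.inv (f := ρ_ s.dual) (g := (λ_ _).symm) (IsMate.rightUnitor s.left)⟩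
  rightUnitor s := ⟨(λ_ s.dual).inv, IsMate.rightUnitor _,
    IsMate.inv (f := λ_ s.dual) (g := (ρ_ _).symm) (IsMate.leftUnitor s.left)⟩
  transport {X Y} s e :=
    ⟨⟨s.dual, @exactPairingCongrLeft D _ _ Y X s.dual s.right e.symm,
      @exactPairingCongrRight D _ _ s.dual Y X s.left e.symm⟩, 𝟙 _,
      show s.right.coevaluation' ≫ e.hom ▷ s.dual =
        (s.right.coevaluation' ≫ e.hom ▷ s.dual) ≫ Y ◁ 𝟙 s.dual by simp,
      show (s.left.coevaluation' ≫ s.dual ◁ e.hom) ≫ 𝟙 s.dual ▷ Y =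
        s.left.coevaluation' ≫ s.dual ◁ e.hom by simp⟩

namespace TwoSidedDual

/-- The two-sided dual of a dual. -/
@[reducible]
def symm {X : D} (s : TwoSidedDual X) : TwoSidedDual s.dual := ⟨X, s.left, s.right⟩

theorem isHom_coevaluation {X : D} (s : TwoSidedDual X) :
    (twoSidedDualStr D).IsHom (twoSidedDualStr D).unit ((twoSidedDualStr D).tensor s.symm s)
      s.left.coevaluation' :=
  ⟨s.right.evaluation', IsMate.coevaluation_evaluation s.left s.right,
    IsMate.evaluation_coevaluation s.left s.right⟩

theorem isHom_evaluation {X : D} (s : TwoSidedDual X) :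
    (twoSidedDualStr D).IsHom ((twoSidedDualStr D).tensor s s.symm) (twoSidedDualStr D).unit
      s.left.evaluation' :=
  ⟨s.right.coevaluation', IsMate.evaluation_coevaluation s.right s.left,
    IsMate.coevaluation_evaluation s.right s.left⟩

/-- The rigid structure given by a choice of two-sided duals. -/
@[reducible]
def leftRigid (h : ∀ Z : D, TwoSidedDual Z) : LeftRigidCategory D where
  leftDual Z := @HasLeftDual.mk D _ _ Z (h Z).dual (h Z).left

variable (h : ∀ Z : D, TwoSidedDual Z)
  (hom : ∀ {Z W : D} (f : Z ⟶ W), (twoSidedDualStr D).IsHom (h Z) (h W) f)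
  (hom_tensor : ∀ Z W, (twoSidedDualStr D).IsHom (h (Z ⊗ W))
    ((twoSidedDualStr D).tensor (h Z) (h W)) (𝟙 (Z ⊗ W)))
  (hom_unit : (twoSidedDualStr D).IsHom (h (𝟙_ D)) (twoSidedDualStr D).unit (𝟙 (𝟙_ D)))

theorem isMate_dualMap {A B : D} (f : A ⟶ B) :
    letI := leftRigid h
    IsMate (h B).left (h A).left (dualMap f) f :=
  IsMate.leftAdjointMate _ _ f

/-- The pivotal structure given by a coherent choice of two-sided duals. -/
@[reducible]
def pivotal : PivotalCategory D :=
  letI := leftRigid h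
  -- Z, by its right pairing, and Z** are both left duals of Z*, so uniqueness of duals compares
  -- them. Each axiom below holds because its two sides are mates of the same morphism.
  { piv := fun Z => leftDualIso (h Z).right (h (h Z).dual).left
    piv_naturality := by
      intro A B f
      obtain ⟨g, hg, hg'⟩ := hom f
      -- The two transposes of f agree, so the right mate `g` of f is the dual map formed with left
      -- duals.
      obtain rfl := hg'.unique_left (isMate_dualMap h f)
      exact (hg.comp_id (IsMate.leftDualIso (h B).right (h (h B).dual).left)).unique_left
        ((IsMate.leftDualIso (h A).right (h (h A).dual).left).id_comp
          (isMate_dualMap h (dualMap f)))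
    piv_unit := by
      obtain ⟨g, hg, hg'⟩ := (twoSidedDualStr D).inv (Iso.refl _) hom_unit
      have hd := IsMate.leftDualIso (h (𝟙_ D)).left exactPairingUnit
      obtain rfl := hg'.unique_left hd
      have h1 := hg.comp_id (IsMate.leftDualIso (h (𝟙_ D)).right (h (h (𝟙_ D)).dual).left)
      rw [Iso.refl_inv, Category.id_comp] at h1
      exact h1.unique_left ((IsMate.inv (g := Iso.refl _) hd).id_comp
        (isMate_dualMap h (leftDualIso (h (𝟙_ D)).left exactPairingUnit).hom))
    piv_tensor := by
      intro A B
      obtain ⟨g, hg, hg'⟩ := (twoSidedDualStr D).inv (Iso.refl _) (hom_tensor A B)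
      have hd := IsMate.leftDualIso (h (A ⊗ B)).left
        (@ExactPairing.tensor D _ _ (h B).dual (h A).dual B A (h B).left (h A).left)
      obtain rfl := hg'.unique_left hd
      have h1 := hg.comp_id (IsMate.leftDualIso (h (A ⊗ B)).right (h (h (A ⊗ B)).dual).left)
      rw [Iso.refl_inv, Category.id_comp] at h1
      have hd' := IsMate.leftDualIso (h ((h B).dual ⊗ (h A).dual)).left
        (@ExactPairing.tensor D _ _ (h (h A).dual).dual (h (h B).dual).dual (h A).dual (h B).dual
          (h (h A).dual).left (h (h B).dual).left)
      have ht := (IsMate.leftDualIso (h A).right (h (h A).dual).left).tensor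
        (IsMate.leftDualIso (h B).right (h (h B).dual).left)
      rw [id_tensorHom_id] at ht
      exact h1.unique_left (ht.id_comp ((IsMate.inv (g := Iso.refl _) hd').id_comp
        (isMate_dualMap h (leftDualIso (h (A ⊗ B)).left (@ExactPairing.tensor D _ _ (h B).dual
          (h A).dual B A (h B).left (h A).left)).hom))) }

end TwoSidedDual

end Mates

/-! ### Compatibility of the explicit two-sided duals with the embedding. -/

section

variable {C : Type u} [Category.{v} C] [MonoidalCategory C] [BraidedCategory C]
  [BraidedTracedCategory C]

theorem loop_conj {V V' P Q : C} (e : V' ≅ V) (k : V ⊗ P ⟶ V ⊗ Q) :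
    loop V k = loop V' (e.hom ▷ P ≫ k ≫ e.inv ▷ Q) := by
  rw [loop_slide, Category.assoc, ← comp_whiskerRight, Iso.inv_hom_id, id_whiskerRight,
    Category.comp_id]

/-- Sliding a crossing over the other two exposes a self-crossing of B, which is yanked; the two
crossings of A with B remain. -/
theorem loop_cr_dbl (A B : C) :
    loop B (cr B A B ≫ A ◁ (β_ B B).hom ≫ cr A B B) = dbl A B := by
  have h : cr B A B ≫ A ◁ (β_ B B).hom ≫ cr A B B =
      B ◁ (β_ A B).hom ≫ cr B B A ≫ B ◁ (β_ B A).hom := by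
    have h' := whiskerLeft_over B (β_ A B).hom
    exact h'.symm
  rw [h, comp_loop, loop_comp, cr, loop_tail, loop_braiding, id_whiskerRight, Category.id_comp,
    dbl]

theorem loop_cr_dbl_comp {A B : C} (x : A ⟶ A) (y : B ⟶ B) :
    loop B (cr B A B ≫ A ◁ (β_ B B).hom ≫ x ▷ (B ⊗ B) ≫ cr A B B ≫ y ▷ (A ⊗ B)) =
      dbl A B ≫ (x ⊗ₘ y) := by
  rw [← loop_cr_dbl, ← loop_comp]
  have h := loop_slide (cr B A B ≫ A ◁ (β_ B B).hom ≫ x ▷ (B ⊗ B) ≫ cr A B B) y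
  simp only [Category.assoc] at h
  rw [← h]
  congr 1
  have hn (V W : C) (z : V ⟶ V) : z ▷ (W ⊗ B) ≫ cr V W B = cr V W B ≫ W ◁ (z ▷ B) := by
    have h1 := tail_comp_whiskerRight z (β_ V W).hom (𝟙 W) B
    have h2 := tail_comp_whiskerLeft (𝟙 W) (β_ V W).hom z B
    simp only [id_whiskerRight, whiskerLeft_id, Category.comp_id, Category.id_comp] at h1 h2
    rw [cr, ← h1, ← h2, BraidedCategory.braiding_naturality_left]
  have h2 : A ◁ (y ▷ B) ≫ A ◁ (β_ B B).hom = A ◁ (β_ B B).hom ≫ A ◁ B ◁ y := by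
    simp [← whiskerLeft_comp]
  have h3 : A ◁ B ◁ y ≫ x ▷ (B ⊗ B) ≫ cr A B B = cr A B B ≫ B ◁ (x ⊗ₘ y) := by
    rw [hn, cr, ← tail_naturality_assoc, ← whiskerLeft_comp, ← MonoidalCategory.tensorHom_def']
  rw [reassoc_of% hn, reassoc_of% h2, h3, Category.assoc, Category.assoc]

end

namespace IntObj

variable {C : Type u} [Category.{v} C] [MonoidalCategory C] [BraidedCategory C]
  [BraidedTracedCategory C]

theorem comp_cap {X Y : IntObj C} (f : X ⟶ Y) (y : Y.pos ⟶ Y.neg) :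
    f ≫ cap y = cap (loop Y.neg (f.hom ≫ y ▷ X.neg)) := by
  apply hom_ext
  change intComp f.hom (𝟙_ C ◁ y) = 𝟙_ C ◁ loop Y.neg (f.hom ≫ y ▷ X.neg)
  rw [intComp, whiskerLeft_loop_under]
  congr 1
  simp [tail]

theorem pair_comp_cap {X Y : IntObj C} (a : X.pos ⟶ Y.pos) (b : Y.neg ⟶ X.neg)
    (y : Y.pos ⟶ Y.neg) : pair a b ≫ cap y = cap (a ≫ y ≫ b) := by
  apply hom_ext
  rw [pair_comp_hom]
  change 𝟙_ C ◁ a ≫ 𝟙_ C ◁ y ≫ 𝟙_ C ◁ b = 𝟙_ C ◁ (a ≫ y ≫ b)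
  simp

-- The tensor of the two evaluations produces the double braiding followed by both curls, and
-- `curl_tensor` recombines them into the curl of A ⊗ B. This is why the right duals are
-- multiplicative.
set_option linter.unusedSimpArgs false in
theorem tensor_inclStar_evaluation (A B : C) :
    (@ExactPairing.tensor _ _ _ ((incl C).obj A) ((incl C).obj B) (star A) (star B)
      (inclStar A) (inclStar B)).evaluation' =
    cap (Z := (star B ⊗ star A) ⊗ ((incl C).obj A ⊗ (incl C).obj B))
      ((𝟙_ C ⊗ 𝟙_ C) ◁ curl (A ⊗ B)) := by
  rw [tensor_evaluation]
  refine (Category.assoc _ _ _).symm.trans ((comp_cap (Y := star B ⊗ (incl C).obj B) _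
    (𝟙_ C ◁ curl B)).trans (congrArg cap ?_))
  rw [associator_eq, pairIso_hom, pair_comp_hom, associator_eq, leftUnitor_eq, pairIso_inv,
    pairIso_hom]
  change loop (𝟙_ C ⊗ B) ((_ ◁ (α_ (𝟙_ C) (𝟙_ C) (A ⊗ B)).hom ≫ intTensor (β_ B (𝟙_ C)).hom
    (pair _ _ ≫ _ ≫ pair _ _ : star A ⊗ ((incl C).obj A ⊗ (incl C).obj B) ⟶
      (incl C).obj B).hom ≫ _ ◁ (α_ (𝟙_ C ⊗ 𝟙_ C) A B).hom) ≫ _) = _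
  rw [pair_comp_hom, comp_pair_hom]
  change loop (𝟙_ C ⊗ B) ((_ ◁ (α_ (𝟙_ C) (𝟙_ C) (A ⊗ B)).hom ≫ intTensor (β_ B (𝟙_ C)).hom
    (_ ◁ (α_ (𝟙_ C) A B).inv ≫ ((ρ_ (𝟙_ C)).inv ▷ _ ≫
      intTensor (𝟙_ C ◁ 𝟙_ C ◁ curl A) (β_ (𝟙_ C) B).hom ≫ (λ_ B).hom ▷ _) ≫
      _ ◁ (α_ (𝟙_ C) (𝟙_ C) A).inv) ≫ _ ◁ (α_ (𝟙_ C ⊗ 𝟙_ C) A B).hom) ≫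
      (𝟙_ C ◁ curl B) ▷ ((𝟙_ C ⊗ 𝟙_ C) ⊗ (A ⊗ B))) = (𝟙_ C ⊗ 𝟙_ C) ◁ curl (A ⊗ B)
  trans ((λ_ (𝟙_ C)).hom ▷ (A ⊗ B) ≫ (λ_ (A ⊗ B)).hom) ≫
    loop B (cr B A B ≫ A ◁ (β_ B B).hom ≫ curl A ▷ (B ⊗ B) ≫ cr A B B ≫ curl B ▷ (A ⊗ B)) ≫
      (λ_ (A ⊗ B)).inv ≫ (λ_ (𝟙_ C)).inv ▷ (A ⊗ B)
  · rw [loop_conj (λ_ B).symm, comp_loop_comp]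
    congr 1
    simp only [intTensor, cr, tail, braiding_tensorUnit_right, braiding_tensorUnit_left,
      BraidedCategory.braiding_tensor_right_hom, BraidedCategory.braiding_tensor_left_hom,
      Iso.symm_hom, Iso.symm_inv]
    monoidal
  · rw [loop_cr_dbl_comp, ← curl_tensor]
    simp

set_option linter.unusedSimpArgs false in
theorem tensor_starIncl_evaluation (A B : C) :
    (@ExactPairing.tensor _ _ _ (star B) (star A) ((incl C).obj B) ((incl C).obj A)
      (starIncl B) (starIncl A)).evaluation' =
    cap (Z := ((incl C).obj A ⊗ (incl C).obj B) ⊗ (star B ⊗ star A))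
      (𝟙 ((A ⊗ B) ⊗ (𝟙_ C ⊗ 𝟙_ C))) := by
  rw [tensor_evaluation]
  refine (Category.assoc _ _ _).symm.trans ((comp_cap (Y := (incl C).obj A ⊗ star A) _
    (𝟙 (A ⊗ 𝟙_ C))).trans (congrArg cap ?_))
  rw [associator_eq, pairIso_hom, pair_comp_hom, associator_eq, leftUnitor_eq, pairIso_inv,
    pairIso_hom]
  change loop (A ⊗ 𝟙_ C) ((_ ◁ (α_ A B (𝟙_ C ⊗ 𝟙_ C)).hom ≫ intTensor (β_ (𝟙_ C) A).hom
    (pair _ _ ≫ _ ≫ pair _ _ : (incl C).obj B ⊗ (star B ⊗ star A) ⟶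
      star A).hom ≫ _ ◁ (α_ (A ⊗ B) (𝟙_ C) (𝟙_ C)).hom) ≫ _) = _
  rw [pair_comp_hom, comp_pair_hom]
  change loop (A ⊗ 𝟙_ C) ((_ ◁ (α_ A B (𝟙_ C ⊗ 𝟙_ C)).hom ≫ intTensor (β_ (𝟙_ C) A).hom
    (_ ◁ (α_ B (𝟙_ C) (𝟙_ C)).inv ≫ ((ρ_ A).inv ▷ _ ≫
      intTensor (𝟙_ C ◁ 𝟙 (B ⊗ 𝟙_ C)) (β_ A (𝟙_ C)).hom ≫ (λ_ (𝟙_ C)).hom ▷ _) ≫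
      _ ◁ (α_ A B (𝟙_ C)).inv) ≫ _ ◁ (α_ (A ⊗ B) (𝟙_ C) (𝟙_ C)).hom) ≫
      𝟙 (A ⊗ 𝟙_ C) ▷ ((A ⊗ B) ⊗ (𝟙_ C ⊗ 𝟙_ C))) = 𝟙 ((A ⊗ B) ⊗ (𝟙_ C ⊗ 𝟙_ C))
  trans ((A ⊗ B) ◁ (λ_ (𝟙_ C)).hom ≫ (ρ_ (A ⊗ B)).hom) ≫ loop A (cr A A B) ≫
      (ρ_ (A ⊗ B)).inv ≫ (A ⊗ B) ◁ (λ_ (𝟙_ C)).inv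
  · rw [loop_conj (ρ_ A).symm, comp_loop_comp]
    congr 1
    simp only [intTensor, cr, tail, braiding_tensorUnit_right, braiding_tensorUnit_left,
      BraidedCategory.braiding_tensor_right_hom, BraidedCategory.braiding_tensor_left_hom,
      Iso.symm_hom, Iso.symm_inv]
    monoidal
  · rw [loop_cr]
    simp

/-- Caps absorb pairs, so a mate condition in Int becomes an equation in C without loops. -/
theorem isMate_of_evaluation_eq_cap {X Y X' Y' : IntObj C} {E : ExactPairing X Y}
    {E' : ExactPairing X' Y'} {y : Y.pos ⊗ X.pos ⟶ X.neg ⊗ Y.neg}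
    {y' : Y'.pos ⊗ X'.pos ⟶ X'.neg ⊗ Y'.neg} (hE : E.evaluation' = cap (Z := Y ⊗ X) y)
    (hE' : E'.evaluation' = cap (Z := Y' ⊗ X') y') (a : X.pos ⟶ X'.pos) (b : X'.neg ⟶ X.neg)
    (c : Y'.pos ⟶ Y.pos) (d : Y.neg ⟶ Y'.neg)
    (h : c ▷ X.pos ≫ y ≫ X.neg ◁ d = Y'.pos ◁ a ≫ y' ≫ b ▷ Y'.neg) :
    IsMate E E' (pair a b) (pair c d) := by
  refine IsMate.of_comp_evaluation ?_
  rw [hE, hE', pair_whiskerRight, whiskerLeft_pair]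
  exact (pair_comp_cap _ _ _).trans ((congrArg cap h).trans (pair_comp_cap _ _ _).symm)

/-- The two-sided dual of an object in the image of the embedding. -/
@[reducible]
def inclDual (A : C) : TwoSidedDual ((incl C).obj A) := ⟨star A, inclStar A, starIncl A⟩

theorem isHom_incl_map {A B : C} (f : A ⟶ B) :
    (twoSidedDualStr (IntObj C)).IsHom (inclDual A) (inclDual B) ((incl C).map f) := by
  refine ⟨pair (X := star B) (Y := star A) (𝟙 (𝟙_ C)) f, ?_, ?_⟩
  · refine isMate_of_evaluation_eq_cap (E := inclStar A) (E' := inclStar B)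
      (y := 𝟙_ C ◁ curl A) (y' := 𝟙_ C ◁ curl B) rfl rfl _ _ _ _ ?_
    change 𝟙 (𝟙_ C) ▷ A ≫ 𝟙_ C ◁ curl A ≫ 𝟙_ C ◁ f = 𝟙_ C ◁ f ≫ 𝟙_ C ◁ curl B ≫ 𝟙 (𝟙_ C) ▷ B
    simp only [id_whiskerRight, Category.id_comp, Category.comp_id, ← whiskerLeft_comp,
      curl_naturality]
  · refine isMate_of_evaluation_eq_cap (E := starIncl B) (E' := starIncl A)
      (y := 𝟙 (B ⊗ 𝟙_ C)) (y' := 𝟙 (A ⊗ 𝟙_ C)) rfl rfl _ _ _ _ ?_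
    change f ▷ 𝟙_ C ≫ 𝟙 (B ⊗ 𝟙_ C) ≫ B ◁ 𝟙 (𝟙_ C) = A ◁ 𝟙 (𝟙_ C) ≫ 𝟙 (A ⊗ 𝟙_ C) ≫ f ▷ 𝟙_ C
    simp

theorem isHom_incl_μ (A B : C) :
    (twoSidedDualStr (IntObj C)).IsHom
      ((twoSidedDualStr (IntObj C)).tensor (inclDual A) (inclDual B)) (inclDual (A ⊗ B))
      (Functor.LaxMonoidal.μ (incl C) A B) := by
  rw [incl_μ, inclμ_hom]
  refine ⟨pair (X := star (A ⊗ B)) (Y := star B ⊗ star A) (λ_ (𝟙_ C)).inv (𝟙 (A ⊗ B)), ?_, ?_⟩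
  · refine isMate_of_evaluation_eq_cap (tensor_inclStar_evaluation A B)
      (E' := inclStar (A ⊗ B)) (y' := 𝟙_ C ◁ curl (A ⊗ B)) rfl _ _ _ _ ?_
    change (λ_ (𝟙_ C)).inv ▷ (A ⊗ B) ≫ (𝟙_ C ⊗ 𝟙_ C) ◁ curl (A ⊗ B) ≫
      (𝟙_ C ⊗ 𝟙_ C) ◁ 𝟙 (A ⊗ B) =
        𝟙_ C ◁ 𝟙 (A ⊗ B) ≫ 𝟙_ C ◁ curl (A ⊗ B) ≫ (λ_ (𝟙_ C)).inv ▷ (A ⊗ B)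
    simp
  · refine isMate_of_evaluation_eq_cap (E := starIncl (A ⊗ B)) (y := 𝟙 ((A ⊗ B) ⊗ 𝟙_ C)) rfl
      (tensor_starIncl_evaluation A B) _ _ _ _ ?_
    change 𝟙 (A ⊗ B) ▷ 𝟙_ C ≫ 𝟙 ((A ⊗ B) ⊗ 𝟙_ C) ≫ (A ⊗ B) ◁ (λ_ (𝟙_ C)).inv =
      (A ⊗ B) ◁ (λ_ (𝟙_ C)).inv ≫ 𝟙 ((A ⊗ B) ⊗ 𝟙_ C ⊗ 𝟙_ C) ≫ 𝟙 (A ⊗ B) ▷ (𝟙_ C ⊗ 𝟙_ C)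
    simp

theorem curl_unit : curl (𝟙_ C) = 𝟙 (𝟙_ C) := by
  rw [curl, LeftTracedCategory.trL_vanishing_unit, braiding_tensorUnit_left]
  monoidal

theorem isHom_incl_ε :
    (twoSidedDualStr (IntObj C)).IsHom (twoSidedDualStr (IntObj C)).unit (inclDual (𝟙_ C))
      (Functor.LaxMonoidal.ε (incl C)) := by
  have h : 𝟙 (𝟙_ (IntObj C)) = pair (X := 𝟙_ (IntObj C)) (Y := 𝟙_ (IntObj C)) (𝟙 (𝟙_ C))
    (𝟙 (𝟙_ C)) := (pair_id _).symm
  have hu : (exactPairingUnit : ExactPairing (𝟙_ (IntObj C)) (𝟙_ (IntObj C))).evaluation' =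
      cap (Z := 𝟙_ (IntObj C) ⊗ 𝟙_ (IntObj C)) (𝟙 (𝟙_ C ⊗ 𝟙_ C)) := by
    change (ρ_ _).hom = _
    rw [rightUnitor_eq, pairIso_hom]
    apply hom_ext
    change intPair (ρ_ (𝟙_ C)).hom (λ_ (𝟙_ C)).inv = 𝟙_ C ◁ 𝟙 (𝟙_ C ⊗ 𝟙_ C)
    simp only [intPair, BraidedCategory.braiding_tensor_left_hom, braiding_tensorUnit_left]
    monoidal
  rw [incl_ε, h]
  refine ⟨pair (X := star (𝟙_ C)) (Y := 𝟙_ (IntObj C)) (𝟙 (𝟙_ C)) (𝟙 (𝟙_ C)), ?_, ?_⟩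
  · refine isMate_of_evaluation_eq_cap hu (E' := inclStar (𝟙_ C))
      (y' := 𝟙_ C ◁ curl (𝟙_ C)) rfl _ _ _ _ ?_
    rw [curl_unit]
    change 𝟙 (𝟙_ C) ▷ (𝟙_ C) ≫ 𝟙 _ ≫ 𝟙_ C ◁ 𝟙 (𝟙_ C) =
      𝟙_ C ◁ 𝟙 (𝟙_ C) ≫ 𝟙_ C ◁ 𝟙 (𝟙_ C) ≫ 𝟙 (𝟙_ C) ▷ (𝟙_ C)
    simp
  · refine isMate_of_evaluation_eq_cap (E := starIncl (𝟙_ C)) (y := 𝟙 (𝟙_ C ⊗ 𝟙_ C)) rfl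
      hu _ _ _ _ ?_
    change 𝟙 (𝟙_ C) ▷ (𝟙_ C) ≫ 𝟙 _ ≫ 𝟙_ C ◁ 𝟙 (𝟙_ C) =
      𝟙_ C ◁ 𝟙 (𝟙_ C) ≫ 𝟙 _ ≫ 𝟙 (𝟙_ C) ▷ (𝟙_ C)
    simp

variable (C) in
/-- The `Int` construction is generated by the image of the embedding and duals of it. -/
@[reducible]
def dualGenerated : DualGenerated (incl C) where
  full := incl_full
  star := star
  pairing := starIncl
  exists_iso Z := ⟨Z.pos, Z.neg, ⟨pairIso (X := (incl C).obj Z.pos ⊗ star Z.neg) (Y := Z)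
    (ρ_ Z.pos) (ρ_ Z.neg).symm⟩⟩
  exists_swap B V := ⟨pairIso (X := (incl C).obj B ⊗ star V) (Y := star V ⊗ (incl C).obj B)
    (β_ B (𝟙_ C)) (β_ (𝟙_ C) V)⟩
  exists_tensor U V := ⟨V ⊗ U, ⟨pairIso (X := star U ⊗ star V) (Y := star (V ⊗ U))
    (λ_ (𝟙_ C)) (Iso.refl _)⟩⟩
  exists_unit := ⟨𝟙_ C, ⟨Iso.refl _⟩⟩

variable (C) in
/-- The two-sided duals of the generators. -/
@[reducible]
def dualLift : (dualGenerated C).Lift (twoSidedDualStr (IntObj C)) where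
  φ := inclDual
  σ S := (inclDual S).symm
  map := isHom_incl_map
  μ := isHom_incl_μ
  ε := isHom_incl_ε
  coevaluation S := (inclDual S).isHom_coevaluation
  evaluation S := (inclDual S).isHom_evaluation

end IntObj

/-! ### Canonical traces computed from two-sided duals. -/

section PivotalTraces

variable {D : Type u} [Category.{v} D] [MonoidalCategory D] [PivotalCategory D]

theorem pivotalTrR_eq_of_comp_piv {X : D} (c : 𝟙_ D ⟶ X ⊗ dualObj X)
    (hc : c ≫ (PivotalCategory.piv X).hom ▷ dualObj X = dualUnit (dualObj X))
    {A B : D} (f : A ⊗ X ⟶ B ⊗ X) :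
    pivotalTrR D X f = (ρ_ A).inv ≫ A ◁ c ≫ (α_ A X (dualObj X)).inv ≫ f ▷ dualObj X ≫
      (α_ B X (dualObj X)).hom ≫ B ◁ dualCounit X ≫ (ρ_ B).hom := by
  have h : c = dualUnit (dualObj X) ≫ (PivotalCategory.piv X).inv ▷ dualObj X := by
    rw [← hc, Category.assoc, ← comp_whiskerRight, Iso.hom_inv_id, id_whiskerRight,
      Category.comp_id]
  rw [h, pivotalTrR]
  simp only [comp_whiskerRight, MonoidalCategory.whiskerLeft_comp, Category.assoc,
    associator_inv_naturality_middle_assoc]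

theorem pivotalTrL_eq_of_piv_comp {X : D} (e : dualObj X ⊗ X ⟶ 𝟙_ D)
    (he : dualObj X ◁ (PivotalCategory.piv X).hom ≫ dualCounit (dualObj X) = e)
    {A B : D} (f : X ⊗ A ⟶ X ⊗ B) :
    pivotalTrL D X f = (λ_ A).inv ≫ dualUnit X ▷ A ≫ (α_ (dualObj X) X A).hom ≫
      dualObj X ◁ f ≫ (α_ (dualObj X) X B).inv ≫ e ▷ B ≫ (λ_ B).hom := by
  rw [← he, pivotalTrL]
  simp only [comp_whiskerRight, MonoidalCategory.whiskerLeft_comp, Category.assoc,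
    associator_inv_naturality_middle_assoc]

end PivotalTraces

namespace TwoSidedDual

variable {D : Type u} [Category.{v} D] [MonoidalCategory D]

/-- The right trace defined by a two-sided dual. -/
def trR {X : D} (s : TwoSidedDual X) {A B : D} (f : A ⊗ X ⟶ B ⊗ X) : A ⟶ B :=
  (ρ_ A).inv ≫ A ◁ s.right.coevaluation' ≫ (α_ A X s.dual).inv ≫ f ▷ s.dual ≫
    (α_ B X s.dual).hom ≫ B ◁ s.left.evaluation' ≫ (ρ_ B).hom

/-- The left trace defined by a two-sided dual. -/
def trL {X : D} (s : TwoSidedDual X) {A B : D} (f : X ⊗ A ⟶ X ⊗ B) : A ⟶ B :=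
  (λ_ A).inv ≫ s.left.coevaluation' ▷ A ≫ (α_ s.dual X A).hom ≫ s.dual ◁ f ≫
    (α_ s.dual X B).inv ≫ s.right.evaluation' ▷ B ≫ (λ_ B).hom

/-- A change of dual moves from the coevaluation to the evaluation, past f. This needs both of its
mate conditions, since the trace uses the right pairing at one end and the left pairing at the
other. -/
theorem trR_congr {X : D} {s t : TwoSidedDual X} (h : (twoSidedDualStr D).IsHom s t (𝟙 X))
    {A B : D} (f : A ⊗ X ⟶ B ⊗ X) : s.trR f = t.trR f := by
  obtain ⟨g, h1, h2⟩ := h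
  have h3 := h2.comp_evaluation
  rw [id_whiskerRight, Category.id_comp] at h3
  unfold IsMate at h1
  rw [id_whiskerRight, Category.comp_id] at h1
  rw [trR, trR, h1, h3]
  simp only [MonoidalCategory.whiskerLeft_comp, Category.assoc]
  rw [associator_inv_naturality_right_assoc, whisker_exchange_assoc,
    associator_naturality_right_assoc]

theorem trL_congr {X : D} {s t : TwoSidedDual X} (h : (twoSidedDualStr D).IsHom s t (𝟙 X))
    {A B : D} (f : X ⊗ A ⟶ X ⊗ B) : s.trL f = t.trL f := by
  obtain ⟨g, h1, h2⟩ := h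
  have h3 := h1.comp_evaluation
  rw [whiskerLeft_id, Category.id_comp] at h3
  unfold IsMate at h2
  rw [whiskerLeft_id, Category.comp_id] at h2
  rw [trL, trL, ← h2, ← h3]
  simp only [comp_whiskerRight, Category.assoc]
  rw [associator_naturality_left_assoc, ← whisker_exchange_assoc,
    associator_inv_naturality_left_assoc]

variable (h : ∀ Z : D, TwoSidedDual Z)
  (hom : ∀ {Z W : D} (f : Z ⟶ W), (twoSidedDualStr D).IsHom (h Z) (h W) f)
  (hom_tensor : ∀ Z W, (twoSidedDualStr D).IsHom (h (Z ⊗ W))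
    ((twoSidedDualStr D).tensor (h Z) (h W)) (𝟙 (Z ⊗ W)))
  (hom_unit : (twoSidedDualStr D).IsHom (h (𝟙_ D)) (twoSidedDualStr D).unit (𝟙 (𝟙_ D)))

theorem pivotalTrR_eq (X : D) {A B : D} (f : A ⊗ X ⟶ B ⊗ X) :
    letI := pivotal h hom hom_tensor hom_unit
    pivotalTrR D X f = (h X).trR f := by
  let := pivotal h hom hom_tensor hom_unit
  exact pivotalTrR_eq_of_comp_piv (h X).right.coevaluation'
    ((IsMate.leftDualIso (h X).right (h (h X).dual).left).trans
      ((congrArg _ (whiskerLeft_id _ _)).trans (Category.comp_id _))) f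

theorem pivotalTrL_eq (X : D) {A B : D} (f : X ⊗ A ⟶ X ⊗ B) :
    letI := pivotal h hom hom_tensor hom_unit
    pivotalTrL D X f = (h X).trL f := by
  let := pivotal h hom hom_tensor hom_unit
  exact pivotalTrL_eq_of_piv_comp (h X).right.evaluation'
    ((IsMate.leftDualIso (h X).right (h (h X).dual).left).comp_evaluation.symm.trans
      ((congrArg (· ≫ _) (id_whiskerRight _ _)).trans (Category.id_comp _))) f

end TwoSidedDual

namespace IntObj

variable {C : Type u} [Category.{v} C] [MonoidalCategory C] [BraidedCategory C]
  [BraidedTracedCategory C]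

theorem μ_incl_map_δ {A B A' B' : C} (f : A ⊗ A' ⟶ B ⊗ B') :
    Functor.LaxMonoidal.μ (incl C) A A' ≫ (incl C).map f ≫ Functor.OplaxMonoidal.δ (incl C) B B' =
      pair (X := (incl C).obj A ⊗ (incl C).obj A') (Y := (incl C).obj B ⊗ (incl C).obj B') f
        (𝟙 (𝟙_ C ⊗ 𝟙_ C)) := by
  rw [incl_μ, incl_δ, incl_map, inclμ, inclμ, pairIso_hom, pairIso_inv, pair_comp_pair,
    pair_comp_pair]
  congr 1
  · change 𝟙 _ ≫ f ≫ 𝟙 _ = f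
    simp
  · change ((λ_ (𝟙_ C)).hom ≫ 𝟙 _) ≫ (λ_ (𝟙_ C)).inv = _
    simp

theorem pair_comp_comp_pair_hom {X₀ X₁ X₂ X₃ X₄ X₅ X₆ X₇ : IntObj C} (a : X₀.pos ⟶ X₁.pos)
    (b : X₁.neg ⟶ X₀.neg) (K : X₁ ⟶ X₂) (c : X₂.pos ⟶ X₃.pos) (d : X₃.neg ⟶ X₂.neg)
    (c' : X₃.pos ⟶ X₄.pos) (d' : X₄.neg ⟶ X₃.neg) (c'' : X₄.pos ⟶ X₅.pos)
    (d'' : X₅.neg ⟶ X₄.neg) (L : X₅ ⟶ X₆) (e : X₆.pos ⟶ X₇.pos) (g : X₇.neg ⟶ X₆.neg) :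
    (pair a b ≫ K ≫ pair c d ≫ pair c' d' ≫ pair c'' d'' ≫ L ≫ pair e g).hom =
      intComp ((d'' ≫ d' ≫ d) ▷ X₀.pos ≫ (X₂.neg ◁ a ≫ K.hom ≫ X₂.pos ◁ b) ≫
        (c ≫ c' ≫ c'') ▷ X₀.neg) (g ▷ X₅.pos ≫ L.hom ≫ e ▷ X₅.neg) := by
  have h : pair a b ≫ K ≫ pair c d ≫ pair c' d' ≫ pair c'' d'' ≫ L ≫ pair e g =
      ((pair a b ≫ K) ≫ pair c d ≫ pair c' d' ≫ pair c'' d'') ≫ (L ≫ pair e g) := by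
    simp only [Category.assoc]
  rw [h, comp_hom, pair_comp_pair, pair_comp_pair, comp_pair_hom, comp_pair_hom, pair_comp_hom,
    Category.assoc]

-- The `curlR` in the coevaluation of `inclStar` is the one appearing in `trR_eq_loop`.
set_option linter.unusedSimpArgs false in
theorem inclDual_trR (X : C) {A B : C} (f : A ⊗ X ⟶ B ⊗ X) :
    (inclDual X).trR (pair (X := (incl C).obj A ⊗ (incl C).obj X)
      (Y := (incl C).obj B ⊗ (incl C).obj X) f (𝟙 (𝟙_ C ⊗ 𝟙_ C))) =
        (incl C).map (RightTracedCategory.trR X f) := by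
  apply hom_ext
  rw [incl_map_hom, TwoSidedDual.trR, pair_whiskerRight, trR_eq_loop, rightUnitor_eq,
    rightUnitor_eq, associator_eq, associator_eq, pairIso_hom, pairIso_hom, pairIso_inv,
    pairIso_inv]
  refine (pair_comp_comp_pair_hom _ _ _ _ _ _ _ _ _ _ _ _).trans ?_
  change intComp (((α_ X (𝟙_ C) (𝟙_ C)).hom ≫ X ◁ 𝟙 (𝟙_ C ⊗ 𝟙_ C) ≫ (α_ X (𝟙_ C) (𝟙_ C)).inv) ▷ A ≫
    (((X ⊗ 𝟙_ C) ⊗ 𝟙_ C) ◁ (ρ_ A).inv ≫ intTensor (β_ (𝟙_ C) A).hom ((curlR X ▷ 𝟙_ C) ▷ 𝟙_ C) ≫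
      _ ◁ (λ_ (𝟙_ C)).hom) ≫
      ((α_ A X (𝟙_ C)).inv ≫ f ▷ 𝟙_ C ≫ (α_ B X (𝟙_ C)).hom) ▷ 𝟙_ C)
    ((λ_ (𝟙_ C)).inv ▷ _ ≫ intTensor (β_ (𝟙_ C) B).hom (𝟙_ C ◁ 𝟙 (X ⊗ 𝟙_ C)) ≫
      (ρ_ B).hom ▷ ((X ⊗ 𝟙_ C) ⊗ 𝟙_ C)) = _
  have h := intComp_conj (ρ_ (X ⊗ 𝟙_ C) ≪≫ ρ_ X) (𝟙 A) (B ◁ᵢ (ρ_ X).symm) (𝟙 _) (𝟙 _) (𝟙 _)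
    (((β_ X A).hom ≫ A ◁ curlR X ≫ f) ≫ (ρ_ (B ⊗ X)).inv) ((λ_ (B ⊗ X)).hom ≫ 𝟙 (B ⊗ X))
  rw [intComp_unit_left] at h
  refine Eq.trans ?_ (h.trans ?_)
  · congr 1 <;>
    · simp only [intTensor, cr, tail, braiding_tensorUnit_right, braiding_tensorUnit_left,
      BraidedCategory.braiding_tensor_right_hom, BraidedCategory.braiding_tensor_left_hom,
      whiskerLeftIso_hom, whiskerLeftIso_inv, whiskerRightIso_hom, whiskerRightIso_inv,
      Iso.trans_hom, Iso.trans_inv, Iso.symm_hom, Iso.symm_inv]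
      monoidal
  · simp

-- The `curl` in the evaluation of `inclStar` undoes the correction contained in `loop`, as in
-- `trL_eq_loop`.
set_option linter.unusedSimpArgs false in
theorem inclDual_trL (X : C) {A B : C} (f : X ⊗ A ⟶ X ⊗ B) :
    (inclDual X).trL (pair (X := (incl C).obj X ⊗ (incl C).obj A)
      (Y := (incl C).obj X ⊗ (incl C).obj B) f (𝟙 (𝟙_ C ⊗ 𝟙_ C))) =
        (incl C).map (LeftTracedCategory.trL X f) := by
  apply hom_ext
  rw [incl_map_hom, TwoSidedDual.trL, whiskerLeft_pair, trL_eq_loop, leftUnitor_eq,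
    leftUnitor_eq, associator_eq, associator_eq, pairIso_hom, pairIso_hom, pairIso_inv,
    pairIso_inv]
  refine (pair_comp_comp_pair_hom _ _ _ _ _ _ _ _ _ _ _ _).trans ?_
  change intComp (((α_ (𝟙_ C) (𝟙_ C) X).inv ≫ 𝟙 (𝟙_ C ⊗ 𝟙_ C) ▷ X ≫ (α_ (𝟙_ C) (𝟙_ C) X).hom) ▷ A ≫
    (_ ◁ (λ_ A).inv ≫ intTensor (𝟙 (𝟙_ C ⊗ X) ▷ 𝟙_ C) (β_ (𝟙_ C) A).hom ≫
      _ ◁ (ρ_ (𝟙_ C)).hom) ≫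
      ((α_ (𝟙_ C) X A).hom ≫ 𝟙_ C ◁ f ≫ (α_ (𝟙_ C) X B).inv) ▷ 𝟙_ C)
    ((ρ_ (𝟙_ C)).inv ▷ _ ≫ intTensor (𝟙_ C ◁ 𝟙_ C ◁ curl X) (β_ (𝟙_ C) B).hom ≫
      (λ_ B).hom ▷ _) = _
  have h := intComp_conj (λ_ (𝟙_ C ⊗ X) ≪≫ λ_ X) (𝟙 A) ((λ_ X).symm ▷ᵢ B) (𝟙 _) (𝟙 _) (𝟙 _)
    (f ≫ (ρ_ (X ⊗ B)).inv) ((λ_ (X ⊗ B)).hom ≫ curl X ▷ B ≫ (β_ X B).hom)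
  rw [intComp_unit_left] at h
  refine Eq.trans ?_ (h.trans ?_)
  · congr 1 <;>
    · simp only [intTensor, cr, tail, braiding_tensorUnit_right, braiding_tensorUnit_left,
      BraidedCategory.braiding_tensor_right_hom, BraidedCategory.braiding_tensor_left_hom,
      whiskerLeftIso_hom, whiskerLeftIso_inv, whiskerRightIso_hom, whiskerRightIso_inv,
      Iso.trans_hom, Iso.trans_inv, Iso.symm_hom, Iso.symm_inv]
      monoidal
  · simp

end IntObj

/-! ### Half-braidings and their transfer to duals. -/

section HalfBraidings

variable {D : Type u} [Category.{v} D] [MonoidalCategory D]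

/-- A morphism is compatible with half-braidings. -/
def CategoryTheory.HalfBraiding.IsHom {X Y : D} (s : HalfBraiding X) (t : HalfBraiding Y) (f : X ⟶ Y) : Prop :=
  ∀ U, f ▷ U ≫ (t.β U).hom = (s.β U).hom ≫ U ◁ f

variable (D) in
/-- Half-braidings as a monoidal structure. -/
@[reducible]
def halfBraidingStr : MonoidalStr D where
  Str := HalfBraiding
  IsHom := HalfBraiding.IsHom
  id s U := by simp
  comp {X Y Z s t r f g} h k U := by
    rw [comp_whiskerRight, Category.assoc, k U, ← Category.assoc, h U, Category.assoc,
      MonoidalCategory.whiskerLeft_comp]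
  inv {X Y s t} e h U := by
    rw [← cancel_epi (e.hom ▷ U), ← Category.assoc, ← Category.assoc, h U, ← comp_whiskerRight,
      e.hom_inv_id, id_whiskerRight, Category.id_comp, Category.assoc,
      ← MonoidalCategory.whiskerLeft_comp, e.hom_inv_id, MonoidalCategory.whiskerLeft_id,
      Category.comp_id]
  tensor {X Y} s t := (Center.tensorObj ⟨X, s⟩ ⟨Y, t⟩).2
  unit := Center.tensorUnit.2
  whiskerLeft {X Y Z} r {s t f} h U :=
    Center.whiskerLeft_comm ⟨Z, r⟩ (Y₁ := ⟨X, s⟩) (Y₂ := ⟨Y, t⟩) ⟨f, h⟩ U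
  whiskerRight {X Y Z s t f} h r U :=
    Center.whiskerRight_comm (X₁ := ⟨X, s⟩) (X₂ := ⟨Y, t⟩) ⟨f, h⟩ ⟨Z, r⟩ U
  associator {X Y Z} s t r U := (Center.associator ⟨X, s⟩ ⟨Y, t⟩ ⟨Z, r⟩).hom.comm U
  leftUnitor {X} s U := (Center.leftUnitor ⟨X, s⟩).hom.comm U
  rightUnitor {X} s U := (Center.rightUnitor ⟨X, s⟩).hom.comm U
  transport {X Y} s e :=
    ⟨{  β := fun U => (e.symm ▷ᵢ U) ≪≫ s.β U ≪≫ (U ◁ᵢ e)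
        monoidal := fun U V => by
          simp only [Iso.trans_hom, whiskerRightIso_hom, whiskerLeftIso_hom, Iso.symm_hom,
            HalfBraiding.monoidal]
          have h : (U ◁ e.hom) ▷ V ≫ (α_ U Y V).hom ≫ U ◁ (e.inv ▷ V) = (α_ U X V).hom := by
            rw [associator_naturality_middle_assoc, ← MonoidalCategory.whiskerLeft_comp,
              ← comp_whiskerRight, e.hom_inv_id]
            simp
          simp only [comp_whiskerRight, MonoidalCategory.whiskerLeft_comp, Category.assoc,
            reassoc_of% h]
          simp
        naturality := fun {U V} f => by
          simp only [Iso.trans_hom, whiskerRightIso_hom, whiskerLeftIso_hom, Iso.symm_hom,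
            Category.assoc]
          rw [whisker_exchange_assoc, HalfBraiding.naturality_assoc, whisker_exchange] },
      fun U => by simp [← comp_whiskerRight_assoc]⟩

section Inverse

variable {X : D} (m : ∀ U : D, U ⊗ X ⟶ X ⊗ U)

/-- The inverse at U is `m Y` bent round by the pairing. Naturality with respect to unit and counit,
with multiplicativity, reduces each composite to a zigzag. -/
theorem isIso_of_natural_of_tensor
    (natural : ∀ {U V : D} (f : U ⟶ V), f ▷ X ≫ m V = m U ≫ X ◁ f)
    (tensor : ∀ U V : D, m (U ⊗ V) =
      (α_ U V X).hom ≫ U ◁ m V ≫ (α_ U X V).inv ≫ m U ▷ V ≫ (α_ X U V).hom)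
    (unit : m (𝟙_ D) = (λ_ X).hom ≫ (ρ_ X).inv) (U Y : D) [ExactPairing U Y] : IsIso (m U) := by
  have h1 : η_ U Y ▷ X ≫ m (U ⊗ Y) = (λ_ X).hom ≫ (ρ_ X).inv ≫ X ◁ η_ U Y := by
    rw [natural, unit, Category.assoc]
  have h2 : m (Y ⊗ U) ≫ X ◁ ε_ U Y = ε_ U Y ▷ X ≫ (λ_ X).hom ≫ (ρ_ X).inv := by
    rw [← natural, unit]
  rw [tensor] at h1 h2
  refine ⟨𝟙 (X ⊗ U) ⊗≫ η_ U Y ▷ (X ⊗ U) ⊗≫ U ◁ m Y ▷ U ⊗≫ (U ⊗ X) ◁ ε_ U Y ⊗≫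
    𝟙 (U ⊗ X), ?_, ?_⟩
  · calc
      _ = 𝟙 (U ⊗ X) ⊗≫ (𝟙_ D ◁ m U ≫ η_ U Y ▷ (X ⊗ U)) ⊗≫ U ◁ m Y ▷ U ⊗≫ (U ⊗ X) ◁ ε_ U Y ⊗≫
          𝟙 (U ⊗ X) := by
        monoidal
      _ = 𝟙 (U ⊗ X) ⊗≫ η_ U Y ▷ (U ⊗ X) ⊗≫ U ◁ (((α_ Y U X).hom ≫ Y ◁ m U ≫ (α_ Y X U).inv ≫ m Y ▷ U ≫
          (α_ X Y U).hom) ≫ X ◁ ε_ U Y) ⊗≫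
          𝟙 (U ⊗ X) := by
        rw [whisker_exchange]; monoidal
      _ = 𝟙 (U ⊗ X) ⊗≫ (η_ U Y ▷ U ⊗≫ U ◁ ε_ U Y) ▷ X ⊗≫
          𝟙 (U ⊗ X) := by
        rw [h2]; monoidal
      _ = _ := by
        rw [ExactPairing.evaluation_coevaluation'']; monoidal
  · calc
      _ = 𝟙 (X ⊗ U) ⊗≫ η_ U Y ▷ (X ⊗ U) ⊗≫ U ◁ m Y ▷ U ⊗≫ ((U ⊗ X) ◁ ε_ U Y ≫ m U ▷ 𝟙_ D) ⊗≫
          𝟙 (X ⊗ U) := by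
        monoidal
      _ = 𝟙 (X ⊗ U) ⊗≫ (η_ U Y ▷ X ≫ (α_ U Y X).hom ≫ U ◁ m Y ≫ (α_ U X Y).inv ≫ m U ▷ Y ≫
          (α_ X U Y).hom) ▷ U ⊗≫ X ◁ U ◁ ε_ U Y ⊗≫
          𝟙 (X ⊗ U) := by
        rw [whisker_exchange]; monoidal
      _ = 𝟙 (X ⊗ U) ⊗≫ X ◁ (η_ U Y ▷ U ⊗≫ U ◁ ε_ U Y) ⊗≫
          𝟙 (X ⊗ U) := by
        rw [h1]; monoidal
      _ = _ := by
        rw [ExactPairing.evaluation_coevaluation'']; monoidal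

/-- A half-braiding from its inverse. -/
noncomputable def CategoryTheory.HalfBraiding.ofInv
    (natural : ∀ {U V : D} (f : U ⟶ V), f ▷ X ≫ m V = m U ≫ X ◁ f)
    (tensor : ∀ U V : D, m (U ⊗ V) =
      (α_ U V X).hom ≫ U ◁ m V ≫ (α_ U X V).inv ≫ m U ▷ V ≫ (α_ X U V).hom)
    (iso : ∀ U, IsIso (m U)) : HalfBraiding X where
  β U := (asIso (m U)).symm
  monoidal U V := by
    rw [← cancel_epi (asIso (m (U ⊗ V))).hom]
    simp only [Iso.symm_hom, Iso.hom_inv_id]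
    rw [asIso_hom, tensor]
    have h (U : D) : m U ≫ (asIso (m U)).inv = 𝟙 _ := (asIso (m U)).hom_inv_id
    simp only [Category.assoc, Iso.hom_inv_id_assoc, ← comp_whiskerRight_assoc, h,
      id_whiskerRight, Category.id_comp, Iso.inv_hom_id_assoc,
      ← MonoidalCategory.whiskerLeft_comp_assoc, MonoidalCategory.whiskerLeft_id, Iso.hom_inv_id]
  naturality {U V} f := by
    rw [← cancel_epi (asIso (m U)).hom, ← cancel_mono (asIso (m V)).hom]
    have h1 : m U ≫ (asIso (m U)).inv = 𝟙 _ := (asIso (m U)).hom_inv_id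
    have h2 : (asIso (m V)).inv ≫ m V = 𝟙 _ := (asIso (m V)).inv_hom_id
    simp only [Iso.symm_hom, Category.assoc, asIso_hom, natural, reassoc_of% h1, h2,
      Category.comp_id]

end Inverse

section Dual

variable {X X' : D} (b : HalfBraiding X) (Q : ExactPairing X' X)

/-- The inverse of the half-braiding of a left dual. -/
def CategoryTheory.HalfBraiding.dualInv (U : D) : U ⊗ X' ⟶ X' ⊗ U :=
  𝟙 _ ⊗≫ Q.coevaluation' ▷ (U ⊗ X') ⊗≫ X' ◁ (b.β U).hom ▷ X' ⊗≫ (X' ⊗ U) ◁ Q.evaluation' ⊗≫ 𝟙 _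

theorem CategoryTheory.ExactPairing.zigzag (Q : ExactPairing X' X) : X ◁ Q.coevaluation' ⊗≫ Q.evaluation' ▷ X = ⊗𝟙.hom :=
  ExactPairing.coevaluation_evaluation'' X' X

/-- Once `dualInv` is inverted, this says that the coevaluation respects half-braidings;
`dualInv_evaluation` plays the same role for the evaluation. -/
theorem CategoryTheory.HalfBraiding.coevaluation_dualInv (U : D) :
    (ρ_ U).inv ≫ U ◁ Q.coevaluation' ≫ (α_ U X' X).inv ≫ b.dualInv Q U ▷ X =
      (λ_ U).inv ≫ Q.coevaluation' ▷ U ≫ (α_ X' X U).hom ≫ X' ◁ (b.β U).hom ≫ (α_ X' U X).inv := by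
  rw [dualInv]
  calc
    _ = 𝟙 _ ⊗≫ (𝟙_ D ◁ (U ◁ Q.coevaluation') ≫ Q.coevaluation' ▷ (U ⊗ (X' ⊗ X))) ⊗≫
        X' ◁ (b.β U).hom ▷ X' ▷ X ⊗≫ (X' ⊗ U) ◁ Q.evaluation' ▷ X ⊗≫ 𝟙 _ := by
      monoidal
    _ = 𝟙 _ ⊗≫ Q.coevaluation' ▷ U ⊗≫
        X' ◁ ((X ⊗ U) ◁ Q.coevaluation' ≫ (b.β U).hom ▷ (X' ⊗ X)) ⊗≫
        (X' ⊗ U) ◁ Q.evaluation' ▷ X ⊗≫ 𝟙 _ := by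
      rw [whisker_exchange]; monoidal
    _ = 𝟙 _ ⊗≫ Q.coevaluation' ▷ U ⊗≫ X' ◁ (b.β U).hom ⊗≫
        (X' ⊗ U) ◁ (X ◁ Q.coevaluation' ⊗≫ Q.evaluation' ▷ X) ⊗≫ 𝟙 _ := by
      rw [whisker_exchange]; monoidal
    _ = _ := by
      rw [ExactPairing.zigzag]; monoidal

theorem CategoryTheory.HalfBraiding.dualInv_evaluation (U : D) :
    X ◁ b.dualInv Q U ≫ (α_ X X' U).inv ≫ Q.evaluation' ▷ U ≫ (λ_ U).hom =
      (α_ X U X').inv ≫ (b.β U).hom ▷ X' ≫ (α_ U X X').hom ≫ U ◁ Q.evaluation' ≫ (ρ_ U).hom := by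
  rw [dualInv]
  calc
    _ = 𝟙 _ ⊗≫ X ◁ Q.coevaluation' ▷ (U ⊗ X') ⊗≫ X ◁ X' ◁ (b.β U).hom ▷ X' ⊗≫
        ((X ⊗ X') ◁ (U ◁ Q.evaluation') ≫ Q.evaluation' ▷ (U ⊗ 𝟙_ D)) ⊗≫ 𝟙 _ := by
      monoidal
    _ = 𝟙 _ ⊗≫ X ◁ Q.coevaluation' ▷ (U ⊗ X') ⊗≫
        ((X ⊗ X') ◁ ((b.β U).hom ▷ X') ≫ Q.evaluation' ▷ ((U ⊗ X) ⊗ X')) ⊗≫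
        U ◁ Q.evaluation' ⊗≫ 𝟙 _ := by
      rw [whisker_exchange]; monoidal
    _ = 𝟙 _ ⊗≫ (X ◁ Q.coevaluation' ⊗≫ Q.evaluation' ▷ X) ▷ (U ⊗ X') ⊗≫ (b.β U).hom ▷ X' ⊗≫
        U ◁ Q.evaluation' ⊗≫ 𝟙 _ := by
      rw [whisker_exchange]; monoidal
    _ = _ := by
      rw [ExactPairing.zigzag]; monoidal

theorem CategoryTheory.HalfBraiding.dualInv_naturality {U V : D} (f : U ⟶ V) :
    f ▷ X' ≫ b.dualInv Q V = b.dualInv Q U ≫ X' ◁ f := by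
  rw [dualInv, dualInv]
  calc
    _ = 𝟙 _ ⊗≫ (𝟙_ D ◁ f ▷ X' ≫ Q.coevaluation' ▷ (V ⊗ X')) ⊗≫ X' ◁ (b.β V).hom ▷ X' ⊗≫
        (X' ⊗ V) ◁ Q.evaluation' ⊗≫ 𝟙 _ := by
      monoidal
    _ = 𝟙 _ ⊗≫ Q.coevaluation' ▷ (U ⊗ X') ⊗≫ X' ◁ (X ◁ f ≫ (b.β V).hom) ▷ X' ⊗≫
        (X' ⊗ V) ◁ Q.evaluation' ⊗≫ 𝟙 _ := by
      rw [whisker_exchange]; monoidal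
    _ = 𝟙 _ ⊗≫ Q.coevaluation' ▷ (U ⊗ X') ⊗≫ X' ◁ (b.β U).hom ▷ X' ⊗≫
        X' ◁ (f ▷ (X ⊗ X') ≫ V ◁ Q.evaluation') ⊗≫ 𝟙 _ := by
      rw [b.naturality]; monoidal
    _ = _ := by
      rw [← whisker_exchange]; monoidal

theorem CategoryTheory.HalfBraiding.dualInv_tensor (U V : D) : b.dualInv Q (U ⊗ V) =
    (α_ U V X').hom ≫ U ◁ b.dualInv Q V ≫ (α_ U X' V).inv ≫ b.dualInv Q U ▷ V ≫
      (α_ X' U V).hom := by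
  symm
  rw [dualInv.eq_1 b Q U]
  calc
    _ = 𝟙 _ ⊗≫ (𝟙_ D ◁ (U ◁ b.dualInv Q V) ≫ Q.coevaluation' ▷ (U ⊗ (X' ⊗ V))) ⊗≫
        X' ◁ (b.β U).hom ▷ (X' ⊗ V) ⊗≫ (X' ⊗ U) ◁ Q.evaluation' ▷ V ⊗≫ 𝟙 _ := by
      monoidal
    _ = 𝟙 _ ⊗≫ Q.coevaluation' ▷ (U ⊗ (V ⊗ X')) ⊗≫
        X' ◁ ((X ⊗ U) ◁ b.dualInv Q V ≫ (b.β U).hom ▷ (X' ⊗ V)) ⊗≫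
        (X' ⊗ U) ◁ Q.evaluation' ▷ V ⊗≫ 𝟙 _ := by
      rw [whisker_exchange]; monoidal
    _ = 𝟙 _ ⊗≫ Q.coevaluation' ▷ (U ⊗ (V ⊗ X')) ⊗≫ X' ◁ (b.β U).hom ▷ (V ⊗ X') ⊗≫
        (X' ⊗ U) ◁ (X ◁ b.dualInv Q V ≫ (α_ X X' V).inv ≫ Q.evaluation' ▷ V ≫ (λ_ V).hom) ⊗≫
          𝟙 _ := by
      rw [whisker_exchange]; monoidal
    _ = _ := by
      rw [dualInv_evaluation, dualInv, b.monoidal]; monoidal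

theorem CategoryTheory.HalfBraiding.dualInv_unit (hb : (b.β (𝟙_ D)).hom = (ρ_ X).hom ≫ (λ_ X).inv) :
    b.dualInv Q (𝟙_ D) = (λ_ X').hom ≫ (ρ_ X').inv := by
  rw [dualInv, hb]
  calc
    _ = 𝟙 _ ⊗≫ (Q.coevaluation' ▷ X' ⊗≫ X' ◁ Q.evaluation') ⊗≫ 𝟙 _ := by monoidal
    _ = _ := by
      have h : Q.coevaluation' ▷ X' ⊗≫ X' ◁ Q.evaluation' = ⊗𝟙.hom :=
        ExactPairing.evaluation_coevaluation'' X' X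
      rw [h]; monoidal

/-- The half-braiding of a left dual. -/
@[reducible]
noncomputable def CategoryTheory.HalfBraiding.dual (hb : (b.β (𝟙_ D)).hom = (ρ_ X).hom ≫ (λ_ X).inv)
    (E : ∀ U : D, TwoSidedDual U) : HalfBraiding X' :=
  HalfBraiding.ofInv (b.dualInv Q) (b.dualInv_naturality Q) (b.dualInv_tensor Q) fun U =>
    @isIso_of_natural_of_tensor D _ _ X' (b.dualInv Q) (b.dualInv_naturality Q)
      (b.dualInv_tensor Q) (b.dualInv_unit Q hb) U (E U).dual (E U).right

variable (hb : (b.β (𝟙_ D)).hom = (ρ_ X).hom ≫ (λ_ X).inv) (E : ∀ U : D, TwoSidedDual U)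

theorem CategoryTheory.HalfBraiding.dual_β_inv (U : D) : ((b.dual Q hb E).β U).inv = b.dualInv Q U := rfl

theorem CategoryTheory.HalfBraiding.isHom_coevaluation :
    (halfBraidingStr D).IsHom (halfBraidingStr D).unit
      ((halfBraidingStr D).tensor (b.dual Q hb E) b) Q.coevaluation' := by
  intro U
  change Q.coevaluation' ▷ U ≫ (α_ X' X U).hom ≫ X' ◁ (b.β U).hom ≫ (α_ X' U X).inv ≫
    ((b.dual Q hb E).β U).hom ▷ X ≫ (α_ U X' X).hom = ((λ_ U).hom ≫ (ρ_ U).inv) ≫ _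
  have h := b.coevaluation_dualInv Q U
  rw [← cancel_epi (λ_ U).inv, ← reassoc_of% h, ← b.dual_β_inv Q hb E,
    ← comp_whiskerRight_assoc, Iso.inv_hom_id]
  simp

theorem CategoryTheory.HalfBraiding.isHom_evaluation :
    (halfBraidingStr D).IsHom ((halfBraidingStr D).tensor b (b.dual Q hb E))
      (halfBraidingStr D).unit Q.evaluation' := by
  intro U
  change Q.evaluation' ▷ U ≫ (λ_ U).hom ≫ (ρ_ U).inv = ((α_ X X' U).hom ≫
    X ◁ ((b.dual Q hb E).β U).hom ≫ (α_ X U X').inv ≫ (b.β U).hom ▷ X' ≫ (α_ U X X').hom) ≫ _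
  have h := b.dualInv_evaluation Q U
  rw [← cancel_mono (ρ_ U).hom]
  simp only [Category.assoc]
  rw [← h, ← b.dual_β_inv Q hb E, ← MonoidalCategory.whiskerLeft_comp_assoc, Iso.hom_inv_id]
  simp

end Dual

end HalfBraidings

/-! ### Half-braidings of the embedded objects and the resulting braiding. -/

section

variable {C : Type u} [Category.{v} C] [MonoidalCategory C] [BraidedCategory C]

theorem cr_comp_braiding_inv (B : C) {V A W U : C} (f : V ⊗ A ⟶ W ⊗ U) :
    cr V B A ≫ B ◁ f ≫ tail (β_ W B).inv U = V ◁ (β_ A B).inv ≫ tail f B ≫ W ◁ (β_ U B).hom := by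
  have h := BraidedCategory.braiding_naturality_left f B
  simp only [BraidedCategory.braiding_tensor_left_hom, Category.assoc] at h
  rw [← cancel_epi (V ◁ (β_ A B).hom), ← cancel_epi (α_ V A B).hom, ← cancel_mono (cr W B U)]
  simp only [Category.assoc, cr, tail_comp, Iso.inv_hom_id, tail_id, Category.comp_id,
    ← whiskerLeft_comp_assoc, Iso.hom_inv_id, whiskerLeft_id, Category.id_comp]
  simp only [tail, Category.assoc, Iso.hom_inv_id_assoc]
  exact h.symm

set_option linter.unusedSimpArgs false in
-- In `intTensor` the contravariant strand V already passes over B. The crossing of B with W that is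
-- natural alongside it also keeps B underneath, hence the inverse braiding.
theorem intTensor_braiding_inv (B : C) {V A W U : C} (f : V ⊗ A ⟶ W ⊗ U) :
    ((λ_ V).hom ≫ (ρ_ V).inv) ▷ (B ⊗ A) ≫ intTensor (β_ (𝟙_ C) B).hom f ≫
        (β_ W B).inv ▷ (U ⊗ 𝟙_ C) =
      (𝟙_ C ⊗ V) ◁ (β_ A B).inv ≫ intTensor f (β_ (𝟙_ C) B).hom ≫
        (W ⊗ B) ◁ ((λ_ U).hom ≫ (ρ_ U).inv) := by
  trans (λ_ V).hom ▷ (B ⊗ A) ≫ (cr V B A ≫ B ◁ f ≫ tail (β_ W B).inv U) ≫ (α_ W B U).inv ≫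
    (W ⊗ B) ◁ (ρ_ U).inv
  · simp only [intTensor, cr, tail, braiding_tensorUnit_right, braiding_tensorUnit_left,
      BraidedCategory.braiding_tensor_right_hom, BraidedCategory.braiding_tensor_left_hom]
    monoidal
  · rw [cr_comp_braiding_inv]
    simp only [intTensor, cr, tail, braiding_tensorUnit_right, braiding_tensorUnit_left,
      BraidedCategory.braiding_tensor_right_hom, BraidedCategory.braiding_tensor_left_hom]
    monoidal

end

namespace IntObj

variable {C : Type u} [Category.{v} C] [MonoidalCategory C] [BraidedCategory C]
  [BraidedTracedCategory C]

/-- The components of the half-braiding of an object in the image of the embedding. -/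
@[reducible]
def inclβ (B : C) (Z : IntObj C) : (incl C).obj B ⊗ Z ≅ Z ⊗ (incl C).obj B :=
  pairIso (X := (incl C).obj B ⊗ Z) (Y := Z ⊗ (incl C).obj B) (β_ Z.pos B).symm
    (λ_ Z.neg ≪≫ (ρ_ Z.neg).symm)

theorem inclβ_hom (B : C) (Z : IntObj C) : (inclβ B Z).hom =
    pair (X := (incl C).obj B ⊗ Z) (Y := Z ⊗ (incl C).obj B) (β_ Z.pos B).inv
      ((λ_ Z.neg).hom ≫ (ρ_ Z.neg).inv) := rfl

/-- The half-braiding of an object in the image of the embedding. -/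
@[reducible]
def inclHalfBraiding (B : C) : HalfBraiding ((incl C).obj B) where
  β := inclβ B
  monoidal U V := by
    rw [inclβ_hom, inclβ_hom, inclβ_hom, pair_whiskerRight, whiskerLeft_pair, associator_eq,
      associator_eq, associator_eq, pairIso_inv, pairIso_hom, pairIso_inv, pair_comp_pair,
      pair_comp_pair, pair_comp_pair, pair_comp_pair]
    congr 1
    · change (β_ (U.pos ⊗ V.pos) B).inv = (α_ B U.pos V.pos).inv ≫ (β_ U.pos B).inv ▷ V.pos ≫
        (α_ U.pos B V.pos).hom ≫ U.pos ◁ (β_ V.pos B).inv ≫ (α_ U.pos V.pos B).inv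
      simp [BraidedCategory.braiding_tensor_left_inv]
    · change (λ_ (V.neg ⊗ U.neg)).hom ≫ (ρ_ (V.neg ⊗ U.neg)).inv =
        ((((α_ (𝟙_ C) V.neg U.neg).inv ≫ ((λ_ V.neg).hom ≫ (ρ_ V.neg).inv) ▷ U.neg) ≫
          (α_ V.neg (𝟙_ C) U.neg).hom) ≫ V.neg ◁ ((λ_ U.neg).hom ≫ (ρ_ U.neg).inv)) ≫
            (α_ V.neg U.neg (𝟙_ C)).inv
      monoidal
  naturality {U V} f := by
    apply hom_ext
    rw [inclβ_hom, inclβ_hom, pair_comp_hom, comp_pair_hom]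
    exact intTensor_braiding_inv B f.hom

theorem inclHalfBraiding_unit (B : C) :
    ((inclHalfBraiding B).β (𝟙_ (IntObj C))).hom = (ρ_ _).hom ≫ (λ_ _).inv := by
  rw [inclβ_hom, rightUnitor_eq, leftUnitor_eq, pairIso_hom, pairIso_inv, pair_comp_pair]
  congr 1
  · change (β_ (𝟙_ C) B).inv = (ρ_ B).hom ≫ (λ_ B).inv
    rw [braiding_inv_tensorUnit_left]
  · change (λ_ (𝟙_ C)).hom ≫ (ρ_ (𝟙_ C)).inv = (ρ_ (𝟙_ C)).hom ≫ (λ_ (𝟙_ C)).inv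
    monoidal

theorem inclHalfBraiding_map {A B : C} (f : A ⟶ B) :
    (halfBraidingStr (IntObj C)).IsHom (inclHalfBraiding A) (inclHalfBraiding B)
      ((incl C).map f) := by
  intro U
  rw [inclβ_hom, inclβ_hom, incl_map, pair_whiskerRight, whiskerLeft_pair, pair_comp_pair,
    pair_comp_pair]
  congr 1
  · change f ▷ U.pos ≫ (β_ U.pos B).inv = (β_ U.pos A).inv ≫ U.pos ◁ f
    simp
  · change ((λ_ U.neg).hom ≫ (ρ_ U.neg).inv) ≫ U.neg ◁ 𝟙 (𝟙_ C) =
      𝟙 (𝟙_ C) ▷ U.neg ≫ (λ_ U.neg).hom ≫ (ρ_ U.neg).inv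
    simp

theorem inclHalfBraiding_μ (A B : C) :
    (halfBraidingStr (IntObj C)).IsHom ((halfBraidingStr (IntObj C)).tensor
      (inclHalfBraiding A) (inclHalfBraiding B)) (inclHalfBraiding (A ⊗ B))
        (Functor.LaxMonoidal.μ (incl C) A B) := by
  intro U
  change _ = ((α_ _ _ _).hom ≫ (incl C).obj A ◁ (inclβ B U).hom ≫ (α_ _ _ _).inv ≫
    (inclβ A U).hom ▷ (incl C).obj B ≫ (α_ _ _ _).hom) ≫ _
  rw [incl_μ, inclμ_hom, inclβ_hom, inclβ_hom, inclβ_hom, pair_whiskerRight, pair_whiskerRight,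
    whiskerLeft_pair, whiskerLeft_pair, associator_eq, associator_eq, associator_eq, pairIso_hom,
    pairIso_inv, pairIso_hom, pair_comp_pair, pair_comp_pair, pair_comp_pair, pair_comp_pair,
    pair_comp_pair, pair_comp_pair]
  congr 1
  · change 𝟙 (A ⊗ B) ▷ U.pos ≫ (β_ U.pos (A ⊗ B)).inv = ((α_ A B U.pos).hom ≫
      A ◁ (β_ U.pos B).inv ≫ (α_ A U.pos B).inv ≫ (β_ U.pos A).inv ▷ B ≫ (α_ U.pos A B).hom) ≫
        U.pos ◁ 𝟙 (A ⊗ B)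
    simp [BraidedCategory.braiding_tensor_right_inv]
  · change ((λ_ U.neg).hom ≫ (ρ_ U.neg).inv) ≫ U.neg ◁ (λ_ (𝟙_ C)).inv =
      (λ_ (𝟙_ C)).inv ▷ U.neg ≫ ((((α_ (𝟙_ C) (𝟙_ C) U.neg).hom ≫
        𝟙_ C ◁ ((λ_ U.neg).hom ≫ (ρ_ U.neg).inv)) ≫ (α_ (𝟙_ C) U.neg (𝟙_ C)).inv) ≫
          ((λ_ U.neg).hom ≫ (ρ_ U.neg).inv) ▷ 𝟙_ C) ≫ (α_ U.neg (𝟙_ C) (𝟙_ C)).hom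
    monoidal

theorem inclHalfBraiding_ε :
    (halfBraidingStr (IntObj C)).IsHom (halfBraidingStr (IntObj C)).unit
      (inclHalfBraiding (𝟙_ C)) (Functor.LaxMonoidal.ε (incl C)) := by
  intro U
  change _ = ((λ_ U).hom ≫ (ρ_ U).inv) ≫ _
  rw [incl_ε, inclβ_hom, rightUnitor_eq, leftUnitor_eq, pairIso_hom, pairIso_inv, pair_comp_pair,
    id_whiskerRight, whiskerLeft_id, Category.comp_id]
  refine (Category.id_comp _).trans ?_
  congr 1
  · change (β_ U.pos (𝟙_ C)).inv = (λ_ U.pos).hom ≫ (ρ_ U.pos).inv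
    rw [braiding_inv_tensorUnit_right]

variable (C) in
/-- The half-braidings of the generators. -/
@[reducible]
noncomputable def halfBraidingLift (E : ∀ Z : IntObj C, TwoSidedDual Z) :
    (dualGenerated C).Lift (halfBraidingStr (IntObj C)) where
  φ := inclHalfBraiding
  σ S := (inclHalfBraiding S).dual (starIncl S) (inclHalfBraiding_unit S) E
  map := inclHalfBraiding_map
  μ := inclHalfBraiding_μ
  ε := inclHalfBraiding_ε
  coevaluation S := (inclHalfBraiding S).isHom_coevaluation (starIncl S)
    (inclHalfBraiding_unit S) E
  evaluation S := (inclHalfBraiding S).isHom_evaluation (starIncl S)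
    (inclHalfBraiding_unit S) E

end IntObj

section

variable {D : Type u} [Category.{v} D] [MonoidalCategory D]

/-- The braiding given by a monoidal family of half-braidings. -/
@[reducible]
def braidedOfHalfBraidings (b : ∀ Z : D, HalfBraiding Z)
    (hom : ∀ {Z W : D} (f : Z ⟶ W), (halfBraidingStr D).IsHom (b Z) (b W) f)
    (hom_tensor : ∀ Z W, (halfBraidingStr D).IsHom (b (Z ⊗ W))
      ((halfBraidingStr D).tensor (b Z) (b W)) (𝟙 (Z ⊗ W))) : BraidedCategory D where
  braiding X Y := (b X).β Y
  braiding_naturality_right X _ _ f := (b X).naturality f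
  braiding_naturality_left f Z := hom f Z
  hexagon_forward X Y Z := by
    rw [(b X).monoidal]
    simp
  hexagon_reverse X Y Z := by
    have h := hom_tensor X Y Z
    rw [id_whiskerRight, Category.id_comp, MonoidalCategory.whiskerLeft_id,
      Category.comp_id] at h
    rw [← h]
    change (α_ X Y Z).inv ≫ ((α_ X Y Z).hom ≫ X ◁ ((b Y).β Z).hom ≫ (α_ X Z Y).inv ≫
      ((b X).β Z).hom ▷ Y ≫ (α_ Z X Y).hom) ≫ (α_ Z X Y).inv = _
    simp

end

namespace IntObj

variable {C : Type u} [Category.{v} C] [MonoidalCategory C] [BraidedCategory C]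
  [BraidedTracedCategory C]

theorem incl_braided (A B : C) :
    Functor.LaxMonoidal.μ (incl C) A B ≫ (incl C).map (β_ A B).hom =
      (inclβ B ((incl C).obj A)).inv ≫ Functor.LaxMonoidal.μ (incl C) B A := by
  rw [incl_μ, incl_μ, inclμ_hom, inclμ_hom, incl_map, pairIso_inv, pair_comp_pair,
    pair_comp_pair]
  congr 1
  · change 𝟙 (A ⊗ B) ≫ (β_ A B).hom = (β_ A B).hom ≫ 𝟙 (B ⊗ A)
    simp
  · change 𝟙 (𝟙_ C) ≫ (λ_ (𝟙_ C)).inv =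
      (λ_ (𝟙_ C)).inv ≫ (ρ_ (𝟙_ C)).hom ≫ (λ_ (𝟙_ C)).inv
    monoidal

end IntObj

open IntObj in
theorem mainTheorem1 (C : Type u) [Category.{v} C] [MonoidalCategory C] [BraidedCategory C]
    [BraidedTracedCategory C] :
    ∃ (IntC : Type u) (_ : Category.{v} IntC) (_ : MonoidalCategory IntC)
      (_ : BraidedCategory IntC) (_ : PivotalCategory IntC)
      (F : C ⥤ IntC) (_ : F.Braided),
      F.Full ∧ F.Faithful ∧
      PreservesRightTrace F RightTracedCategory.trR (pivotalTrR IntC) ∧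
      PreservesLeftTrace F LeftTracedCategory.trL (pivotalTrL IntC) ∧
      ∀ Z : IntC, ∃ A U : C, Nonempty (Z ≅ F.obj A ⊗ dualObj (F.obj U)) := by
  obtain ⟨h, hom, hom_tensor, hom_unit, hφ⟩ := (dualLift C).exists_extension
  -- The two-sided duals `h` come first: they supply the right duals that make the half-braidings on
  -- the objects `star S` invertible.
  obtain ⟨b, b_hom, b_tensor, -, hb⟩ := (halfBraidingLift C h).exists_extension
  have hβ (A B : C) : (b ((incl C).obj B)).β ((incl C).obj A) = inclβ B ((incl C).obj A) := by
    have h' := hb B ((incl C).obj A)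
    rw [id_whiskerRight, Category.id_comp, MonoidalCategory.whiskerLeft_id,
      Category.comp_id] at h'
    exact Iso.ext h'.symm
  let B := braidedOfHalfBraidings b b_hom b_tensor
  -- The half-braidings of embedded objects use inverse crossings, so the braiding they define
  -- restricts to the inverse of σ; reversing it makes the embedding braided.
  refine ⟨IntObj C, inferInstance, inferInstance, reverseBraiding (IntObj C),
    TwoSidedDual.pivotal h hom hom_tensor hom_unit, incl C,
    @Functor.Braided.mk _ _ _ _ _ _ _ (reverseBraiding (IntObj C)) (incl C) inclMonoidal ?_,
    incl_full, incl_faithful, ?_, ?_, ?_⟩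
  · intro X Y
    refine (incl_braided X Y).trans ?_
    rw [← hβ]
    rfl
  · intro X A B f
    refine ((inclDual_trR X f).symm.trans ?_).trans
      (TwoSidedDual.pivotalTrR_eq h hom hom_tensor hom_unit _ _).symm
    rw [← μ_incl_map_δ]
    -- The chosen dual `h` of an embedded object need not be `inclDual`; it is compatible with it
    -- through the identity, and that determines the trace.
    exact (TwoSidedDual.trR_congr (hφ X) _).symm
  · intro X A B f
    refine ((inclDual_trL X f).symm.trans ?_).trans
      (TwoSidedDual.pivotalTrL_eq h hom hom_tensor hom_unit _ _).symm
    rw [← μ_incl_map_δ]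
    exact (TwoSidedDual.trL_congr (hφ X) _).symm
  · intro Z
    obtain ⟨A, U, ⟨e⟩⟩ := (dualGenerated C).exists_iso Z
    -- `star U` and the dual chosen by `h` are both left duals of FU.
    exact ⟨A, U, ⟨e.symm ≪≫ whiskerLeftIso _
      (leftDualIso (starIncl U) (h ((incl C).obj U)).left)⟩⟩
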